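/- Let $\sigma^2>0$, $\vartheta_2>0$, $\vartheta_1,\vartheta_0\in\mathbb R$ satisfy $\frac{\vartheta_1^2}{4\vartheta_2^2}-\frac{\vartheta_0}{\vartheta_2}+\pi^2>0$. Put $\kappa=\vartheta_1/\vartheta_2$, $\langle u,v\rangle=\int_0^1u(x)v(x)e^{\kappa x}\,dx$, and, for $\ell\ge1$, $$e_\ell(y)=\sqrt2\,\sin(\pi\ell y)\,e^{-\kappa y/2},\qquad \lambda_\ell=\pi^2\vartheta_2\ell^2+\frac{\vartheta_1^2}{4\vartheta_2}-\vartheta_0 .$$ Let $X=(X_t(x),\,t\ge0,\,x\in[0,1])$ be the (continuous version of the) weak solution of $$dX_t=\Big(\vartheta_2\tfrac{\partial^2}{\partial x^2}X_t+\vartheta_1\tfrac{\partial}{\partial x}X_t+\vartheta_0X_t\Big)dt+\sigma\,dW_t,\qquad X_t(0)=X_t(1)=0,\qquad X_0=\xi,$$ where $W$ is a cylindrical Brownian motion on $L^2([0,1])$ with the inner product $\langle\cdot,\cdot\rangle$, that is, a centered Gaussian family with $\mathrm{Cov}(W_s(u),W_t(v))=(s\wedge t)\langle u,v\rangle$, and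 $\xi$ is independent of $W$. The initial condition is either $\xi=0$ (zero) or such that the variables $\langle\xi,e_\ell\rangle$, $\ell\ge1$, are independent with $\langle \xi,e_\ell\rangle\sim\mathcal N(0,\sigma^2/(2\lambda_\ell))$ (stationary). For integers $N,M,L\ge1$ and real $T>0$ let $\Delta=T/N$, $t_i=iT/N$, $y_k=k/M$ and $$\mathcal X=(X_{t_i}(y_k),\;0\le i\le N,\;0\le k\le M).$$ Let $\mathcal X^L=(X^L_{t_i}(y_k),\;0\le i\le N,\;0\le k\le M)$ be the output of the replacement method, defined as follows. For $1\le m<M$ let $\mathcal I_m=\{m+2nM:n\ge0\}\cup\{2M-m+2nM:n\ge0\}$ and $s_m^2=\sum_{\ell\in\mathcal I_m,\,\ell\ge LM}\frac{\sigma^2}{2\lambda_\ell}$. For every $m$ and every $\ell\in\mathcal I_m$ with $\ell<LM$, simulate $$u_\ell(t_{i+1})=e^{-\lambda_\ell\Delta}u_\ell(t_i)+\sigma\sqrt{\tfrac{1-e^{-2\lambda_\ell\Delta}}{2\lambda_\ell}}\,N_i^\ell,\qquad 0\le i<N,$$ where $u_\ell(0)=0$ for the zero initial condition and $u_\ell(0)\sim\mathcal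 N(0,\sigma^2/(2\lambda_\ell))$ for the stationary one; generate $R_m^L(i)\sim\mathcal N(0,s_m^2)$, $0\le i\le N$, except that $R_m^L(0)=0$ for the zero initial condition. Here the $N_i^\ell$ are standard normal, and all the variables $u_\ell(0)$, $N_i^\ell$, $R_m^L(i)$ are independent. Finally put $$U_m^L(t_i)=\sum_{\ell\in\mathcal I_m,\,\ell<LM}u_\ell(t_i)+R_m^L(i),\qquad X^L_{t_i}(y_k)=\sum_{m=1}^{M-1}U_m^L(t_i)\,e_m(y_k).$$ Write $\mathrm{TV}(\mathcal X,\mathcal X^L)=\sup_A|P(\mathcal X\in A)-P(\mathcal X^L\in A)|$, the supremum being over all Borel sets $A$. Then, for either initial condition: (i) There are constants $c,C>0$ depending only on $(\sigma^2,\vartheta_2,\vartheta_1,\vartheta_0)$ such that, for all integers $N,M,L\ge1$ and all $T>0$, $$\mathrm{TV}(\mathcal X,\mathcal X^L)\le C\sqrt{MN}\,e^{-cL^2M^2\Delta}.$$ (ii) Let $T=T_n>0$ and $N=N_n,\,M=M_n,\,L=L_n\ge1$ depend on $n\in\mathbb N$. If $T\Delta^q\to0$ for some $q>0$ and $LM\Delta^\alpha\to\infty$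 for some $\alpha>1/2$ as $n\to\infty$, then $\mathrm{TV}(\mathcal X,\mathcal X^L)\to0$. In particular, if $T>0$ is constant and $M/N^\alpha\to\infty$ for some $\alpha>1/2$, then $\mathrm{TV}(\mathcal X,\mathcal X^1)\to0$. -/

import Mathlib

open MeasureTheory ProbabilityTheory Filter Topology
open scoped NNReal

noncomputable section

namespace HeatSPDE

/-- The admissible parameters `(σ², ϑ₂, ϑ₁, ϑ₀)` of the equation. -/
structure Params where
  sigmaSq : ℝ
  theta2 : ℝ
  theta1 : ℝ
  theta0 : ℝ
  sigmaSq_pos : 0 < sigmaSq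
  theta2_pos : 0 < theta2
  spectral_pos : 0 < theta1 ^ 2 / (4 * theta2 ^ 2) - theta0 / theta2 + Real.pi ^ 2

/-- The two initial conditions: `X₀ = 0`, or the stationary law. -/
inductive InitialCondition where
  | zero
  | stationary

namespace Params

variable (p : Params)

/-- `σ`, the positive root of `σ²`. -/
def sigma : ℝ := √p.sigmaSq

/-- `κ = ϑ₁ / ϑ₂`. -/
def kappa : ℝ := p.theta1 / p.theta2

/-- `λ_ℓ = π² ϑ₂ ℓ² + ϑ₁² / (4 ϑ₂) - ϑ₀`. -/
def eigenvalue (l : ℕ) : ℝ :=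
  Real.pi ^ 2 * p.theta2 * (l : ℝ) ^ 2 + p.theta1 ^ 2 / (4 * p.theta2) - p.theta0

/-- `e_ℓ(y) = √2 sin(π ℓ y) exp(-κ y / 2)`. -/
def eigenfunction (l : ℕ) (y : ℝ) : ℝ :=
  √2 * Real.sin (Real.pi * l * y) * Real.exp (-(p.kappa * y / 2))

/-- The weighted inner product `⟨f, g⟩ = ∫₀¹ f(x) g(x) exp(κ x) dx` on functions. -/
def weightedInner (f g : ℝ → ℝ) : ℝ :=
  ∫ x in (0 : ℝ)..1, f x * g x * Real.exp (p.kappa * x)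

/-- The measure `exp(κ x) dx` on `[0, 1]`. -/
def weight : Measure ℝ :=
  (volume.restrict (Set.Icc (0 : ℝ) 1)).withDensity
    (fun x ↦ ENNReal.ofReal (Real.exp (p.kappa * x)))

/-- The Hilbert space `L²([0, 1])` with the weighted inner product. -/
abbrev L2 : Type := Lp ℝ 2 p.weight

end Params

/-- `φ` belongs to `H²((0,1)) ∩ H¹₀((0,1))`, with first and second weak derivatives `φ'` and `φ''`:
`φ''` is square integrable, `φ'` and `φ` are successive primitives (so `φ 0 = 0`), and `φ 1 = 0`. -/
structure DirichletDomain (φ φ' φ'' : ℝ → ℝ) : Prop where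
  memLp : MemLp φ'' 2 (volume.restrict (Set.Icc (0 : ℝ) 1))
  deriv_eq : ∀ x ∈ Set.Icc (0 : ℝ) 1, φ' x = φ' 0 + ∫ y in (0 : ℝ)..x, φ'' y
  eq_integral : ∀ x ∈ Set.Icc (0 : ℝ) 1, φ x = ∫ y in (0 : ℝ)..x, φ' y
  right_eq_zero : φ 1 = 0

section Solution

variable {Ω : Type*} [MeasurableSpace Ω] (p : Params) (ic : InitialCondition) (P : Measure Ω)

/-- `W` is a cylindrical Brownian motion on the weighted `L²([0, 1])`: a linear map sending every
`u` to a process `W_·(u)` that is a standard Brownian motion if `‖u‖ = 1`, with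
`Cov(W_s(u), W_t(v)) = min(s, t) ⟨u, v⟩`, all these variables being jointly Gaussian. -/
structure IsCylindricalBM (W : ℝ≥0 → p.L2 → Ω → ℝ) : Prop where
  linear : ∀ (t : ℝ≥0) (a b : ℝ) (u v : p.L2),
    ∀ᵐ ω ∂P, W t (a • u + b • v) ω = a * W t u ω + b * W t v ω
  brownian : ∀ u : p.L2, ‖u‖ = 1 → IsBrownianReal (fun t ↦ W t u) P
  gaussian : IsGaussianProcess (fun q : ℝ≥0 × p.L2 ↦ W q.1 q.2) P
  covariance : ∀ (s t : ℝ≥0) (u v : p.L2),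
    cov[W s u, W t v; P] = (min s t : ℝ≥0) * inner ℝ u v

/-- The law of the initial value `ξ`: either `ξ = 0`, or the coefficients `⟨ξ, e_ℓ⟩`, `ℓ ≥ 1`, are
independent with `⟨ξ, e_ℓ⟩ ∼ N(0, σ² / (2 λ_ℓ))`. -/
def HasInitialLaw (ξ : ℝ → Ω → ℝ) : Prop :=
  match ic with
  | .zero => ∀ᵐ ω ∂P, ∀ x ∈ Set.Icc (0 : ℝ) 1, ξ x ω = 0
  | .stationary =>
    iIndepFun (fun (j : ℕ) (ω : Ω) ↦
      p.weightedInner (fun x ↦ ξ x ω) (p.eigenfunction (j + 1))) P ∧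
    ∀ l : ℕ, 1 ≤ l → HasLaw
      (fun ω : Ω ↦ p.weightedInner (fun x ↦ ξ x ω) (p.eigenfunction l))
      (gaussianReal 0 (Real.toNNReal (p.sigmaSq / (2 * p.eigenvalue l)))) P

/-- `X = (X_t(x))`, `t ≥ 0`, `x ∈ [0, 1]`, is the (continuous version of the) weak solution of
`dX_t = (ϑ₂ ∂²X_t + ϑ₁ ∂X_t + ϑ₀ X_t) dt + σ dW_t` with Dirichlet boundary condition, driven by the
cylindrical Brownian motion `W`, with an initial value `X₀` that is independent of `W` and has the
law prescribed by `ic`. The operator is self-adjoint for the weighted inner product, so that the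
equation is tested against all `φ` in its domain `H² ∩ H¹₀`. -/
structure IsWeakSolution (W : ℝ≥0 → p.L2 → Ω → ℝ) (X : ℝ → ℝ → Ω → ℝ) : Prop where
  noise : IsCylindricalBM p P W
  aemeasurable : ∀ t : ℝ, 0 ≤ t → ∀ x ∈ Set.Icc (0 : ℝ) 1, AEMeasurable (X t x) P
  continuous : ∀ᵐ ω ∂P, ContinuousOn (fun z : ℝ × ℝ ↦ X z.1 z.2 ω)
    (Set.Ici (0 : ℝ) ×ˢ Set.Icc (0 : ℝ) 1)
  boundary : ∀ᵐ ω ∂P, ∀ t : ℝ, 0 ≤ t → X t 0 ω = 0 ∧ X t 1 ω = 0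
  initial_law : HasInitialLaw p ic P (X 0)
  initial_indep : IndepFun (fun (ω : Ω) (x : Set.Icc (0 : ℝ) 1) ↦ X 0 x ω)
    (fun (ω : Ω) (q : ℝ≥0 × p.L2) ↦ W q.1 q.2 ω) P
  weak_eq : ∀ φ φ' φ'' : ℝ → ℝ, DirichletDomain φ φ' φ'' →
    ∀ u : p.L2, u =ᵐ[p.weight] φ → ∀ t : ℝ≥0, ∀ᵐ ω ∂P,
      p.weightedInner (fun x ↦ X t x ω) φ =
        p.weightedInner (fun x ↦ X 0 x ω) φ +
        (∫ s in (0 : ℝ)..t, p.weightedInner (fun x ↦ X s x ω)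
          (fun x ↦ p.theta2 * φ'' x + p.theta1 * φ' x + p.theta0 * φ x)) +
        p.sigma * W t u ω

/-- The law of the observation vector `(X_{t_i}(y_k))`, `0 ≤ i ≤ N`, `0 ≤ k ≤ M`, where
`t_i = i T / N` and `y_k = k / M`. -/
def observationLaw (X : ℝ → ℝ → Ω → ℝ) (T : ℝ) (N M : ℕ) :
    Measure (Fin (N + 1) → Fin (M + 1) → ℝ) :=
  P.map (fun ω i k ↦ X ((i : ℕ) * T / N) ((k : ℕ) / M) ω)

end Solution

section Replacement

variable (p : Params) (ic : InitialCondition)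

/-- `I_m = {m + 2 n M : n ≥ 0} ∪ {2 M - m + 2 n M : n ≥ 0}`. -/
def modeSet (M m : ℕ) : Set ℕ :=
  {l | ∃ n : ℕ, l = m + 2 * n * M} ∪ {l | ∃ n : ℕ, l = 2 * M - m + 2 * n * M}

open Classical in
/-- `s_m² = ∑_{ℓ ∈ I_m, ℓ ≥ L M} σ² / (2 λ_ℓ)`. -/
def replacementVariance (M L m : ℕ) : ℝ :=
  ∑' l : ℕ, if l ∈ modeSet M m ∧ L * M ≤ l then p.sigmaSq / (2 * p.eigenvalue l) else 0

/-- The initial value of the `ℓ`-th coefficient process, built from a standard normal `z`. -/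
def initialCoefficient (l : ℕ) (z : ℝ) : ℝ :=
  match ic with
  | .zero => 0
  | .stationary => √(p.sigmaSq / (2 * p.eigenvalue l)) * z

/-- The `ℓ`-th coefficient process at the times `0, Δ, 2Δ, …`, simulated through its
AR(1)-structure from standard normal innovations `z`. -/
def arPath (Δ : ℝ) (l : ℕ) (z : ℕ → ℝ) : ℕ → ℝ
  | 0 => initialCoefficient p ic l (z 0)
  | i + 1 => Real.exp (-(p.eigenvalue l * Δ)) * arPath Δ l z i +
      p.sigma * √((1 - Real.exp (-(2 * p.eigenvalue l * Δ))) / (2 * p.eigenvalue l)) * z (i + 1)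

/-- `R_m^L(i) ∼ N(0, s_m²)`, built from a standard normal `z`; for the zero initial condition
`R_m^L(0)` is replaced by `0`. -/
def replacementTerm (M L m i : ℕ) (z : ℝ) : ℝ :=
  match ic, i with
  | .zero, 0 => 0
  | _, _ => √(replacementVariance p M L m) * z

open Classical in
/-- `U_m^L(t_i) = ∑_{ℓ ∈ I_m, ℓ < L M} u_ℓ(t_i) + R_m^L(i)`. The array `z` feeds the AR(1) recursions
and the array `r` feeds the replacement variables. -/
def replacementCoefficient (T : ℝ) (N M L : ℕ) (z r : ℕ → ℕ → ℝ) (m i : ℕ) : ℝ :=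
  ∑ l ∈ (Finset.range (L * M)).filter (fun l ↦ l ∈ modeSet M m), arPath p ic (T / N) l (z l) i +
    replacementTerm p ic M L m i (r m i)

/-- The output `X^L_{t_i}(y_k) = ∑_{m=1}^{M-1} U_m^L(t_i) e_m(y_k)` of the replacement method. -/
def replacementOutput (T : ℝ) (N M L : ℕ) (z r : ℕ → ℕ → ℝ) :
    Fin (N + 1) → Fin (M + 1) → ℝ :=
  fun i k ↦ ∑ m ∈ Finset.Ico 1 M,
    replacementCoefficient p ic T N M L z r m i * p.eigenfunction m ((k : ℕ) / M)

/-- The law of an array of independent standard normal variables. The index `Sum.inl (ℓ, i)` is for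
the `i`-th normal variable in the simulation of `u_ℓ`, and `Sum.inr (m, i)` is for `R_m^L(i)`. -/
def noiseLaw : Measure ((ℕ × ℕ) ⊕ (ℕ × ℕ) → ℝ) :=
  Measure.infinitePi (fun _ ↦ gaussianReal 0 1)

/-- The law of the approximation computed by the replacement method. -/
def replacementLaw (T : ℝ) (N M L : ℕ) : Measure (Fin (N + 1) → Fin (M + 1) → ℝ) :=
  noiseLaw.map (fun w ↦ replacementOutput p ic T N M L
    (fun l i ↦ w (Sum.inl (l, i))) (fun m i ↦ w (Sum.inr (m, i))))

end Replacement

/-- `TV(μ, ν) = sup_A |μ(A) - ν(A)|` over the measurable sets `A`, for probability measures. -/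
def tvDist {α : Type*} [MeasurableSpace α] (μ ν : Measure α) : ℝ :=
  ⨆ A : {A : Set α // MeasurableSet A}, |μ.real A - ν.real A|

end HeatSPDE

end

open HeatSPDE

/-! Both laws are images of centered Gaussian laws under one linear map, `gridField`, and only part
of the covariance differs. On the grid $k/M$ the function $e_\ell$ equals $\pm e_m$ if $\ell\in I_m$
and vanishes if $M\mid\ell$ (`eigenfunction_grid_of_mem`, `modeSet_cases`). Hence the observations
are $\sum_m U_m(t_i)e_m(y_k)$, where $U_m$ collects, up to signs, the coefficient processes with
$\ell\in I_m$. These processes are independent AR(1) sequences at the times $i\Delta$. The modes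
$\ell<LM$ are simulated exactly and contribute the same covariance to both laws. For $\ell\ge LM$
the AR coefficient is at most $\rho=e^{-\lambda_{LM}\Delta}$, so the tail is almost white in time.
The replacement variables are exactly white and have the total stationary variance of the tail. By
`abs_quadratic_tail_sub_le` the two tail covariance forms differ by a relative error
$\theta=4(N+1)^2\rho$.

The comparison in total variation is `tvClose_multivariateGaussian_of_relative`. It needs no
determinants and no diagonalization: both covariances are $(1-\theta)D$ plus a small positive
semidefinite remainder, adding a remainder is convolving with a Gaussian law, that is, averaging
over random shifts, and a shift is paid for coordinate by coordinate with a one-dimensional bound.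
The common low-mode covariance is a further convolution, which cannot increase the distance. The
result is of order $MN\sqrt\theta$. As a total variation distance is at most one, passing to a
fourth root turns this into $\sqrt{MN}\,e^{-cL^2M^2\Delta}$ (`IsWeakSolution.tvDist_le`).

The law of the observations has to be extracted from the weak formulation. Testing with $e_\ell$
gives a pathwise identity, from which the innovations of the coefficients are limits of finite
weighted sums of noise increments (`tendsto_sum_exp_increment`). The joint law follows from finite
independent Gaussian families and bounded convergence of characteristic functions
(`IsWeakSolution.expI_innovation`), without stochastic integrals. The paths are only continuous in
space, so their sine series need not converge pointwise. It is summed with the kernels `cosBump ^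
n`, whose multipliers are bounded by one and tend to one, so that the variances converge by
domination (`IsWeakSolution.expI_observation`).

For the asymptotic statement, the hypotheses bound $M$ and $N$ above by powers of $Y=LM$ and
$L^2M^2\Delta$ below by a positive power of $Y$; the exponential then wins. -/

noncomputable section

namespace HeatSPDE

/-! ### Total variation, images and convolutions. -/

section TotalVariation

/-- `μ` and `ν` differ by at most `r` on every measurable set. -/
def TVClose {α : Type*} [MeasurableSpace α] (μ ν : Measure α) (r : ℝ) : Prop :=
  ∀ A, MeasurableSet A → |μ.real A - ν.real A| ≤ r

variable {α β : Type*} [MeasurableSpace α] [MeasurableSpace β]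

lemma tvDist_le_of_close {μ ν : Measure α} {r : ℝ} (h : TVClose μ ν r) : tvDist μ ν ≤ r := by
  have : Nonempty {A : Set α // MeasurableSet A} := ⟨⟨∅, MeasurableSet.empty⟩⟩
  exact ciSup_le fun A ↦ h A.1 A.2

lemma tvDist_nonneg (μ ν : Measure α) : 0 ≤ tvDist μ ν :=
  Real.iSup_nonneg fun _ ↦ abs_nonneg _

lemma TVClose.mono {μ ν : Measure α} {r s : ℝ} (h : TVClose μ ν r) (hrs : r ≤ s) :
    TVClose μ ν s := fun A hA ↦ (h A hA).trans hrs

lemma TVClose.refl (μ : Measure α) : TVClose μ μ 0 := fun A _ ↦ by simp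

lemma TVClose.symm {μ ν : Measure α} {r : ℝ} (h : TVClose μ ν r) : TVClose ν μ r :=
  fun A hA ↦ by rw [abs_sub_comm]; exact h A hA

lemma TVClose.trans {μ ν ρ : Measure α} {r s : ℝ} (h : TVClose μ ν r) (h' : TVClose ν ρ s) :
    TVClose μ ρ (r + s) := fun A hA ↦
  (abs_sub_le _ (ν.real A) _).trans (add_le_add (h A hA) (h' A hA))

lemma tvClose_one (μ ν : Measure α) [IsProbabilityMeasure μ] [IsProbabilityMeasure ν] :
    TVClose μ ν 1 := fun A _ ↦ by
  have h1 : μ.real A ≤ 1 := measureReal_le_one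
  have h2 : ν.real A ≤ 1 := measureReal_le_one
  have h3 : 0 ≤ μ.real A := measureReal_nonneg
  have h4 : 0 ≤ ν.real A := measureReal_nonneg
  rw [abs_le]; constructor <;> linarith

lemma TVClose.map {μ ν : Measure α} {r : ℝ} (h : TVClose μ ν r) {f : α → β} (hf : Measurable f) :
    TVClose (μ.map f) (ν.map f) r := fun A hA ↦ by
  rw [map_measureReal_apply hf hA, map_measureReal_apply hf hA]
  exact h _ (hf hA)

variable {E : Type*} [AddCommGroup E] [MeasurableSpace E] [MeasurableAdd₂ E]

lemma conv_real_apply (μ ν : Measure E) [IsProbabilityMeasure μ] [IsProbabilityMeasure ν]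
    {A : Set E} (hA : MeasurableSet A) :
    (μ ∗ ν).real A = ∫ y, (μ.map (fun x ↦ x + y)).real A ∂ν := by
  have hm : Measurable fun z : E × E ↦ z.1 + z.2 := measurable_add
  rw [Measure.real, Measure.conv, Measure.map_apply hm hA,
    Measure.prod_apply_symm (hm hA), integral_eq_lintegral_of_nonneg_ae]
  · congr 1
    refine lintegral_congr fun y ↦ ?_
    rw [Measure.real, ENNReal.ofReal_toReal (by
      have : IsProbabilityMeasure (μ.map (fun x ↦ x + y)) :=
        Measure.isProbabilityMeasure_map (by fun_prop)
      exact measure_ne_top _ _), Measure.map_apply (by fun_prop) hA]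
    rfl
  · exact ae_of_all _ fun _ ↦ measureReal_nonneg
  · have : (fun y ↦ (μ.map (fun x ↦ x + y)).real A) =
        fun y ↦ (μ ((fun x ↦ (x, y)) ⁻¹' ((fun z : E × E ↦ z.1 + z.2) ⁻¹' A))).toReal := by
      funext y
      rw [Measure.real, Measure.map_apply (by fun_prop) hA]; rfl
    rw [this]
    exact (measurable_measure_prodMk_right (hm hA)).ennreal_toReal.aestronglyMeasurable

lemma integrable_real_map_add (μ ν : Measure E) [IsProbabilityMeasure μ] [IsProbabilityMeasure ν]
    {A : Set E} (hA : MeasurableSet A) :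
    Integrable (fun y ↦ (μ.map (fun x ↦ x + y)).real A) ν := by
  have hm : Measurable fun z : E × E ↦ z.1 + z.2 := measurable_add
  have : (fun y ↦ (μ.map (fun x ↦ x + y)).real A) =
      fun y ↦ (μ ((fun x ↦ (x, y)) ⁻¹' ((fun z : E × E ↦ z.1 + z.2) ⁻¹' A))).toReal := by
    funext y
    rw [Measure.real, Measure.map_apply (by fun_prop) hA]; rfl
  refine Integrable.of_bound (C := 1) ?_ (ae_of_all _ fun y ↦ ?_)
  · rw [this]
    exact (measurable_measure_prodMk_right (hm hA)).ennreal_toReal.aestronglyMeasurable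
  · have : IsProbabilityMeasure (μ.map (fun x ↦ x + y)) :=
      Measure.isProbabilityMeasure_map (by fun_prop)
    rw [Real.norm_of_nonneg measureReal_nonneg]
    exact measureReal_le_one

/-- Convolving with a fixed law does not increase the distance in total variation. -/
lemma TVClose.conv {μ ν : Measure E} [IsProbabilityMeasure μ] [IsProbabilityMeasure ν] {r : ℝ}
    (h : TVClose μ ν r) (ρ : Measure E) [IsProbabilityMeasure ρ] :
    TVClose (μ ∗ ρ) (ν ∗ ρ) r := fun A hA ↦ by
  rw [conv_real_apply μ ρ hA, conv_real_apply ν ρ hA,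
    ← integral_sub (integrable_real_map_add μ ρ hA) (integrable_real_map_add ν ρ hA)]
  suffices hb : ∀ᵐ y ∂ρ, ‖(μ.map (fun x ↦ x + y)).real A - (ν.map (fun x ↦ x + y)).real A‖ ≤ r by
    have := norm_integral_le_of_norm_le_const hb
    rwa [probReal_univ, mul_one] at this
  refine ae_of_all _ fun y ↦ ?_
  exact h.map (f := fun x ↦ x + y) (by fun_prop) A hA

/-- A law is close to its convolution with `ρ` if it is close to its typical translations. -/
lemma tvClose_conv_self (μ ρ : Measure E) [IsProbabilityMeasure μ] [IsProbabilityMeasure ρ]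
    {r : E → ℝ} (hr : Integrable r ρ)
    (h : ∀ᵐ y ∂ρ, TVClose (μ.map (fun x ↦ x + y)) μ (r y)) :
    TVClose (μ ∗ ρ) μ (∫ y, r y ∂ρ) := fun A hA ↦ by
  have h0 : μ.real A = ∫ _, μ.real A ∂ρ := by simp
  rw [conv_real_apply μ ρ hA, h0, ← integral_sub (integrable_real_map_add μ ρ hA)
    (integrable_const _)]
  rw [← Real.norm_eq_abs]
  refine norm_integral_le_of_norm_le hr ?_
  filter_upwards [h] with y hy using hy A hA

end TotalVariation

/-! ### Shifting a one-dimensional Gaussian law. -/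

section OneDimensional

/-- The density ratio $r$ of the two laws satisfies $E(r-1)^2=e^{q^2}-1\le 2q^2$ for $q=|a|/\sqrt
v\le1$, and the distance is at most $E|r-1|$. For $q\ge1$ the bound exceeds one. -/
lemma tvClose_gaussianReal (a : ℝ) {v : ℝ≥0} (hv : v ≠ 0) :
    TVClose (gaussianReal a v) (gaussianReal 0 v) (2 * (|a| / √v)) := by
  have hv0 : (0 : ℝ) < v := by exact_mod_cast pos_iff_ne_zero.2 hv
  have hs : 0 < √(v : ℝ) := Real.sqrt_pos.2 hv0
  set q : ℝ := |a| / √v with hq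
  have hq0 : 0 ≤ q := by positivity
  have hq2 : q ^ 2 = a ^ 2 / v := by rw [hq, div_pow, sq_abs, Real.sq_sqrt hv0.le]
  rcases eq_or_lt_of_le hq0 with hq00 | hqpos
  · have ha : a = 0 := by
      rw [hq, eq_comm, div_eq_zero_iff] at hq00
      rcases hq00 with h | h
      · exact abs_eq_zero.1 h
      · exact absurd h hs.ne'
    rw [← hq00, ha]; simpa using TVClose.refl _
  rcases le_total 1 q with h1 | h1
  · exact (tvClose_one _ _).mono (by linarith)
  intro A hA
  set μ := gaussianReal 0 v with hμ
  set r : ℝ → ℝ := fun x ↦ Real.exp (a / v * x) * Real.exp (-(a ^ 2 / (2 * v))) with hr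
  have hpdf : ∀ x, gaussianPDFReal a v x = gaussianPDFReal 0 v x * r x := by
    intro x
    simp only [gaussianPDFReal_def, hr]
    rw [← Real.exp_add (a / v * x), mul_assoc (√(2 * Real.pi * v))⁻¹, ← Real.exp_add]
    congr 2
    field_simp
    ring
  have hri : Integrable r μ := (integrable_exp_mul_gaussianReal _).mul_const _
  have hexp : ∀ t, ∫ x, Real.exp (t * x) ∂μ = Real.exp (v * t ^ 2 / 2) := by
    intro t
    have := congrFun (mgf_fun_id_gaussianReal (μ := 0) (v := v)) t
    simpa [mgf, hμ] using this
  have hr1 : ∫ x, r x ∂μ = 1 := by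
    simp only [hr]
    rw [integral_mul_const, hexp, ← Real.exp_add]
    rw [Real.exp_eq_one_iff]
    field_simp
    ring
  have hr2eq : ∀ x, r x ^ 2 = Real.exp (2 * a / v * x) * Real.exp (-(a ^ 2 / v)) := by
    intro x
    simp only [hr]
    rw [← Real.exp_add, ← Real.exp_add, ← Real.exp_nat_mul]
    congr 1; push_cast; field_simp
  have hr2i : Integrable (fun x ↦ r x ^ 2) μ := by
    simp only [hr2eq]; exact (integrable_exp_mul_gaussianReal _).mul_const _
  have hr2 : ∫ x, r x ^ 2 ∂μ = Real.exp (q ^ 2) := by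
    simp only [hr2eq]
    rw [integral_mul_const, hexp, ← Real.exp_add, hq2]
    congr 1; field_simp; ring
  have hdi : Integrable (fun x ↦ (r x - 1) ^ 2) μ := by
    have : (fun x ↦ (r x - 1) ^ 2) = fun x ↦ r x ^ 2 - 2 * r x + 1 := by funext x; ring
    rw [this]; exact (hr2i.sub (hri.const_mul 2)).add (integrable_const _)
  have hd : ∫ x, (r x - 1) ^ 2 ∂μ = Real.exp (q ^ 2) - 1 := by
    have : (fun x ↦ (r x - 1) ^ 2) = fun x ↦ r x ^ 2 - 2 * r x + 1 := by funext x; ring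
    have hs : Integrable (fun x ↦ r x ^ 2 - 2 * r x) μ := hr2i.sub (hri.const_mul 2)
    rw [this, integral_add hs (integrable_const _), integral_sub hr2i (hri.const_mul 2), integral_const_mul, hr1, hr2]
    simp; ring
  have hd2 : Real.exp (q ^ 2) - 1 ≤ 2 * q ^ 2 := by
    have h2 : |q ^ 2| ≤ 1 := by rw [abs_of_nonneg (by positivity)]; nlinarith
    have := Real.abs_exp_sub_one_le h2
    rw [abs_of_nonneg (sq_nonneg q)] at this
    exact (le_abs_self _).trans this
  have e1 : (gaussianReal a v).real A = ∫ x in A, r x ∂μ := by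
    rw [Measure.real, gaussianReal_apply_eq_integral _ hv, ENNReal.toReal_ofReal
      (integral_nonneg fun x ↦ gaussianPDFReal_nonneg _ _ _), ← integral_indicator hA,
      ← integral_indicator hA, hμ, integral_gaussianReal_eq_integral_smul hv]
    congr 1; funext x
    by_cases hx : x ∈ A <;> simp [hx, hpdf]
  have e2 : μ.real A = ∫ x in A, (1 : ℝ) ∂μ := by simp
  rw [e1, e2, ← integral_sub hri.integrableOn (integrable_const _)]
  -- A pointwise AM-GM inequality with the scale $q$, in place of Cauchy–Schwarz; after integration
  -- it gives at most $\tfrac32q$.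
  have hbound : ∀ x, |r x - 1| ≤ (q⁻¹ * (r x - 1) ^ 2 + q) / 2 := by
    intro x
    have h : 0 ≤ q⁻¹ * (|r x - 1| - q) ^ 2 := by positivity
    have e : q⁻¹ * (|r x - 1| - q) ^ 2 = q⁻¹ * (r x - 1) ^ 2 - 2 * |r x - 1| + q := by
      rw [← sq_abs (r x - 1)]; field_simp; ring
    linarith
  have hbi : Integrable (fun x ↦ (q⁻¹ * (r x - 1) ^ 2 + q) / 2) μ :=
    ((hdi.const_mul _).add (integrable_const _)).div_const _
  calc |∫ x in A, (r x - 1) ∂μ| ≤ ∫ x in A, |r x - 1| ∂μ := abs_integral_le_integral_abs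
    _ ≤ ∫ x, |r x - 1| ∂μ := setIntegral_le_integral (hri.sub (integrable_const _)).abs
        (ae_of_all _ fun _ ↦ abs_nonneg _)
    _ ≤ ∫ x, (q⁻¹ * (r x - 1) ^ 2 + q) / 2 ∂μ :=
        integral_mono (hri.sub (integrable_const _)).abs hbi hbound
    _ = (q⁻¹ * (Real.exp (q ^ 2) - 1) + q) / 2 := by
        rw [integral_div, integral_add (hdi.const_mul _) (integrable_const _),
          integral_const_mul, hd]; simp
    _ ≤ (q⁻¹ * (2 * q ^ 2) + q) / 2 := by gcongr
    _ ≤ 2 * q := by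
        have : q⁻¹ * (2 * q ^ 2) = 2 * q := by field_simp
        rw [this]; linarith

end OneDimensional

/-! ### Comparison of multivariate Gaussian laws. -/

section Multivariate

open Matrix

variable {ι : Type*} [Fintype ι] [DecidableEq ι]

lemma multivariateGaussian_conv (a b : EuclideanSpace ℝ ι) {S R : Matrix ι ι ℝ}
    (hS : S.PosSemidef) (hR : R.PosSemidef) :
    multivariateGaussian a S ∗ multivariateGaussian b R = multivariateGaussian (a + b) (S + R) := by
  refine Measure.ext_of_charFun (funext fun x ↦ ?_)
  rw [charFun_conv, charFun_multivariateGaussian hS, charFun_multivariateGaussian hR,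
    charFun_multivariateGaussian (hS.add hR), ← Complex.exp_add]
  congr 1
  rw [inner_add_right, add_mulVec, dotProduct_add]
  push_cast; ring

lemma multivariateGaussian_map_add (a b : EuclideanSpace ℝ ι) (S : Matrix ι ι ℝ) :
    (multivariateGaussian a S).map (fun x ↦ x + b) = multivariateGaussian (a + b) S := by
  rw [multivariateGaussian, Measure.map_map (by fun_prop) (by fun_prop), multivariateGaussian]
  congr 1; funext x; simp only [Function.comp]; abel

/-- Splits off the `j`-th coordinate as an independent factor. Only this one-dimensional factor
depends on `c`, so the scalar shift bound survives the convolution. -/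
lemma map_single_gaussianReal_conv (a : EuclideanSpace ℝ ι) {v : ι → ℝ} (hv : 0 ≤ v) (j : ι)
    (c : ℝ) :
    ((gaussianReal c (v j).toNNReal).map (fun y ↦ EuclideanSpace.single j y)) ∗
      multivariateGaussian a (diagonal (Function.update v j 0)) =
    multivariateGaussian (a + EuclideanSpace.single j c) (diagonal v) := by
  have hv' : 0 ≤ Function.update v j 0 := by
    intro i; by_cases h : i = j
    · subst h; simp
    · simpa [h] using hv i
  have hcont : Measurable (fun y : ℝ ↦ (EuclideanSpace.single j y : EuclideanSpace ℝ ι)) := by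
    have h : (fun y : ℝ ↦ (EuclideanSpace.single j y : EuclideanSpace ℝ ι)) =
      fun y : ℝ ↦ y • (EuclideanSpace.single j (1 : ℝ) : EuclideanSpace ℝ ι) := by
      funext y; ext i; simp
    rw [h]; fun_prop
  have : IsProbabilityMeasure ((gaussianReal c (v j).toNNReal).map
      (fun y ↦ (EuclideanSpace.single j y : EuclideanSpace ℝ ι))) :=
    Measure.isProbabilityMeasure_map hcont.aemeasurable
  refine Measure.ext_of_charFun (funext fun x ↦ ?_)
  have h1 : charFun ((gaussianReal c (v j).toNNReal).map
      (fun y ↦ (EuclideanSpace.single j y : EuclideanSpace ℝ ι))) x =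
      charFun (gaussianReal c (v j).toNNReal) (x j) := by
    rw [charFun_apply, charFun_apply, integral_map hcont.aemeasurable
      (Measurable.aestronglyMeasurable (by fun_prop))]
    simp [EuclideanSpace.inner_single_left, mul_comm]
  rw [charFun_conv, h1, charFun_gaussianReal,
    charFun_multivariateGaussian (Matrix.PosSemidef.diagonal hv'),
    charFun_multivariateGaussian (Matrix.PosSemidef.diagonal hv), ← Complex.exp_add]
  congr 1
  have h2 : ∀ w : ι → ℝ, x.ofLp ⬝ᵥ diagonal w *ᵥ x.ofLp = ∑ i, w i * x i ^ 2 := by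
    intro w; simp only [dotProduct, mulVec_diagonal]
    exact Finset.sum_congr rfl fun i _ ↦ by ring
  have h3 : ∑ i, v i * x i ^ 2 = v j * x j ^ 2 + ∑ i, Function.update v j 0 i * x i ^ 2 := by
    rw [← Finset.add_sum_erase _ _ (Finset.mem_univ j), ← Finset.add_sum_erase _
      (fun i ↦ Function.update v j 0 i * x i ^ 2) (Finset.mem_univ j)]
    simp only [Function.update_self, zero_mul, zero_add]
    congr 1
    exact Finset.sum_congr rfl fun i hi ↦ by
      rw [Function.update_of_ne (Finset.ne_of_mem_erase hi)]
  have hc : (((v j).toNNReal : ℝ≥0) : ℂ) = ((v j : ℝ) : ℂ) := by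
    conv_rhs => rw [← Real.coe_toNNReal _ (hv j)]
  rw [h2, h2, h3, inner_add_right, hc]
  simp only [EuclideanSpace.inner_single_right]
  push_cast
  simp
  ring

/-- In a degenerate direction a nonzero shift would give a singular law, whence `hc`; there the
bound reads $0/0=0$. -/
lemma tvClose_multivariateGaussian_single (a : EuclideanSpace ℝ ι) {v : ι → ℝ} (hv : 0 ≤ v)
    (j : ι) {c : ℝ} (hc : v j = 0 → c = 0) :
    TVClose (multivariateGaussian (a + EuclideanSpace.single j c) (diagonal v))
      (multivariateGaussian a (diagonal v)) (2 * (|c| / √(v j))) := by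
  by_cases hj : v j = 0
  · have hz : (EuclideanSpace.single j 0 : EuclideanSpace ℝ ι) = 0 := by ext i; simp
    rw [hc hj, hz, add_zero]
    simpa [hj] using TVClose.refl (multivariateGaussian a (diagonal v))
  have hcont : Measurable (fun y : ℝ ↦ (EuclideanSpace.single j y : EuclideanSpace ℝ ι)) := by
    have h : (fun y : ℝ ↦ (EuclideanSpace.single j y : EuclideanSpace ℝ ι)) =
      fun y : ℝ ↦ y • (EuclideanSpace.single j (1 : ℝ) : EuclideanSpace ℝ ι) := by
      funext y; ext i; simp
    rw [h]; fun_prop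
  have hj0 : 0 < v j := lt_of_le_of_ne (hv j) (Ne.symm hj)
  have h0 : multivariateGaussian a (diagonal v) =
      multivariateGaussian (a + EuclideanSpace.single j 0) (diagonal v) := by
    have hz : (EuclideanSpace.single j 0 : EuclideanSpace ℝ ι) = 0 := by ext i; simp
    rw [hz, add_zero]
  rw [h0, ← map_single_gaussianReal_conv a hv j, ← map_single_gaussianReal_conv a hv j]
  have hp : ∀ c : ℝ, IsProbabilityMeasure ((gaussianReal c (v j).toNNReal).map
      (fun y ↦ (EuclideanSpace.single j y : EuclideanSpace ℝ ι))) := fun c ↦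
    Measure.isProbabilityMeasure_map hcont.aemeasurable
  have h1 := tvClose_gaussianReal c (v := (v j).toNNReal) (by simpa using hj0)
  rw [Real.coe_toNNReal _ hj0.le] at h1
  exact (h1.map hcont).conv _

lemma tvClose_multivariateGaussian_shift {v : ι → ℝ} (hv : 0 ≤ v) (b : EuclideanSpace ℝ ι)
    (hb : ∀ j, v j = 0 → b j = 0) :
    TVClose (multivariateGaussian b (diagonal v)) (multivariateGaussian 0 (diagonal v))
      (∑ j, 2 * (|b j| / √(v j))) := by
  have key : ∀ s : Finset ι,
      TVClose (multivariateGaussian (∑ j ∈ s, EuclideanSpace.single j (b j)) (diagonal v))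
        (multivariateGaussian 0 (diagonal v)) (∑ j ∈ s, 2 * (|b j| / √(v j))) := by
    intro s
    induction s using Finset.induction_on with
    | empty => simpa using TVClose.refl (multivariateGaussian 0 (diagonal v))
    | insert j s hj ih =>
      rw [Finset.sum_insert hj, Finset.sum_insert hj, add_comm (EuclideanSpace.single j (b j))]
      exact (tvClose_multivariateGaussian_single _ hv j (hb j)).trans ih
  have hsum : ∑ j, EuclideanSpace.single j (b j) = b := by
    ext i
    simp
  simpa only [hsum] using key Finset.univ

/-- The first absolute moment is bounded by the root of the second because the variance of $|b_j|$
is nonnegative. -/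
lemma integral_abs_multivariateGaussian_le {K : Matrix ι ι ℝ} (hK : K.PosSemidef) (j : ι) :
    Integrable (fun b : EuclideanSpace ℝ ι ↦ |b j|) (multivariateGaussian 0 K) ∧
    ∫ b : EuclideanSpace ℝ ι, |b j| ∂(multivariateGaussian 0 K) ≤ √(K j j) := by
  set μ := multivariateGaussian 0 K
  have hmp := measurePreserving_eval_multivariateGaussian (μ := 0) hK (i := j)
  have hlaw : HasLaw (fun b : EuclideanSpace ℝ ι ↦ b j) (gaussianReal 0 (K j j).toNNReal) μ :=
    hmp.hasLaw
  have hmem : MemLp (fun b : EuclideanSpace ℝ ι ↦ b j) 2 μ := hlaw.hasGaussianLaw.memLp_two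
  have habs : MemLp (fun b : EuclideanSpace ℝ ι ↦ |b j|) 2 μ := hmem.norm
  refine ⟨habs.integrable one_le_two, ?_⟩
  have hmean : ∫ b : EuclideanSpace ℝ ι, b j ∂μ = 0 := by
    have := hlaw.integral_eq; simpa using this
  have hvar : ∫ b : EuclideanSpace ℝ ι, (b j) ^ 2 ∂μ = K j j := by
    have h := variance_eval_multivariateGaussian (μ := 0) hK j
    rw [variance_eq_sub hmem] at h
    simpa [hmean] using h
  have h2 := variance_nonneg (fun b : EuclideanSpace ℝ ι ↦ |b j|) μ
  rw [variance_eq_sub habs] at h2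
  refine Real.le_sqrt_of_sq_le ?_
  have e : ∫ b : EuclideanSpace ℝ ι, ((fun b : EuclideanSpace ℝ ι ↦ |b j|) ^ 2) b ∂μ = K j j := by
    rw [← hvar]; congr 1; funext b; simp
  rw [e] at h2
  linarith

/-- The larger law is a mixture of shifts of the smaller one by a vector $b\sim N(0,K)$, and the
mean cost of coordinate $j$ is $2E|b_j|/\sqrt{v_j}\le2\sqrt r$. Only the diagonal of `K` enters, so
`K` need not be diagonal. -/
lemma tvClose_multivariateGaussian_add {v : ι → ℝ} (hv : 0 ≤ v) {K : Matrix ι ι ℝ}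
    (hK : K.PosSemidef) {r : ℝ} (hr : 0 ≤ r) (hKv : ∀ j, K j j ≤ r * v j) :
    TVClose (multivariateGaussian 0 (diagonal v + K)) (multivariateGaussian 0 (diagonal v))
      (2 * Fintype.card ι * √r) := by
  have hD := Matrix.PosSemidef.diagonal hv
  rw [← add_zero (0 : EuclideanSpace ℝ ι), ← multivariateGaussian_conv 0 0 hD hK, add_zero]
  have hint : ∀ j ∈ (Finset.univ : Finset ι), Integrable
      (fun b : EuclideanSpace ℝ ι ↦ 2 * (|b j| / √(v j))) (multivariateGaussian 0 K) := fun j _ ↦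
    ((integral_abs_multivariateGaussian_le hK j).1.div_const _).const_mul _
  refine (tvClose_conv_self (multivariateGaussian 0 (diagonal v)) (multivariateGaussian 0 K)
    (r := fun b ↦ ∑ j, 2 * (|b j| / √(v j))) (integrable_finsetSum _ hint) ?_).mono ?_
  -- Where $v_j=0$, the hypothesis forces $K_{jj}\le0$, so the random shift almost surely does not
  -- move the degenerate coordinate.
  · have hz : ∀ᵐ b ∂(multivariateGaussian 0 K), ∀ j, v j = 0 → b j = 0 := by
      rw [ae_all_iff]; intro j
      by_cases hj : v j = 0
      · have hK0 : K j j ≤ 0 := by simpa [hj] using hKv j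
        have hmp := measurePreserving_eval_multivariateGaussian (μ := 0) hK (i := j)
        have hlaw : HasLaw (fun b : EuclideanSpace ℝ ι ↦ b j) (Measure.dirac 0)
            (multivariateGaussian 0 K) := by
          have := hmp.hasLaw
          rw [Real.toNNReal_of_nonpos hK0, gaussianReal_zero_var] at this
          simpa using this
        filter_upwards [hlaw.ae_eq_of_dirac] with b hb _ using hb
      · exact ae_of_all _ fun b h ↦ absurd h hj
    filter_upwards [hz] with b hb
    rw [multivariateGaussian_map_add, zero_add]
    exact tvClose_multivariateGaussian_shift hv b hb
  · rw [integral_finsetSum _ hint]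
    have : ∀ j ∈ (Finset.univ : Finset ι), ∫ b : EuclideanSpace ℝ ι, 2 * (|b j| / √(v j))
        ∂(multivariateGaussian 0 K) ≤ 2 * √r := by
      intro j _
      rw [integral_const_mul, integral_div]
      refine mul_le_mul_of_nonneg_left ?_ zero_le_two
      refine div_le_of_le_mul₀ (Real.sqrt_nonneg _) (Real.sqrt_nonneg _) ?_
      rw [← Real.sqrt_mul hr]
      exact (integral_abs_multivariateGaussian_le hK j).2.trans (Real.sqrt_le_sqrt (hKv j))
    refine (Finset.sum_le_sum this).trans_eq ?_
    simp; ring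

/-- Centered Gaussian laws whose covariance forms are relatively close to a diagonal one are close
in total variation. A common additional covariance `K` does no harm. -/
lemma tvClose_multivariateGaussian_of_relative {v : ι → ℝ} (hv : 0 ≤ v) {H K : Matrix ι ι ℝ}
    (hK : K.PosSemidef) (hH : H.IsHermitian) {θ : ℝ} (hθ : 0 ≤ θ) (hθ' : θ ≤ 1 / 2)
    (hrel : ∀ b : ι → ℝ, |b ⬝ᵥ H *ᵥ b - ∑ j, v j * b j ^ 2| ≤ θ * ∑ j, v j * b j ^ 2) :
    TVClose (multivariateGaussian 0 (H + K)) (multivariateGaussian 0 (diagonal v + K))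
      (8 * Fintype.card ι * √θ) := by
  have hquad : ∀ (w b : ι → ℝ), b ⬝ᵥ diagonal w *ᵥ b = ∑ i, w i * b i ^ 2 := by
    intro w b; simp only [dotProduct, mulVec_diagonal]
    exact Finset.sum_congr rfl fun i _ ↦ by ring
  -- The common lower bound of the two covariances: `H` and `diagonal v` both exceed `diagonal w` by
  -- a positive semidefinite matrix.
  set w : ι → ℝ := (1 - θ) • v with hw
  have hw0 : 0 ≤ w := smul_nonneg (by linarith) hv
  have hwq : ∀ b : ι → ℝ, ∑ j, w j * b j ^ 2 = (1 - θ) * ∑ j, v j * b j ^ 2 := by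
    intro b; rw [Finset.mul_sum]
    exact Finset.sum_congr rfl fun j _ ↦ by simp [hw]; ring
  have hR : (H - diagonal w).PosSemidef := by
    refine PosSemidef.of_dotProduct_mulVec_nonneg
      (hH.sub (isHermitian_diagonal_of_self_adjoint _ (by ext; simp))) fun b ↦ ?_
    have h := (abs_le.1 (hrel b)).1
    rw [star_trivial, sub_mulVec, dotProduct_sub, hquad, hwq]
    linarith
  have hR' : (diagonal (θ • v)).PosSemidef := PosSemidef.diagonal (smul_nonneg hθ hv)
  have hd : ∀ j, H j j - v j ≤ θ * v j := by
    intro j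
    have h := (abs_le.1 (hrel (Pi.single j 1))).2
    have e1 : (Pi.single j 1 : ι → ℝ) ⬝ᵥ H *ᵥ (Pi.single j 1) = H j j := by simp
    have e2 : ∑ i, v i * (Pi.single j 1 : ι → ℝ) i ^ 2 = v j := by
      rw [Finset.sum_eq_single j]
      · simp
      · intro i _ hij; simp [hij]
      · simp
    rwa [e1, e2] at h
  -- The factor $4\theta$: the diagonal of the remainder is at most $2\theta v_j$, and $v_j\le2w_j$
  -- since $\theta\le1/2$.
  have c1 : TVClose (multivariateGaussian 0 (diagonal w + (H - diagonal w)))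
      (multivariateGaussian 0 (diagonal w)) (2 * Fintype.card ι * √(4 * θ)) := by
    refine tvClose_multivariateGaussian_add hw0 hR (by positivity) fun j ↦ ?_
    have := hd j
    have hvj : 0 ≤ v j := hv j
    simp only [Matrix.sub_apply, diagonal_apply_eq, hw, Pi.smul_apply, smul_eq_mul]
    nlinarith [mul_nonneg hθ hvj, mul_nonneg (mul_nonneg hθ hvj) (by linarith : 0 ≤ 1 / 2 - θ)]
  have c2 : TVClose (multivariateGaussian 0 (diagonal w + diagonal (θ • v)))
      (multivariateGaussian 0 (diagonal w)) (2 * Fintype.card ι * √(4 * θ)) := by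
    refine tvClose_multivariateGaussian_add hw0 hR' (by positivity) fun j ↦ ?_
    have hvj : 0 ≤ v j := hv j
    simp only [diagonal_apply_eq, hw, Pi.smul_apply, smul_eq_mul]
    nlinarith [mul_nonneg hθ hvj, mul_nonneg (mul_nonneg hθ hvj) (by linarith : 0 ≤ 1 / 2 - θ)]
  have e1 : diagonal w + (H - diagonal w) = H := by abel
  have e2 : diagonal w + diagonal (θ • v) = diagonal v := by
    rw [diagonal_add]; congr 1; funext j; simp [hw]; ring
  rw [e1] at c1
  rw [e2] at c2
  have hs : √(4 * θ) = 2 * √θ := by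
    rw [Real.sqrt_mul (by norm_num), show (4 : ℝ) = 2 ^ 2 by norm_num,
      Real.sqrt_sq (by norm_num)]
  have hHpsd : H.PosSemidef := by
    have := (PosSemidef.diagonal hw0).add hR
    rwa [e1] at this
  have h := ((c1.trans c2.symm).conv (multivariateGaussian 0 K)).mono
    (s := 8 * Fintype.card ι * √θ) (by rw [hs]; linarith)
  rwa [multivariateGaussian_conv 0 0 hHpsd hK,
    multivariateGaussian_conv 0 0 (PosSemidef.diagonal hv) hK, add_zero] at h

end Multivariate

/-! ### Riemann sums and innovations along fine partitions. -/

section Partition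

/-- On finer and finer partitions of `[a, a + H]`, the values of a continuous function of two
variables at `(s_k, s)` and `(s, s_{k+1})` become indistinguishable. -/
lemma tendsto_sum_integral_partition {g : ℝ → ℝ → ℝ} (hg : Continuous (Function.uncurry g))
    (a : ℝ) {H : ℝ} (hH : 0 ≤ H) :
    Tendsto (fun n : ℕ ↦ ∑ k ∈ Finset.range n,
      ∫ s in (a + k * (H / n))..(a + (k + 1 : ℕ) * (H / n)),
        (g (a + k * (H / n)) s - g s (a + (k + 1 : ℕ) * (H / n)))) atTop (𝓝 0) := by
  have hK : IsCompact (Set.Icc a (a + H) ×ˢ Set.Icc a (a + H)) := isCompact_Icc.prod isCompact_Icc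
  have huc := hK.uniformContinuousOn_of_continuous hg.continuousOn
  rw [Metric.uniformContinuousOn_iff] at huc
  rw [Metric.tendsto_atTop]
  intro ε hε
  obtain ⟨δ, hδ, hδ'⟩ := huc (ε / (H + 1)) (by positivity)
  have hlim : Tendsto (fun n : ℕ ↦ H / (n : ℝ)) atTop (𝓝 0) :=
    tendsto_const_div_atTop_nhds_zero_nat H
  obtain ⟨n₀, hn₀⟩ := Filter.eventually_atTop.1
    ((hlim.eventually (gt_mem_nhds hδ)).and (eventually_ge_atTop 1))
  refine ⟨n₀, fun n hn ↦ ?_⟩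
  obtain ⟨hn1, hn2⟩ := hn₀ n hn
  have hn0 : (0 : ℝ) < n := by exact_mod_cast hn2
  have hstep : 0 ≤ H / n := by positivity
  rw [dist_zero_right]
  have hbound : ∀ k ∈ Finset.range n,
      ‖∫ s in (a + k * (H / n))..(a + (k + 1 : ℕ) * (H / n)),
        (g (a + k * (H / n)) s - g s (a + (k + 1 : ℕ) * (H / n)))‖ ≤
      ε / (H + 1) * (H / n) := by
    intro k hk
    have hk' : ((k + 1 : ℕ) : ℝ) ≤ n := by exact_mod_cast Finset.mem_range.1 hk
    have hmul : ((k + 1 : ℕ) : ℝ) * (H / n) ≤ H := by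
      calc ((k + 1 : ℕ) : ℝ) * (H / n) ≤ n * (H / n) := by gcongr
        _ = H := by field_simp
    have hk0 : (0 : ℝ) ≤ k * (H / n) := by positivity
    push_cast at hmul
    refine (intervalIntegral.norm_integral_le_of_norm_le_const (C := ε / (H + 1))
      fun s hs ↦ ?_).trans_eq ?_
    · rw [Set.uIoc_of_le (by push_cast; linarith)] at hs
      obtain ⟨h1, h2⟩ := hs
      push_cast at h2
      have := hδ' (a + k * (H / n), s) ⟨⟨by simp only; linarith, by simp only; linarith⟩,
        ⟨by simp only; linarith, by simp only; linarith⟩⟩ (s, a + (k + 1 : ℕ) * (H / n))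
        ⟨⟨by simp only; linarith, by simp only; linarith⟩,
        ⟨by push_cast; linarith, by push_cast; linarith⟩⟩ (by
          rw [Prod.dist_eq, max_lt_iff]
          push_cast
          simp only [Real.dist_eq]
          constructor <;> rw [abs_lt] <;> constructor <;> linarith)
      rw [Real.dist_eq] at this
      exact this.le
    · congr 1
      rw [abs_of_nonneg] <;> push_cast <;> linarith
  calc ‖∑ k ∈ Finset.range n, _‖ ≤ ∑ k ∈ Finset.range n, ε / (H + 1) * (H / n) :=
        norm_sum_le_of_le _ hbound
    _ = ε / (H + 1) * H := by
        rw [Finset.sum_const, Finset.card_range, nsmul_eq_mul]; field_simp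
    _ < ε := by rw [div_mul_eq_mul_div, div_lt_iff₀ (by positivity)]; nlinarith

lemma sum_integral_partition {f : ℝ → ℝ} (hf : Continuous f) (a H : ℝ) {n : ℕ} (hn : 1 ≤ n) :
    ∑ k ∈ Finset.range n, ∫ s in (a + k * (H / n))..(a + (k + 1 : ℕ) * (H / n)), f s =
      ∫ s in a..(a + H), f s := by
  have hn0 : (n : ℝ) ≠ 0 := by exact_mod_cast (by omega : n ≠ 0)
  have := intervalIntegral.sum_integral_adjacent_intervals (μ := volume) (f := f)
    (a := fun k : ℕ ↦ a + k * (H / n)) (n := n) (fun k _ ↦ hf.intervalIntegrable _ _)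
  rw [this]
  congr 1
  · simp
  · field_simp

/-- The case of a function of the first variable alone: the difference of the two evaluations is
then the error of the left Riemann sum. -/
lemma tendsto_riemann_sum {f : ℝ → ℝ} (hf : Continuous f) (a : ℝ) {H : ℝ} (hH : 0 ≤ H) :
    Tendsto (fun n : ℕ ↦ ∑ k ∈ Finset.range n, H / n * f (a + k * (H / n))) atTop
      (𝓝 (∫ s in a..(a + H), f s)) := by
  have h := tendsto_sum_integral_partition (g := fun r _ ↦ f r) (by fun_prop) a hH
  have h2 := h.add_const (∫ s in a..(a + H), f s)
  rw [zero_add] at h2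
  refine h2.congr' ?_
  filter_upwards [eventually_ge_atTop 1] with n hn
  rw [← sum_integral_partition hf a H hn, ← Finset.sum_add_distrib]
  refine Finset.sum_congr rfl fun k _ ↦ ?_
  rw [intervalIntegral.integral_sub (by simp) (hf.intervalIntegrable _ _), sub_add_cancel,
    intervalIntegral.integral_const, smul_eq_mul]
  congr 1
  push_cast; ring

/-- The innovation of a path with drift `-c x` is the limit of weighted sums of the increments of
the driving noise. -/
lemma tendsto_sum_exp_increment {x : ℝ → ℝ} (hx : Continuous x) (c a : ℝ) {H : ℝ} (hH : 0 ≤ H) :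
    Tendsto (fun n : ℕ ↦ ∑ k ∈ Finset.range n, Real.exp (-(c * (a + H - (a + k * (H / n))))) *
      (x (a + (k + 1 : ℕ) * (H / n)) - x (a + k * (H / n)) +
        c * ∫ s in (a + k * (H / n))..(a + (k + 1 : ℕ) * (H / n)), x s)) atTop
      (𝓝 (x (a + H) - Real.exp (-(c * H)) * x a)) := by
  -- Summation by parts: with $E_k=e^{cs_k}$ and $x_k=x(s_k)$, the weighted increment minus
  -- $E_{k+1}x_{k+1}-E_kx_k$ is $\int(cE_kx(s)-ce^{cs}x_{k+1})\,ds$. This choice of `g` makes these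
  -- errors vanish in the limit, and the remaining sum telescopes.
  have h := (tendsto_sum_integral_partition (g := fun r s ↦ c * Real.exp (c * r) * x s)
    (by fun_prop) a hH).const_mul (Real.exp (-(c * (a + H))))
  rw [mul_zero] at h
  have h2 := h.add_const (x (a + H) - Real.exp (-(c * H)) * x a)
  rw [zero_add] at h2
  refine h2.congr' ?_
  filter_upwards [eventually_ge_atTop 1] with n hn
  have hn0 : (n : ℝ) ≠ 0 := by exact_mod_cast (by omega : n ≠ 0)
  have htel := Finset.sum_range_sub
    (fun k : ℕ ↦ Real.exp (-(c * (a + H))) * (Real.exp (c * (a + k * (H / n))) *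
      x (a + k * (H / n)))) n
  have e1 : a + (n : ℝ) * (H / n) = a + H := by field_simp
  rw [e1] at htel
  have e2 : x (a + H) - Real.exp (-(c * H)) * x a = ∑ k ∈ Finset.range n,
    (Real.exp (-(c * (a + H))) * (Real.exp (c * (a + (k + 1 : ℕ) * (H / n))) *
      x (a + (k + 1 : ℕ) * (H / n))) - Real.exp (-(c * (a + H))) *
      (Real.exp (c * (a + k * (H / n))) * x (a + k * (H / n)))) := by
    rw [htel, ← mul_assoc, ← mul_assoc, ← Real.exp_add, ← Real.exp_add]
    congr 1
    · rw [neg_add_cancel, Real.exp_zero, one_mul]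
    · congr 2
      · simp; ring
      · simp
  rw [e2, Finset.mul_sum, ← Finset.sum_add_distrib]
  refine Finset.sum_congr rfl fun k _ ↦ ?_
  have e3 : Real.exp (-(c * (a + H - (a + k * (H / n))))) =
      Real.exp (-(c * (a + H))) * Real.exp (c * (a + k * (H / n))) := by
    rw [← Real.exp_add]; congr 1; ring
  rw [e3, intervalIntegral.integral_sub (Continuous.intervalIntegrable (by fun_prop) _ _) (Continuous.intervalIntegrable (by fun_prop) _ _),
    intervalIntegral.integral_const_mul, intervalIntegral.integral_mul_const,
    intervalIntegral.integral_const_mul]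
  have e4 : c * ∫ s in (a + k * (H / n))..(a + (k + 1 : ℕ) * (H / n)), Real.exp (c * s) =
      Real.exp (c * (a + (k + 1 : ℕ) * (H / n))) - Real.exp (c * (a + k * (H / n))) := by
    rw [← intervalIntegral.integral_const_mul]
    refine intervalIntegral.integral_eq_sub_of_hasDerivAt (f := fun s ↦ Real.exp (c * s))
      (fun s _ ↦ ?_) (Continuous.intervalIntegrable (by fun_prop) _ _)
    have := ((hasDerivAt_id s).const_mul c).exp
    simpa [mul_comm] using this
  rw [e4]; ring

end Partition

/-! ### A summation method for sine series. -/

section PeakKernel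

/-- The nonnegative trigonometric polynomial `(1 + cos (π x)) / 2`, with its maximum at even
integers. -/
def cosBump (x : ℝ) : ℝ := (1 + Real.cos (Real.pi * x)) / 2

/-- The multipliers of the summation method given by the kernels `cosBump ^ n`. -/
def sumWeight (n k : ℕ) : ℝ :=
  (∫ x in (-1 : ℝ)..1, cosBump x ^ n)⁻¹ *
    ∫ x in (-1 : ℝ)..1, cosBump x ^ n * Real.cos (Real.pi * k * x)

lemma continuous_cosBump : Continuous cosBump := by unfold cosBump; fun_prop

lemma cosBump_nonneg (x : ℝ) : 0 ≤ cosBump x := by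
  unfold cosBump; linarith [Real.neg_one_le_cos (Real.pi * x)]

lemma cosBump_neg (x : ℝ) : cosBump (-x) = cosBump x := by simp [cosBump]

lemma cosBump_zero : cosBump 0 = 1 := by simp [cosBump]

lemma cosBump_lt_one {x : ℝ} (h0 : x ≠ 0) (h1 : -2 < x) (h2 : x < 2) : cosBump x < 1 := by
  have hle := Real.cos_le_one (Real.pi * x)
  have hne : Real.cos (Real.pi * x) ≠ 1 := by
    intro h
    rw [Real.cos_eq_one_iff] at h
    obtain ⟨k, hk⟩ := h
    have hx : x = 2 * k := by
      have := Real.pi_ne_zero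
      field_simp at hk; linarith
    have hk1 : (-1 : ℝ) < k := by linarith
    have hk2 : (k : ℝ) < 1 := by linarith
    have hk1' : -1 < k := by exact_mod_cast hk1
    have hk2' : k < 1 := by exact_mod_cast hk2
    have : k = 0 := by omega
    rw [this] at hx; simp at hx; exact h0 hx
  have := lt_of_le_of_ne hle hne
  unfold cosBump; linarith

lemma cosBump_periodic : Function.Periodic cosBump 2 := fun x ↦ by
  unfold cosBump
  rw [show Real.pi * (x + 2) = Real.pi * x + 2 * Real.pi by ring, Real.cos_add_two_pi]

lemma integral_cosBump_shift (n : ℕ) (y : ℝ) :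
    ∫ x in (-1 : ℝ)..1, cosBump (x - y) ^ n = ∫ x in (-1 : ℝ)..1, cosBump x ^ n := by
  have hper : Function.Periodic (fun x ↦ cosBump x ^ n) 2 := fun x ↦ by
    simp only [cosBump_periodic x]
  rw [intervalIntegral.integral_comp_sub_right (fun x ↦ cosBump x ^ n)]
  have := hper.intervalIntegral_add_eq (-1 - y) (-1)
  convert this using 2 <;> ring

lemma integral_cosBump_pos (n : ℕ) : 0 < ∫ x in (-1 : ℝ)..1, cosBump x ^ n := by
  refine intervalIntegral.integral_pos (by norm_num)
    (continuous_cosBump.pow n).continuousOn (fun x _ ↦ pow_nonneg (cosBump_nonneg x) n)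
    ⟨0, by norm_num, by simp [cosBump_zero]⟩

/-- The kernels `cosBump (· - y) ^ n`, normalized, concentrate at `y`. -/
lemma tendsto_peak {g : ℝ → ℝ} {y : ℝ} (hy : y ∈ Set.Ioo (-1 : ℝ) 1)
    (hg : IntegrableOn g (Set.Icc (-1 : ℝ) 1)) (hgc : ContinuousAt g y) :
    Tendsto (fun n : ℕ ↦ (∫ x in (-1 : ℝ)..1, cosBump x ^ n)⁻¹ *
      ∫ x in (-1 : ℝ)..1, cosBump (x - y) ^ n * g x) atTop (𝓝 (g y)) := by
  -- The maximum of the shifted bump on $[-1,1]$ is unique because $|x-y|<2$ there: `y` lies in the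
  -- open interval and the bump has period two.
  have h := tendsto_setIntegral_pow_smul_of_unique_maximum_of_isCompact_of_integrableOn
    (μ := volume) (s := Set.Icc (-1 : ℝ) 1) (x₀ := y) (c := fun x ↦ cosBump (x - y)) (g := g)
    isCompact_Icc (continuous_cosBump.comp (by fun_prop)).continuousOn
    (fun x hx hxy ↦ by
      rw [sub_self, cosBump_zero]
      exact cosBump_lt_one (sub_ne_zero.2 hxy) (by linarith [hx.1, hy.2]) (by linarith [hx.2, hy.1]))
    (fun x _ ↦ cosBump_nonneg _) (by simp [cosBump_zero])
    (by rw [interior_Icc, closure_Ioo (by norm_num)]; exact Set.Ioo_subset_Icc_self hy)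
    hg hgc.continuousWithinAt
  refine h.congr fun n ↦ ?_
  rw [← integral_cosBump_shift n y, intervalIntegral.integral_of_le (by norm_num),
    intervalIntegral.integral_of_le (by norm_num), integral_Icc_eq_integral_Ioc,
    integral_Icc_eq_integral_Ioc]
  rfl

lemma tendsto_sumWeight (k : ℕ) : Tendsto (fun n ↦ sumWeight n k) atTop (𝓝 1) := by
  have hc : Continuous fun x : ℝ ↦ Real.cos (Real.pi * k * x) := by fun_prop
  have := tendsto_peak (g := fun x ↦ Real.cos (Real.pi * k * x)) (y := 0) (by norm_num)
    (hc.continuousOn.integrableOn_compact isCompact_Icc) hc.continuousAt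
  simpa [sumWeight] using this

lemma abs_sumWeight_le (n k : ℕ) : |sumWeight n k| ≤ 1 := by
  have hZ := integral_cosBump_pos n
  rw [sumWeight, abs_mul, abs_of_pos (inv_pos.2 hZ), inv_mul_le_iff₀ hZ, mul_one]
  have hc := continuous_cosBump
  refine (intervalIntegral.abs_integral_le_integral_abs (by norm_num)).trans
    (intervalIntegral.integral_mono_on (by norm_num) (Continuous.intervalIntegrable (by fun_prop) _ _)
      (Continuous.intervalIntegrable (by fun_prop) _ _) fun x _ ↦ ?_)
  rw [abs_mul, abs_of_nonneg (pow_nonneg (cosBump_nonneg x) n)]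
  exact mul_le_of_le_one_right (pow_nonneg (cosBump_nonneg x) n) (Real.abs_cos_le_one _)

/-- Multiplication by the bump couples the frequency $k$ to $k\pm1$ only, so the degree grows by
one. The `natAbs` folds the frequency $-1$, which occurs for $k=0$, back to $1$. -/
lemma exists_cosBump_pow_eq (n : ℕ) : ∃ a : ℕ → ℝ, ∀ x,
    cosBump x ^ n = ∑ k ∈ Finset.range (n + 1), a k * Real.cos (Real.pi * k * x) := by
  induction n with
  | zero => exact ⟨fun _ ↦ 1, fun x ↦ by simp⟩
  | succ n ih =>
    obtain ⟨a, ha⟩ := ih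
    have hspan : ∀ x, cosBump x ^ (n + 1) = ∑ k ∈ Finset.range (n + 1),
        a k * (Real.cos (Real.pi * k * x) / 2 + Real.cos (Real.pi * (k + 1 : ℕ) * x) / 4 +
          Real.cos (Real.pi * (Int.natAbs ((k : ℤ) - 1)) * x) / 4) := by
      intro x
      rw [pow_succ, ha, Finset.sum_mul]
      refine Finset.sum_congr rfl fun k _ ↦ ?_
      have h1 : Real.cos (Real.pi * (k + 1 : ℕ) * x) + Real.cos (Real.pi * (Int.natAbs ((k : ℤ) - 1)) * x)
          = 2 * Real.cos (Real.pi * k * x) * Real.cos (Real.pi * x) := by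
        have e : Real.cos (Real.pi * (Int.natAbs ((k : ℤ) - 1)) * x) =
            Real.cos (Real.pi * k * x - Real.pi * x) := by
          rcases k with _ | k
          · simp
          · congr 1; push_cast; simp; ring
        rw [e, show Real.pi * ((k + 1 : ℕ) : ℝ) * x = Real.pi * k * x + Real.pi * x by
          push_cast; ring, Real.cos_add, Real.cos_sub]
        ring
      unfold cosBump
      linear_combination (-(a k / 4)) * h1
    refine ⟨fun j ↦ ∑ k ∈ Finset.range (n + 1), a k * ((if j = k then 1 / 2 else 0) +
      (if j = k + 1 then 1 / 4 else 0) + (if j = Int.natAbs ((k : ℤ) - 1) then 1 / 4 else 0)),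
      fun x ↦ ?_⟩
    rw [hspan]
    simp_rw [Finset.sum_mul]
    rw [Finset.sum_comm]
    refine Finset.sum_congr rfl fun k hk ↦ ?_
    have hk' := Finset.mem_range.1 hk
    simp_rw [mul_assoc, ← Finset.mul_sum, add_mul, Finset.sum_add_distrib, ite_mul, zero_mul]
    rw [Finset.sum_ite_eq' , Finset.sum_ite_eq', Finset.sum_ite_eq',
      if_pos (Finset.mem_range.2 (by omega)), if_pos (Finset.mem_range.2 (by omega)),
      if_pos (Finset.mem_range.2 (by omega))]
    ring

lemma integral_cos_int_mul {j : ℤ} (hj : j ≠ 0) :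
    ∫ x in (-1 : ℝ)..1, Real.cos (Real.pi * j * x) = 0 := by
  have h : Real.pi * j ≠ 0 := mul_ne_zero Real.pi_ne_zero (by exact_mod_cast hj)
  rw [intervalIntegral.integral_comp_mul_left _ h, integral_cos]
  have e1 : Real.sin (Real.pi * j * 1) = 0 := by
    rw [mul_one, mul_comm]; exact Real.sin_int_mul_pi j
  rw [e1, mul_neg_one, Real.sin_neg, ← mul_one (Real.pi * (j : ℝ)), e1]
  simp

lemma integral_cos_mul_cos (k l : ℕ) (hl : 1 ≤ l) :
    ∫ x in (-1 : ℝ)..1, Real.cos (Real.pi * k * x) * Real.cos (Real.pi * l * x) =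
      if k = l then 1 else 0 := by
  have e : ∀ x : ℝ, Real.cos (Real.pi * k * x) * Real.cos (Real.pi * l * x) =
      (Real.cos (Real.pi * ((k - l : ℤ) : ℝ) * x) + Real.cos (Real.pi * ((k + l : ℤ) : ℝ) * x)) / 2 := by
    intro x
    push_cast
    rw [show Real.pi * ((k : ℝ) - l) * x = Real.pi * k * x - Real.pi * l * x by ring,
      show Real.pi * ((k : ℝ) + l) * x = Real.pi * k * x + Real.pi * l * x by ring,
      Real.cos_sub, Real.cos_add]
    ring
  simp_rw [e]
  rw [intervalIntegral.integral_div, intervalIntegral.integral_add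
    (Continuous.intervalIntegrable (by fun_prop) _ _)
    (Continuous.intervalIntegrable (by fun_prop) _ _),
    integral_cos_int_mul (j := (k + l : ℤ)) (by omega)]
  split_ifs with h
  · subst h; simp
  · rw [integral_cos_int_mul (j := (k - l : ℤ)) (by omega)]; simp

/-- The coefficients of `cosBump ^ n` as a cosine polynomial are given by `sumWeight`. -/
lemma cosBump_pow_sub (n : ℕ) (x y : ℝ) :
    cosBump (x - y) ^ n - cosBump (x + y) ^ n = (∫ x in (-1 : ℝ)..1, cosBump x ^ n) *
      ∑ k ∈ Finset.range (n + 1), sumWeight n k *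
        (2 * Real.sin (Real.pi * k * x) * Real.sin (Real.pi * k * y)) := by
  obtain ⟨a, ha⟩ := exists_cosBump_pow_eq n
  have hZ := (integral_cosBump_pos n).ne'
  have hw : ∀ k ∈ Finset.range (n + 1), 1 ≤ k →
      a k = (∫ x in (-1 : ℝ)..1, cosBump x ^ n) * sumWeight n k := by
    intro k hk hk1
    rw [sumWeight, mul_inv_cancel_left₀ hZ]
    simp_rw [ha, Finset.sum_mul, mul_assoc (a _)]
    rw [intervalIntegral.integral_finsetSum fun j _ ↦
      Continuous.intervalIntegrable (by fun_prop) _ _]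
    simp_rw [intervalIntegral.integral_const_mul, integral_cos_mul_cos _ k hk1]
    simp [Finset.mem_range.1 hk]
  rw [ha, ha, Finset.mul_sum, ← Finset.sum_sub_distrib]
  refine Finset.sum_congr rfl fun k hk ↦ ?_
  -- The constant frequency has a different normalization, but it cancels in the difference of the
  -- two kernels, where only products of sines remain.
  rcases Nat.eq_zero_or_pos k with rfl | hk1
  · simp
  · rw [← mul_assoc _ (sumWeight n k), ← hw k hk hk1,
      show Real.pi * k * (x - y) = Real.pi * k * x - Real.pi * k * y by ring,
      show Real.pi * k * (x + y) = Real.pi * k * x + Real.pi * k * y by ring,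
      Real.cos_sub, Real.cos_add]
    ring

/-- Summation of the sine series of a continuous function on `[0, 1]`. -/
lemma tendsto_sine_sum {g : ℝ → ℝ} (hg : ContinuousOn g (Set.Icc (0 : ℝ) 1)) {y : ℝ}
    (hy : y ∈ Set.Ioo (0 : ℝ) 1) :
    Tendsto (fun n : ℕ ↦ ∑ k ∈ Finset.range (n + 1), sumWeight n k *
      (2 * (∫ x in (0 : ℝ)..1, g x * Real.sin (Real.pi * k * x)) * Real.sin (Real.pi * k * y)))
      atTop (𝓝 (g y)) := by
  have hcc := continuous_cosBump
  have hgi : IntegrableOn g (Set.Icc (0 : ℝ) 1) := hg.integrableOn_compact isCompact_Icc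
  set G : ℝ → ℝ := fun x ↦ (Set.Icc (0 : ℝ) 1).indicator g x with hG
  have hGi : Integrable G := (integrable_indicator_iff measurableSet_Icc).2 hgi
  -- The odd extension of `g`: it agrees with `g` near `y`, and integrating the kernel against it
  -- produces the difference of kernels that expands in sines.
  set F : ℝ → ℝ := fun x ↦ G x - G (-x) with hF
  have hFi : Integrable F := hGi.sub hGi.comp_neg
  have hev : F =ᶠ[𝓝 y] g := by
    filter_upwards [isOpen_Ioo.mem_nhds hy] with x hx
    have h1 : x ∈ Set.Icc (0 : ℝ) 1 := Set.Ioo_subset_Icc_self hx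
    have h2 : -x ∉ Set.Icc (0 : ℝ) 1 := fun h ↦ by linarith [h.1, hx.1]
    simp [hF, hG, h1, h2]
  have hgc : ContinuousAt g y := hg.continuousAt (Icc_mem_nhds hy.1 hy.2)
  have h := tendsto_peak (g := F) (y := y) ⟨by linarith [hy.1], hy.2⟩ hFi.integrableOn
    (hgc.congr hev.symm)
  rw [hev.eq_of_nhds] at h
  refine h.congr fun n ↦ ?_
  have hbd : ∀ (c : ℝ → ℝ), Continuous c → Integrable (fun x ↦ cosBump (c x) ^ n * G x) := by
    intro c hc
    refine hGi.bdd_mul (c := 1) (Continuous.aestronglyMeasurable (by fun_prop)) (ae_of_all _ fun x ↦ ?_)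
    rw [Real.norm_of_nonneg (pow_nonneg (cosBump_nonneg _) _)]
    refine pow_le_one₀ (cosBump_nonneg _) ?_
    unfold cosBump; linarith [Real.cos_le_one (Real.pi * c x)]
  have hres : ∀ c : ℝ → ℝ, ∫ x in (-1 : ℝ)..1, cosBump (c x) ^ n * G x =
      ∫ x in (0 : ℝ)..1, cosBump (c x) ^ n * g x := by
    intro c
    rw [intervalIntegral.integral_of_le (by norm_num), intervalIntegral.integral_of_le (by norm_num),
      ← integral_Icc_eq_integral_Ioc, ← integral_Icc_eq_integral_Ioc]
    have e : (fun x ↦ cosBump (c x) ^ n * G x) =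
        (Set.Icc (0 : ℝ) 1).indicator (fun x ↦ cosBump (c x) ^ n * g x) := by
      funext x; by_cases hx : x ∈ Set.Icc (0 : ℝ) 1 <;> simp [hG, hx]
    rw [e, setIntegral_indicator measurableSet_Icc, Set.inter_eq_right.2
      (Set.Icc_subset_Icc (by norm_num) le_rfl)]
  have e1 : ∫ x in (-1 : ℝ)..1, cosBump (x - y) ^ n * F x =
      ∫ x in (0 : ℝ)..1, (cosBump (x - y) ^ n - cosBump (x + y) ^ n) * g x := by
    have e2 : ∀ x, cosBump (x - y) ^ n * F x = cosBump (x - y) ^ n * G x -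
        (fun u ↦ cosBump (u + y) ^ n * G u) (-x) := by
      intro x
      simp only [hF]
      rw [← cosBump_neg (x - y), show -(x - y) = -x + y by ring]; ring
    simp_rw [e2]
    rw [intervalIntegral.integral_sub (hbd _ (by fun_prop)).intervalIntegrable
      ((hbd (fun u ↦ u + y) (by fun_prop)).comp_neg).intervalIntegrable,
      intervalIntegral.integral_comp_neg (fun u ↦ cosBump (u + y) ^ n * G u), neg_neg, hres, hres,
      ← intervalIntegral.integral_sub]
    · congr 1; funext x; ring
    · exact (ContinuousOn.mul (Continuous.continuousOn (by fun_prop))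
        (by rwa [Set.uIcc_of_le zero_le_one])).intervalIntegrable
    · exact (ContinuousOn.mul (Continuous.continuousOn (by fun_prop))
        (by rwa [Set.uIcc_of_le zero_le_one])).intervalIntegrable
  rw [e1]
  simp_rw [cosBump_pow_sub n _ y, mul_assoc (∫ x in (-1 : ℝ)..1, cosBump x ^ n)]
  rw [intervalIntegral.integral_const_mul, inv_mul_cancel_left₀ (integral_cosBump_pos n).ne']
  simp_rw [Finset.sum_mul]
  rw [intervalIntegral.integral_finsetSum]
  · refine Finset.sum_congr rfl fun k _ ↦ ?_
    have : ∀ x, sumWeight n k * (2 * Real.sin (Real.pi * k * x) * Real.sin (Real.pi * k * y)) * g x =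
      (sumWeight n k * 2 * Real.sin (Real.pi * k * y)) * (g x * Real.sin (Real.pi * k * x)) := by
      intro x; ring
    simp_rw [this]
    rw [intervalIntegral.integral_const_mul]; ring
  · intro k _
    exact (ContinuousOn.mul (Continuous.continuousOn (by fun_prop))
        (by rwa [Set.uIcc_of_le zero_le_one])).intervalIntegrable

end PeakKernel

/-! ### Spectral theory of the differential operator. -/

namespace Params

variable (p : Params)

/-- The assumption on the parameters says exactly that $\lambda_1>0$, and
$\lambda_\ell=\pi^2\vartheta_2(\ell^2-1)+\lambda_1$; the smaller of the two coefficients serves for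
every $\ell\ge1$. -/
lemma exists_eigenvalue_ge : ∃ c : ℝ, 0 < c ∧ ∀ l : ℕ, 1 ≤ l → c * (l : ℝ) ^ 2 ≤ p.eigenvalue l := by
  have h2 := p.theta2_pos
  have h1 : 0 < p.eigenvalue 1 := by
    have := mul_pos h2 p.spectral_pos
    have e : p.theta2 * (p.theta1 ^ 2 / (4 * p.theta2 ^ 2) - p.theta0 / p.theta2 + Real.pi ^ 2) =
        p.eigenvalue 1 := by
      unfold eigenvalue; field_simp; push_cast; ring
    rwa [e] at this
  have hpi : 0 < Real.pi ^ 2 * p.theta2 := by positivity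
  refine ⟨min (Real.pi ^ 2 * p.theta2) (p.eigenvalue 1), lt_min hpi h1, fun l hl ↦ ?_⟩
  have hl' : (1 : ℝ) ≤ l := by exact_mod_cast hl
  have e : p.eigenvalue l = Real.pi ^ 2 * p.theta2 * ((l : ℝ) ^ 2 - 1) + p.eigenvalue 1 := by
    unfold eigenvalue; push_cast; ring
  rw [e]
  have hm1 := min_le_left (Real.pi ^ 2 * p.theta2) (p.eigenvalue 1)
  have hm2 := min_le_right (Real.pi ^ 2 * p.theta2) (p.eigenvalue 1)
  have hsq : 0 ≤ (l : ℝ) ^ 2 - 1 := by nlinarith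
  nlinarith [mul_le_mul_of_nonneg_right hm1 hsq]

lemma eigenvalue_pos {l : ℕ} (hl : 1 ≤ l) : 0 < p.eigenvalue l := by
  obtain ⟨c, hc, h⟩ := p.exists_eigenvalue_ge
  have hl' : (0 : ℝ) < l := by exact_mod_cast hl
  exact lt_of_lt_of_le (by positivity) (h l hl)

lemma eigenvalue_mono {k l : ℕ} (h : k ≤ l) : p.eigenvalue k ≤ p.eigenvalue l := by
  have h2 := p.theta2_pos
  have : (k : ℝ) ≤ l := by exact_mod_cast h
  unfold eigenvalue
  gcongr

lemma continuous_eigenfunction (l : ℕ) : Continuous (p.eigenfunction l) := by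
  unfold eigenfunction; fun_prop

@[simp] lemma eigenfunction_zero_right (l : ℕ) : p.eigenfunction l 0 = 0 := by simp [eigenfunction]

@[simp] lemma eigenfunction_one_right (l : ℕ) : p.eigenfunction l 1 = 0 := by
  have : Real.sin (Real.pi * l) = 0 := by rw [mul_comm]; exact Real.sin_nat_mul_pi l
  simp [eigenfunction, this]

/-- The first derivative of `e_l`. -/
def eigenfunctionDeriv (l : ℕ) (x : ℝ) : ℝ :=
  √2 * (Real.pi * l * Real.cos (Real.pi * l * x) - p.kappa / 2 * Real.sin (Real.pi * l * x)) *
    Real.exp (-(p.kappa * x / 2))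

/-- The second derivative of `e_l`. -/
def eigenfunctionDeriv2 (l : ℕ) (x : ℝ) : ℝ :=
  √2 * (-(Real.pi * l) ^ 2 * Real.sin (Real.pi * l * x) -
    p.kappa * (Real.pi * l) * Real.cos (Real.pi * l * x) +
    (p.kappa / 2) ^ 2 * Real.sin (Real.pi * l * x)) * Real.exp (-(p.kappa * x / 2))

lemma hasDerivAt_eigenfunction (l : ℕ) (x : ℝ) :
    HasDerivAt (p.eigenfunction l) (p.eigenfunctionDeriv l x) x := by
  have hs : HasDerivAt (fun x ↦ Real.sin (Real.pi * l * x))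
      (Real.cos (Real.pi * l * x) * (Real.pi * l * 1)) x :=
    ((hasDerivAt_id x).const_mul (Real.pi * l)).sin
  have he : HasDerivAt (fun x ↦ Real.exp (-(p.kappa * x / 2)))
      (Real.exp (-(p.kappa * x / 2)) * -(p.kappa * 1 / 2)) x :=
    (((hasDerivAt_id x).const_mul p.kappa).div_const 2).neg.exp
  have := (hs.const_mul (√2)).mul he
  refine this.congr_deriv ?_
  unfold eigenfunctionDeriv; ring

lemma hasDerivAt_eigenfunctionDeriv (l : ℕ) (x : ℝ) :
    HasDerivAt (p.eigenfunctionDeriv l) (p.eigenfunctionDeriv2 l x) x := by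
  have hs : HasDerivAt (fun x ↦ Real.sin (Real.pi * l * x))
      (Real.cos (Real.pi * l * x) * (Real.pi * l * 1)) x :=
    ((hasDerivAt_id x).const_mul (Real.pi * l)).sin
  have hc : HasDerivAt (fun x ↦ Real.cos (Real.pi * l * x))
      (-Real.sin (Real.pi * l * x) * (Real.pi * l * 1)) x :=
    ((hasDerivAt_id x).const_mul (Real.pi * l)).cos
  have he : HasDerivAt (fun x ↦ Real.exp (-(p.kappa * x / 2)))
      (Real.exp (-(p.kappa * x / 2)) * -(p.kappa * 1 / 2)) x :=
    (((hasDerivAt_id x).const_mul p.kappa).div_const 2).neg.exp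
  have := (((hc.const_mul (Real.pi * l)).sub (hs.const_mul (p.kappa / 2))).const_mul (√2)).mul he
  refine this.congr_deriv ?_
  simp only [Pi.sub_apply]
  unfold eigenfunctionDeriv2; ring

lemma dirichletDomain_eigenfunction (l : ℕ) :
    DirichletDomain (p.eigenfunction l) (p.eigenfunctionDeriv l) (p.eigenfunctionDeriv2 l) where
  memLp := by
    have hc : Continuous (p.eigenfunctionDeriv2 l) := by unfold eigenfunctionDeriv2; fun_prop
    have h1 : IntegrableOn (fun x ↦ ‖p.eigenfunctionDeriv2 l x‖ ^ 2) (Set.Icc (0 : ℝ) 1) :=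
      (Continuous.continuousOn (by fun_prop)).integrableOn_compact isCompact_Icc
    exact (memLp_two_iff_integrable_sq_norm hc.aestronglyMeasurable).2 h1
  deriv_eq := fun x _ ↦ by
    have hc : Continuous (p.eigenfunctionDeriv2 l) := by unfold eigenfunctionDeriv2; fun_prop
    rw [intervalIntegral.integral_eq_sub_of_hasDerivAt
      (fun y _ ↦ p.hasDerivAt_eigenfunctionDeriv l y) (hc.intervalIntegrable _ _)]
    ring
  eq_integral := fun x _ ↦ by
    have hc : Continuous (p.eigenfunctionDeriv l) := by unfold eigenfunctionDeriv; fun_prop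
    rw [intervalIntegral.integral_eq_sub_of_hasDerivAt
      (fun y _ ↦ p.hasDerivAt_eigenfunction l y) (hc.intervalIntegrable _ _)]
    simp
  right_eq_zero := p.eigenfunction_one_right l

lemma operator_eigenfunction (l : ℕ) (x : ℝ) :
    p.theta2 * p.eigenfunctionDeriv2 l x + p.theta1 * p.eigenfunctionDeriv l x +
      p.theta0 * p.eigenfunction l x = -p.eigenvalue l * p.eigenfunction l x := by
  have h2 := p.theta2_pos.ne'
  have hk : p.theta1 = p.kappa * p.theta2 := by unfold kappa; field_simp
  unfold eigenfunctionDeriv2 eigenfunctionDeriv eigenfunction eigenvalue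
  rw [hk]
  field_simp
  ring

/-- The weight $e^{\kappa x}$ cancels the two exponential factors and leaves the orthogonality of
sines on $[0,1]$. -/
lemma weightedInner_eigenfunction (k l : ℕ) (hl : 1 ≤ l) :
    p.weightedInner (p.eigenfunction k) (p.eigenfunction l) = if k = l then 1 else 0 := by
  have e : ∀ x, p.eigenfunction k x * p.eigenfunction l x * Real.exp (p.kappa * x) =
      2 * Real.sin (Real.pi * k * x) * Real.sin (Real.pi * l * x) := by
    intro x
    unfold eigenfunction
    have h2 : √2 * √2 = (2 : ℝ) := Real.mul_self_sqrt (by norm_num)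
    have h3 : Real.exp (-(p.kappa * x / 2)) * Real.exp (-(p.kappa * x / 2)) *
        Real.exp (p.kappa * x) = 1 := by
      rw [← Real.exp_add, ← Real.exp_add, Real.exp_eq_one_iff]; ring
    calc _ = (√2 * √2) * (Real.exp (-(p.kappa * x / 2)) * Real.exp (-(p.kappa * x / 2)) *
        Real.exp (p.kappa * x)) * (Real.sin (Real.pi * k * x) * Real.sin (Real.pi * l * x)) := by ring
      _ = _ := by rw [h2, h3]; ring
  have e2 : ∀ x : ℝ, 2 * Real.sin (Real.pi * k * x) * Real.sin (Real.pi * l * x) =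
      Real.cos (Real.pi * ((k - l : ℤ) : ℝ) * x) - Real.cos (Real.pi * ((k + l : ℤ) : ℝ) * x) := by
    intro x
    push_cast
    rw [show Real.pi * ((k : ℝ) - l) * x = Real.pi * k * x - Real.pi * l * x by ring,
      show Real.pi * ((k : ℝ) + l) * x = Real.pi * k * x + Real.pi * l * x by ring,
      Real.cos_sub, Real.cos_add]
    ring
  have hint : ∀ j : ℤ, j ≠ 0 → ∫ x in (0 : ℝ)..1, Real.cos (Real.pi * j * x) = 0 := by
    intro j hj
    have h : Real.pi * j ≠ 0 := mul_ne_zero Real.pi_ne_zero (by exact_mod_cast hj)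
    rw [intervalIntegral.integral_comp_mul_left _ h, integral_cos, mul_one, mul_comm,
      Real.sin_int_mul_pi j]
    simp
  unfold weightedInner
  simp_rw [e, e2]
  rw [intervalIntegral.integral_sub (Continuous.intervalIntegrable (by fun_prop) _ _)
    (Continuous.intervalIntegrable (by fun_prop) _ _), hint (k + l : ℤ) (by omega)]
  split_ifs with h
  · subst h; simp
  · rw [hint (k - l : ℤ) (by omega)]; simp

lemma memLp_of_continuous {f : ℝ → ℝ} (hf : Continuous f) : MemLp f 2 p.weight := by
  rw [memLp_two_iff_integrable_sq_norm hf.aestronglyMeasurable, weight,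
    integrable_withDensity_iff_integrable_smul₀' (by fun_prop) (by simp)]
  exact (Continuous.continuousOn (by
    simp only [ENNReal.toReal_ofReal (Real.exp_pos _).le]; fun_prop)).integrableOn_compact isCompact_Icc

lemma integral_weight (f : ℝ → ℝ) :
    ∫ x, f x ∂p.weight = ∫ x in (0 : ℝ)..1, f x * Real.exp (p.kappa * x) := by
  rw [weight, integral_withDensity_eq_integral_toReal_smul (by fun_prop) (by simp),
    intervalIntegral.integral_of_le zero_le_one, ← integral_Icc_eq_integral_Ioc]
  congr 1; funext x
  rw [ENNReal.toReal_ofReal (Real.exp_pos _).le, smul_eq_mul, mul_comm]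

/-- `e_l` as an element of the weighted `L²` space. -/
def eigenvector (l : ℕ) : p.L2 := (p.memLp_of_continuous (p.continuous_eigenfunction l)).toLp

lemma eigenvector_ae_eq (l : ℕ) : p.eigenvector l =ᵐ[p.weight] p.eigenfunction l := MemLp.coeFn_toLp _

lemma inner_eigenvector (k l : ℕ) (hl : 1 ≤ l) :
    inner ℝ (p.eigenvector k) (p.eigenvector l) = if k = l then (1 : ℝ) else 0 := by
  rw [← p.weightedInner_eigenfunction k l hl, L2.inner_def, weightedInner,
    ← p.integral_weight (fun x ↦ p.eigenfunction k x * p.eigenfunction l x)]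
  refine integral_congr_ae ?_
  filter_upwards [p.eigenvector_ae_eq k, p.eigenvector_ae_eq l] with x h1 h2
  rw [h1, h2]
  simp [mul_comm]

lemma norm_eigenvector {l : ℕ} (hl : 1 ≤ l) : ‖p.eigenvector l‖ = 1 := by
  have h := p.inner_eigenvector l l hl
  rw [if_pos rfl, real_inner_self_eq_norm_sq] at h
  exact (pow_eq_one_iff_of_nonneg (norm_nonneg _) two_ne_zero).1 h

/-- Summation of the eigenfunction expansion of a continuous function vanishing at `0` and `1`. -/
lemma tendsto_eigenfunction_sum {f : ℝ → ℝ} (hf : ContinuousOn f (Set.Icc (0 : ℝ) 1)) (h0 : f 0 = 0)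
    (h1 : f 1 = 0) {y : ℝ} (hy : y ∈ Set.Icc (0 : ℝ) 1) :
    Tendsto (fun n : ℕ ↦ ∑ k ∈ Finset.range (n + 1), sumWeight n k *
      (p.weightedInner f (p.eigenfunction k) * p.eigenfunction k y)) atTop (𝓝 (f y)) := by
  rcases eq_or_lt_of_le hy.1 with rfl | hy0
  · simp [h0]
  rcases eq_or_lt_of_le hy.2 with rfl | hy1
  · simp [h1]
  have hg : ContinuousOn (fun x ↦ f x * Real.exp (p.kappa * x / 2)) (Set.Icc (0 : ℝ) 1) :=
    hf.mul (Continuous.continuousOn (by fun_prop))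
  have h := (tendsto_sine_sum hg ⟨hy0, hy1⟩).mul_const (Real.exp (-(p.kappa * y / 2)))
  rw [mul_assoc, ← Real.exp_add, add_neg_cancel, Real.exp_zero, mul_one] at h
  refine h.congr fun n ↦ ?_
  rw [Finset.sum_mul]
  refine Finset.sum_congr rfl fun k _ ↦ ?_
  have e : p.weightedInner f (p.eigenfunction k) =
      √2 * ∫ x in (0 : ℝ)..1, f x * Real.exp (p.kappa * x / 2) * Real.sin (Real.pi * k * x) := by
    rw [weightedInner, ← intervalIntegral.integral_const_mul]
    congr 1; funext x
    have : Real.exp (p.kappa * x) = Real.exp (p.kappa * x / 2) * Real.exp (p.kappa * x / 2) := by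
      rw [← Real.exp_add]; congr 1; ring
    have h3 : Real.exp (-(p.kappa * x / 2)) * Real.exp (p.kappa * x / 2) = 1 := by
      rw [← Real.exp_add, neg_add_cancel, Real.exp_zero]
    rw [this, eigenfunction]
    linear_combination (f x * √2 * Real.sin (Real.pi * k * x) * Real.exp (p.kappa * x / 2)) * h3
  have h2 : √2 * √2 = (2 : ℝ) := Real.mul_self_sqrt (by norm_num)
  rw [e, eigenfunction]
  linear_combination (-(sumWeight n k * (∫ x in (0 : ℝ)..1, f x * Real.exp (p.kappa * x / 2) *
    Real.sin (Real.pi * k * x)) * Real.sin (Real.pi * k * y) * Real.exp (-(p.kappa * y / 2)))) * h2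

end Params

/-! ### Characteristic functions of linear forms. -/

section CharacteristicFunctional

variable {Ω : Type*} [MeasurableSpace Ω]

/-- The characteristic function at `1` of a real random variable. -/
def expI (P : Measure Ω) (Y : Ω → ℝ) : ℂ := ∫ ω, Complex.exp (Y ω * Complex.I) ∂P

variable {P : Measure Ω}

lemma expI_congr {Y Z : Ω → ℝ} (h : Y =ᵐ[P] Z) : expI P Y = expI P Z :=
  integral_congr_ae (by filter_upwards [h] with ω hω using by rw [hω])

lemma expI_eq_charFun {Y : Ω → ℝ} (hY : AEMeasurable Y P) (c : ℝ) :
    expI P (fun ω ↦ c * Y ω) = charFun (P.map Y) c := by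
  rw [charFun_apply_real, integral_map hY (Measurable.aestronglyMeasurable (by fun_prop)), expI]
  simp

lemma expI_eq_charFun_one {Y : Ω → ℝ} (hY : AEMeasurable Y P) :
    expI P Y = charFun (P.map Y) 1 := by
  rw [← expI_eq_charFun hY]; simp

lemma tendsto_expI [IsProbabilityMeasure P] {Y : ℕ → Ω → ℝ} {Z : Ω → ℝ}
    (hY : ∀ n, AEMeasurable (Y n) P) (h : ∀ᵐ ω ∂P, Tendsto (fun n ↦ Y n ω) atTop (𝓝 (Z ω))) :
    Tendsto (fun n ↦ expI P (Y n)) atTop (𝓝 (expI P Z)) := by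
  refine tendsto_integral_of_dominated_convergence (fun _ ↦ 1) (fun n ↦ ?_) (integrable_const _)
    (fun n ↦ ae_of_all _ fun ω ↦ by rw [Complex.norm_exp_ofReal_mul_I]) ?_
  · exact (Complex.measurable_exp.comp_aemeasurable
      ((Complex.measurable_ofReal.comp_aemeasurable (hY n)).mul_const _)).aestronglyMeasurable
  · filter_upwards [h] with ω hω
    exact (Complex.continuous_exp.tendsto _).comp
      (((Complex.continuous_ofReal.tendsto _).comp hω).mul_const _)

lemma expI_add_of_indepFun {Y Z : Ω → ℝ} (hYZ : IndepFun Y Z P) (hY : AEMeasurable Y P)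
    (hZ : AEMeasurable Z P) : expI P (fun ω ↦ Y ω + Z ω) = expI P Y * expI P Z := by
  have hm : Measurable fun x : ℝ ↦ Complex.exp (x * Complex.I) := by fun_prop
  have h := (hYZ.comp hm hm).integral_fun_mul_eq_mul_integral
    (hm.comp_aemeasurable hY).aestronglyMeasurable (hm.comp_aemeasurable hZ).aestronglyMeasurable
  simp only [Function.comp] at h
  rw [expI, expI, expI, ← h]
  congr 1; funext ω
  rw [← Complex.exp_add]; push_cast; ring_nf

/-- The characteristic function of a linear combination of independent centered Gaussian
variables. -/
lemma expI_sum_of_iIndepFun {ι : Type*} [IsProbabilityMeasure P] {X : ι → Ω → ℝ} {v : ι → ℝ≥0}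
    (hX : iIndepFun X P) (hlaw : ∀ i, HasLaw (X i) (gaussianReal 0 (v i)) P) (s : Finset ι)
    (c : ι → ℝ) :
    expI P (fun ω ↦ ∑ i ∈ s, c i * X i ω) =
      Complex.exp (((-(∑ i ∈ s, c i ^ 2 * v i) / 2 : ℝ)) : ℂ) := by
  have hm : ∀ i, AEMeasurable (fun ω ↦ c i * X i ω) P := fun i ↦ (hlaw i).aemeasurable.const_mul _
  have hind : iIndepFun (fun i ω ↦ c i * X i ω) P :=
    hX.comp (fun i x ↦ c i * x) fun i ↦ measurable_const_mul _
  rw [expI_eq_charFun_one (Finset.aemeasurable_fun_sum _ fun i _ ↦ hm i),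
    (hind.restrict s).charFun_map_fun_finsetSum_eq_prod fun i _ ↦ hm i, Finset.prod_apply]
  have h1 : ∀ i ∈ s, charFun (P.map (fun ω ↦ c i * X i ω)) 1 =
      Complex.exp (((-(c i ^ 2 * v i) / 2 : ℝ)) : ℂ) := by
    intro i _
    rw [← expI_eq_charFun_one (hm i), expI_eq_charFun (hlaw i).aemeasurable, (hlaw i).map_eq,
      charFun_gaussianReal]
    congr 1; push_cast; ring
  rw [Finset.prod_congr rfl h1, ← Complex.exp_sum]
  congr 1
  rw [← Complex.ofReal_sum, ← Finset.sum_div, Finset.sum_neg_distrib]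

end CharacteristicFunctional

/-! ### Independent increments of the cylindrical Brownian motion. -/

section WhiteNoise

variable {Ω : Type*} [MeasurableSpace Ω] {p : Params} {P : Measure Ω}
  {W : ℝ≥0 → p.L2 → Ω → ℝ}

/-- The increment of `W(e_{l+1})` over the `j`-th interval of length `h`. -/
def noiseIncrement (p : Params) (W : ℝ≥0 → p.L2 → Ω → ℝ) (h : ℝ≥0) (q : ℕ × ℕ) (ω : Ω) : ℝ :=
  W ((q.2 + 1 : ℕ) * h) (p.eigenvector (q.1 + 1)) ω - W (q.2 * h) (p.eigenvector (q.1 + 1)) ω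

lemma IsCylindricalBM.isGaussianProcess_noiseIncrement (hW : IsCylindricalBM p P W) (h : ℝ≥0) :
    IsGaussianProcess (noiseIncrement p W h) P := by
  classical
  refine hW.gaussian.of_isGaussianProcess fun q ↦
    ⟨{((q.2 + 1 : ℕ) * h, p.eigenvector (q.1 + 1)), (q.2 * h, p.eigenvector (q.1 + 1))},
      { toFun := fun x ↦ x ⟨((q.2 + 1 : ℕ) * h, p.eigenvector (q.1 + 1)), by simp⟩ -
          x ⟨(q.2 * h, p.eigenvector (q.1 + 1)), by simp⟩
        map_add' := fun x y ↦ by simp; abel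
        map_smul' := fun c x ↦ by simp; ring }, fun ω ↦ by simp [noiseIncrement]⟩

lemma IsCylindricalBM.memLp (hW : IsCylindricalBM p P W) (t : ℝ≥0) (u : p.L2) :
    MemLp (W t u) 2 P := (hW.gaussian.hasGaussianLaw_eval (t, u)).memLp_two

lemma IsCylindricalBM.covariance_noiseIncrement [IsProbabilityMeasure P] (hW : IsCylindricalBM p P W)
    (h : ℝ≥0) (q r : ℕ × ℕ) :
    cov[noiseIncrement p W h q, noiseIncrement p W h r; P] = if q = r then (h : ℝ) else 0 := by
  unfold noiseIncrement
  rw [covariance_fun_sub_fun_sub (hW.memLp _ _) (hW.memLp _ _) (hW.memLp _ _) (hW.memLp _ _),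
    hW.covariance, hW.covariance, hW.covariance, hW.covariance,
    p.inner_eigenvector _ _ (Nat.succ_pos _)]
  have hmin : ∀ a b : ℕ, ((min ((a : ℝ≥0) * h) ((b : ℝ≥0) * h) : ℝ≥0) : ℝ) =
      (min a b : ℕ) * (h : ℝ) := by
    intro a b
    rw [← min_mul_of_nonneg _ _ (zero_le (a := h))]
    push_cast; rfl
  simp only [hmin]
  by_cases h1 : q.1 = r.1
  · rw [if_pos (by omega)]
    by_cases h2 : q.2 = r.2
    · rw [if_pos (Prod.ext h1 h2), h2]
      simp; ring
    · rw [if_neg (fun e ↦ h2 (by rw [e]))]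
      rcases lt_or_gt_of_ne h2 with hlt | hlt
      · rw [min_eq_left (by omega : q.2 + 1 ≤ r.2 + 1), min_eq_left (by omega : q.2 + 1 ≤ r.2),
          min_eq_left (by omega : q.2 ≤ r.2 + 1), min_eq_left (by omega : q.2 ≤ r.2)]
        ring
      · rw [min_eq_right (by omega : r.2 + 1 ≤ q.2 + 1), min_eq_right (by omega : r.2 ≤ q.2 + 1),
          min_eq_right (by omega : r.2 + 1 ≤ q.2), min_eq_right (by omega : r.2 ≤ q.2)]
        ring
  · rw [if_neg (by omega), if_neg (fun e ↦ h1 (by rw [e]))]; ring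

lemma IsCylindricalBM.hasLaw_noiseIncrement [IsProbabilityMeasure P] (hW : IsCylindricalBM p P W) (h : ℝ≥0)
    (q : ℕ × ℕ) : HasLaw (noiseIncrement p W h q) (gaussianReal 0 h) P := by
  have hg := (hW.isGaussianProcess_noiseIncrement h).hasGaussianLaw_eval q
  refine ⟨hg.aemeasurable, ?_⟩
  -- The Gaussian and covariance properties leave the means open; they vanish because $W(e_\ell)$ is
  -- a Brownian motion for a unit vector $e_\ell$.
  have hB := (hW.brownian _ (p.norm_eigenvector (Nat.succ_pos q.1))).toIsPreBrownianReal
  rw [hg.map_eq_gaussianReal, ← covariance_self hg.aemeasurable, hW.covariance_noiseIncrement,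
    if_pos rfl, Real.toNNReal_coe]
  congr 1
  unfold noiseIncrement
  rw [integral_sub (hB.integrable_eval _) (hB.integrable_eval _), hB.integral_eval,
    hB.integral_eval, sub_zero]

/-- Jointly Gaussian and uncorrelated, over disjoint time intervals as well as over different modes.
-/
lemma IsCylindricalBM.iIndepFun_noiseIncrement [IsProbabilityMeasure P] (hW : IsCylindricalBM p P W) (h : ℝ≥0) :
    iIndepFun (noiseIncrement p W h) P := by
  rw [iIndepFun_iff_finset]
  intro s
  have hg := (hW.isGaussianProcess_noiseIncrement h).hasGaussianLaw s
  refine HasGaussianLaw.iIndepFun_of_covariance_eq_zero hg fun i j hij ↦ ?_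
  have := hW.covariance_noiseIncrement h i j
  rw [if_neg (fun e ↦ hij (Subtype.ext e))] at this
  exact this

end WhiteNoise

/-! ### Coefficient processes of a weak solution. -/

section Coefficients

/-- The projection of the real line to `[0, 1]`. -/
def clip (x : ℝ) : ℝ := max 0 (min x 1)

lemma clip_mem (x : ℝ) : clip x ∈ Set.Icc (0 : ℝ) 1 :=
  ⟨le_max_left _ _, max_le zero_le_one (min_le_right _ _)⟩

lemma clip_of_mem {x : ℝ} (hx : x ∈ Set.Icc (0 : ℝ) 1) : clip x = x := by
  rw [clip, min_eq_left hx.2, max_eq_right hx.1]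

lemma continuous_clip : Continuous clip := by unfold clip; fun_prop

/-- The field is controlled only on $[0,1]$; clipping replaces it by a function that is continuous
on the whole line without changing the integral. -/
lemma weightedInner_clip (p : Params) (f g : ℝ → ℝ) :
    p.weightedInner f g = ∫ x in (0 : ℝ)..1, f (clip x) * g x * Real.exp (p.kappa * x) := by
  refine intervalIntegral.integral_congr fun x hx ↦ ?_
  rw [Set.uIcc_of_le zero_le_one] at hx
  simp only [clip_of_mem hx]

lemma continuous_weightedInner_path (p : Params) {F : ℝ → ℝ → ℝ}
    (hF : ContinuousOn (fun z : ℝ × ℝ ↦ F z.1 z.2) (Set.Ici (0 : ℝ) ×ˢ Set.Icc (0 : ℝ) 1)) (l : ℕ) :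
    Continuous fun t ↦ p.weightedInner (F (max t 0)) (p.eigenfunction l) := by
  have hcl := continuous_clip
  have he := p.continuous_eigenfunction l
  have h1 : Continuous fun z : ℝ × ℝ ↦ F (max z.1 0) (clip z.2) :=
    hF.comp_continuous (f := fun z : ℝ × ℝ ↦ (max z.1 0, clip z.2)) (by fun_prop)
      fun z ↦ ⟨Set.mem_Ici.2 (le_max_right _ _), clip_mem _⟩
  simp_rw [weightedInner_clip]
  refine intervalIntegral.continuous_parametric_intervalIntegral_of_continuous' ?_ 0 1
  have h2 : Continuous fun z : ℝ × ℝ ↦ p.eigenfunction l z.2 := he.comp continuous_snd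
  exact (h1.mul h2).mul (by fun_prop)

lemma tendsto_riemann_weightedInner (p : Params) {f : ℝ → ℝ} (hf : ContinuousOn f (Set.Icc (0 : ℝ) 1))
    (l : ℕ) :
    Tendsto (fun n : ℕ ↦ ∑ k ∈ Finset.range n, (1 / n : ℝ) * (f (clip (0 + k * (1 / n : ℝ))) *
      p.eigenfunction l (0 + k * (1 / n : ℝ)) * Real.exp (p.kappa * (0 + k * (1 / n : ℝ)))))
      atTop (𝓝 (p.weightedInner f (p.eigenfunction l))) := by
  have hc : Continuous fun x ↦ f (clip x) := hf.comp_continuous continuous_clip clip_mem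
  have he := p.continuous_eigenfunction l
  have h := tendsto_riemann_sum (f := fun x ↦ f (clip x) * p.eigenfunction l x *
    Real.exp (p.kappa * x)) ((hc.mul he).mul (by fun_prop)) 0 zero_le_one
  rw [weightedInner_clip]
  simpa only [zero_add] using h

variable {Ω : Type*} [MeasurableSpace Ω]

/-- The coefficient `⟨X_t, e_l⟩`. -/
def coefficient (p : Params) (X : ℝ → ℝ → Ω → ℝ) (l : ℕ) (t : ℝ) (ω : Ω) : ℝ :=
  p.weightedInner (fun x ↦ X t x ω) (p.eigenfunction l)

variable {p : Params} {ic : InitialCondition} {P : Measure Ω} {W : ℝ≥0 → p.L2 → Ω → ℝ}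
  {X : ℝ → ℝ → Ω → ℝ}

lemma IsWeakSolution.continuousOn_slice (hX : IsWeakSolution p ic P W X) :
    ∀ᵐ ω ∂P, ∀ t : ℝ, 0 ≤ t → ContinuousOn (fun x ↦ X t x ω) (Set.Icc (0 : ℝ) 1) := by
  filter_upwards [hX.continuous] with ω hω t ht
  exact hω.comp (f := fun x : ℝ ↦ (t, x)) (Continuous.continuousOn (by fun_prop))
    fun x hx ↦ ⟨ht, hx⟩

lemma IsWeakSolution.aemeasurable_riemann (hX : IsWeakSolution p ic P W X) (l : ℕ) {t : ℝ}
    (ht : 0 ≤ t) (n : ℕ) :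
    AEMeasurable (fun ω ↦ ∑ k ∈ Finset.range n, (1 / n : ℝ) * (X t (clip (0 + k * (1 / n : ℝ))) ω *
      p.eigenfunction l (0 + k * (1 / n : ℝ)) * Real.exp (p.kappa * (0 + k * (1 / n : ℝ))))) P :=
  Finset.aemeasurable_fun_sum _ fun _ _ ↦
    (((hX.aemeasurable t ht _ (clip_mem _)).mul_const _).mul_const _).const_mul _

/-- Measurability is given for individual values of the field only, so it is passed to the integral
through its Riemann sums. -/
lemma IsWeakSolution.aemeasurable_coefficient (hX : IsWeakSolution p ic P W X) (l : ℕ) {t : ℝ}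
    (ht : 0 ≤ t) : AEMeasurable (coefficient p X l t) P := by
  refine aemeasurable_of_tendsto_metrizable_ae atTop (hX.aemeasurable_riemann l ht) ?_
  filter_upwards [hX.continuousOn_slice] with ω hω
  exact tendsto_riemann_weightedInner p (hω t ht) l

/-- The weak equation tested against $e_\ell$, on which the operator acts as $-\lambda_\ell$: the
coefficient solves a scalar linear equation driven by $W(e_\ell)$. The `max` makes the path
continuous on the whole line. -/
lemma IsWeakSolution.ae_increment (hX : IsWeakSolution p ic P W X) (l : ℕ) (s t : ℝ≥0) :
    ∀ᵐ ω ∂P, coefficient p X l (max (t : ℝ) 0) ω - coefficient p X l (max (s : ℝ) 0) ω +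
      p.eigenvalue l * ∫ r in (s : ℝ)..t, coefficient p X l (max r 0) ω =
      p.sigma * (W t (p.eigenvector l) ω - W s (p.eigenvector l) ω) := by
  have hw := hX.weak_eq _ _ _ (p.dirichletDomain_eigenfunction l) _ (p.eigenvector_ae_eq l)
  filter_upwards [hw s, hw t, hX.continuous] with ω hs ht hc
  have hcont := continuous_weightedInner_path p (F := fun t x ↦ X t x ω) hc l
  have hint : ∀ u : ℝ≥0, ∫ r in (0 : ℝ)..u, p.weightedInner (fun x ↦ X r x ω)
      (fun x ↦ p.theta2 * p.eigenfunctionDeriv2 l x + p.theta1 * p.eigenfunctionDeriv l x +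
        p.theta0 * p.eigenfunction l x) =
      -p.eigenvalue l * ∫ r in (0 : ℝ)..u, coefficient p X l (max r 0) ω := by
    intro u
    rw [← intervalIntegral.integral_const_mul]
    refine intervalIntegral.integral_congr fun r hr ↦ ?_
    rw [Set.uIcc_of_le (NNReal.coe_nonneg u)] at hr
    simp only [p.operator_eigenfunction, max_eq_left hr.1, coefficient, Params.weightedInner]
    rw [← intervalIntegral.integral_const_mul]
    congr 1; funext x; ring
  rw [hint] at hs ht
  have hsub := intervalIntegral.integral_interval_sub_left (μ := volume)
    (hcont.intervalIntegrable (0 : ℝ) t) (hcont.intervalIntegrable (0 : ℝ) s)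
  simp only [coefficient, max_eq_left (NNReal.coe_nonneg _)] at hs ht hsub ⊢
  rw [← hsub]
  linear_combination ht - hs

/-- The innovations of the coefficient processes are limits of sums of increments of the noise. -/
lemma IsWeakSolution.tendsto_innovation (hX : IsWeakSolution p ic P W X) (Δ : ℝ≥0) (l i : ℕ) :
    ∀ᵐ ω ∂P, Tendsto (fun n : ℕ ↦ ∑ k ∈ Finset.range n,
      (p.sigma * Real.exp (-(p.eigenvalue (l + 1) * (Δ - k * (Δ / n))))) *
        noiseIncrement p W (Δ / n) (l, i * n + k) ω) atTop
      (𝓝 (coefficient p X (l + 1) ((i + 1 : ℕ) * Δ) ω -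
        Real.exp (-(p.eigenvalue (l + 1) * Δ)) * coefficient p X (l + 1) (i * Δ) ω)) := by
  -- The weak equation has an exceptional null set for each time; only the countably many partition
  -- times are needed.
  have hinc : ∀ᵐ ω ∂P, ∀ n k : ℕ, _ := ae_all_iff.2 fun n : ℕ ↦ ae_all_iff.2 fun k : ℕ ↦
    hX.ae_increment (l + 1) ((i * n + k : ℕ) * (Δ / n)) ((i * n + k + 1 : ℕ) * (Δ / n))
  filter_upwards [hinc, hX.continuous] with ω hω hc
  have hcont := continuous_weightedInner_path p (F := fun t x ↦ X t x ω) hc (l + 1)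
  have h := tendsto_sum_exp_increment hcont (p.eigenvalue (l + 1)) (i * Δ) (NNReal.coe_nonneg Δ)
  have e1 : (i : ℝ) * Δ + (Δ : ℝ) = (i + 1 : ℕ) * Δ := by push_cast; ring
  have hlim : (p.weightedInner (fun x ↦ X (max (i * (Δ : ℝ) + Δ) 0) x ω) (p.eigenfunction (l + 1)) -
      Real.exp (-(p.eigenvalue (l + 1) * Δ)) *
        p.weightedInner (fun x ↦ X (max (i * (Δ : ℝ)) 0) x ω) (p.eigenfunction (l + 1))) =
      (coefficient p X (l + 1) ((i + 1 : ℕ) * Δ) ω -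
        Real.exp (-(p.eigenvalue (l + 1) * Δ)) * coefficient p X (l + 1) (i * Δ) ω) := by
    rw [e1, max_eq_left (by positivity), max_eq_left (by positivity)]; rfl
  have h' := hlim ▸ h
  refine h'.congr fun n ↦ Finset.sum_congr rfl fun k hk ↦ ?_
  have hn : (n : ℝ) ≠ 0 := by
    have := Finset.mem_range.1 hk
    exact_mod_cast (by omega : n ≠ 0)
  have hk := hω n k
  have t1 : ((((i * n + k : ℕ) : ℝ≥0) * (Δ / n) : ℝ≥0) : ℝ) = i * (Δ : ℝ) + k * (Δ / n) := by
    push_cast; field_simp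
  have t2 : ((((i * n + k + 1 : ℕ) : ℝ≥0) * (Δ / n) : ℝ≥0) : ℝ) =
      i * (Δ : ℝ) + (k + 1 : ℕ) * (Δ / n) := by
    push_cast; field_simp; ring
  rw [t1, t2] at hk
  simp only [coefficient] at hk
  rw [noiseIncrement, mul_comm p.sigma, mul_assoc]
  rw [← hk]
  congr 3; ring

end Coefficients

/-! ### Linear algebra of AR(1) recursions. -/

section Autoregression

/-- The coefficients of a linear form in an autoregressive path with respect to its innovations. -/
def backSum (ρ : ℝ) (N : ℕ) (b : ℕ → ℝ) (j : ℕ) : ℝ :=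
  ∑ i ∈ Finset.range (N + 1), if j ≤ i then b i * ρ ^ (i - j) else 0

/-- The innovations of the path `u` with respect to the coefficient `ρ`. -/
def innovation (ρ : ℝ) (u : ℕ → ℝ) : ℕ → ℝ
  | 0 => u 0
  | j + 1 => u (j + 1) - ρ * u j

lemma eq_sum_innovation (ρ : ℝ) (u : ℕ → ℝ) (i : ℕ) :
    u i = ∑ j ∈ Finset.range (i + 1), ρ ^ (i - j) * innovation ρ u j := by
  induction i with
  | zero => simp [innovation]
  | succ i ih =>
    rw [Finset.sum_range_succ]
    have : ∑ j ∈ Finset.range (i + 1), ρ ^ (i + 1 - j) * innovation ρ u j = ρ * u i := by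
      rw [ih, Finset.mul_sum]
      refine Finset.sum_congr rfl fun j hj ↦ ?_
      have hj' := Finset.mem_range.1 hj
      rw [show i + 1 - j = (i - j) + 1 by omega, pow_succ]
      ring
    rw [this]
    simp [innovation]

/-- Rewrites a linear form in the path as one in the innovations, which are independent; its
variance then becomes a sum of squares. -/
lemma sum_mul_eq_sum_backSum (ρ : ℝ) (N : ℕ) (b u : ℕ → ℝ) :
    ∑ i ∈ Finset.range (N + 1), b i * u i =
      ∑ j ∈ Finset.range (N + 1), backSum ρ N b j * innovation ρ u j := by
  simp_rw [backSum, Finset.sum_mul]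
  rw [Finset.sum_comm]
  refine Finset.sum_congr rfl fun i hi ↦ ?_
  have hi' := Finset.mem_range.1 hi
  conv_lhs => rw [eq_sum_innovation ρ u i, Finset.mul_sum]
  simp_rw [ite_mul, zero_mul]
  rw [← Finset.sum_filter]
  refine Finset.sum_congr ?_ fun j _ ↦ by ring
  ext j; simp only [Finset.mem_range, Finset.mem_filter]; omega

lemma backSum_const_mul (ρ : ℝ) (N : ℕ) (c : ℝ) (b : ℕ → ℝ) (j : ℕ) :
    backSum ρ N (fun i ↦ c * b i) j = c * backSum ρ N b j := by
  rw [backSum, backSum, Finset.mul_sum]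
  exact Finset.sum_congr rfl fun i _ ↦ by split_ifs <;> ring

lemma abs_backSum_le {ρ : ℝ} (h0 : 0 ≤ ρ) (h1 : ρ ≤ 1) (N : ℕ) (b : ℕ → ℝ) (j : ℕ) :
    |backSum ρ N b j| ≤ ∑ i ∈ Finset.range (N + 1), if j ≤ i then |b i| else 0 := by
  refine (Finset.abs_sum_le_sum_abs _ _).trans (Finset.sum_le_sum fun i _ ↦ ?_)
  split_ifs
  · rw [abs_mul, abs_of_nonneg (pow_nonneg h0 _)]
    exact mul_le_of_le_one_right (abs_nonneg _) (pow_le_one₀ h0 h1)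
  · simp

end Autoregression

/-! ### Variances of the modes. -/

section Scales

variable (p : Params) (ic : InitialCondition)

/-- The stationary variance `σ² / (2 λ_l)` of the `l`-th coefficient. -/
def modeVariance (l : ℕ) : ℝ := p.sigmaSq / (2 * p.eigenvalue l)

/-- The autoregression coefficient of the `l`-th coefficient process. -/
def modeDecay (Δ : ℝ) (l : ℕ) : ℝ := Real.exp (-(p.eigenvalue l * Δ))

/-- The standard deviations of the innovations of the `l`-th coefficient process. -/
def innovationScale (Δ : ℝ) (l : ℕ) : ℕ → ℝ
  | 0 => initialCoefficient p ic l 1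
  | _ + 1 => p.sigma * √((1 - Real.exp (-(2 * p.eigenvalue l * Δ))) / (2 * p.eigenvalue l))

/-- The variance of a linear form in the values of the `l`-th coefficient process. -/
def modeForm (Δ : ℝ) (N l : ℕ) (b : ℕ → ℝ) : ℝ :=
  ∑ j ∈ Finset.range (N + 1),
    backSum (modeDecay p Δ l) N b j ^ 2 * innovationScale p ic Δ l j ^ 2

variable {p}

lemma modeVariance_pos {l : ℕ} (hl : 1 ≤ l) : 0 < modeVariance p l :=
  div_pos p.sigmaSq_pos (mul_pos two_pos (p.eigenvalue_pos hl))

lemma modeDecay_nonneg (Δ : ℝ) (l : ℕ) : 0 ≤ modeDecay p Δ l := (Real.exp_pos _).le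

lemma modeDecay_le_one {Δ : ℝ} (hΔ : 0 ≤ Δ) {l : ℕ} (hl : 1 ≤ l) : modeDecay p Δ l ≤ 1 := by
  rw [modeDecay, Real.exp_le_one_iff, neg_nonpos]
  exact mul_nonneg (p.eigenvalue_pos hl).le hΔ

/-- This is the innovation variance that keeps the stationary variance invariant under the
recursion. -/
lemma innovationScale_succ_sq {Δ : ℝ} (hΔ : 0 ≤ Δ) {l : ℕ} (hl : 1 ≤ l) (j : ℕ) :
    innovationScale p ic Δ l (j + 1) ^ 2 = modeVariance p l * (1 - modeDecay p Δ l ^ 2) := by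
  have hlam := p.eigenvalue_pos hl
  have h1 : Real.exp (-(2 * p.eigenvalue l * Δ)) = modeDecay p Δ l ^ 2 := by
    rw [modeDecay, ← Real.exp_nat_mul]; congr 1; push_cast; ring
  have h2 : modeDecay p Δ l ^ 2 ≤ 1 := pow_le_one₀ (modeDecay_nonneg _ _) (modeDecay_le_one hΔ hl)
  rw [innovationScale, mul_pow, Params.sigma, Real.sq_sqrt p.sigmaSq_pos.le, h1, Real.sq_sqrt
    (div_nonneg (by linarith) (by linarith)), modeVariance]
  field_simp

lemma innovationScale_zero_sq_stationary (Δ : ℝ) {l : ℕ} (hl : 1 ≤ l) :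
    innovationScale p .stationary Δ l 0 ^ 2 = modeVariance p l := by
  simp only [innovationScale, initialCoefficient, mul_one]
  exact Real.sq_sqrt (modeVariance_pos hl).le

lemma innovationScale_zero_zero (Δ : ℝ) (l : ℕ) : innovationScale p .zero Δ l 0 = 0 := rfl

lemma innovationScale_sq_le {Δ : ℝ} (hΔ : 0 ≤ Δ) {l : ℕ} (hl : 1 ≤ l) (j : ℕ) :
    innovationScale p ic Δ l j ^ 2 ≤ modeVariance p l := by
  have hv := (modeVariance_pos (p := p) hl).le
  rcases j with _ | j
  · cases ic
    · rw [innovationScale_zero_zero]; simpa using hv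
    · rw [innovationScale_zero_sq_stationary Δ hl]
  · rw [innovationScale_succ_sq ic hΔ hl]
    exact mul_le_of_le_one_right hv (by linarith [sq_nonneg (modeDecay p Δ l)])

lemma modeForm_nonneg (Δ : ℝ) (N l : ℕ) (b : ℕ → ℝ) : 0 ≤ modeForm p ic Δ N l b :=
  Finset.sum_nonneg fun _ _ ↦ mul_nonneg (sq_nonneg _) (sq_nonneg _)

lemma modeForm_const_mul (Δ : ℝ) (N l : ℕ) (c : ℝ) (b : ℕ → ℝ) :
    modeForm p ic Δ N l (fun i ↦ c * b i) = c ^ 2 * modeForm p ic Δ N l b := by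
  rw [modeForm, modeForm, Finset.mul_sum]
  exact Finset.sum_congr rfl fun j _ ↦ by rw [backSum_const_mul]; ring

lemma modeForm_le {Δ : ℝ} (hΔ : 0 ≤ Δ) (N : ℕ) {l : ℕ} (hl : 1 ≤ l) (b : ℕ → ℝ) :
    modeForm p ic Δ N l b ≤
      (N + 1) * (∑ i ∈ Finset.range (N + 1), |b i|) ^ 2 * modeVariance p l := by
  have : ∀ j ∈ Finset.range (N + 1), backSum (modeDecay p Δ l) N b j ^ 2 *
      innovationScale p ic Δ l j ^ 2 ≤
      (∑ i ∈ Finset.range (N + 1), |b i|) ^ 2 * modeVariance p l := by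
    intro j _
    refine mul_le_mul ?_ (innovationScale_sq_le ic hΔ hl j) (sq_nonneg _) (sq_nonneg _)
    rw [← sq_abs]
    refine pow_le_pow_left₀ (abs_nonneg _) ((abs_backSum_le (modeDecay_nonneg _ _)
      (modeDecay_le_one hΔ hl) N b j).trans (Finset.sum_le_sum fun i _ ↦ ?_)) 2
    split_ifs
    · exact le_rfl
    · exact abs_nonneg _
  refine (Finset.sum_le_sum this).trans_eq ?_
  simp; ring

lemma summable_modeVariance : Summable fun l : ℕ ↦ modeVariance p (l + 1) := by
  obtain ⟨c, hc, h⟩ := p.exists_eigenvalue_ge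
  have hs : Summable fun l : ℕ ↦ p.sigmaSq / (2 * c) * (1 / ((l + 1 : ℕ) : ℝ) ^ 2) :=
    ((summable_nat_add_iff 1).2 (Real.summable_one_div_nat_pow.2 one_lt_two)).mul_left _
  refine Summable.of_nonneg_of_le (fun l ↦ (modeVariance_pos (Nat.succ_pos l)).le) (fun l ↦ ?_) hs
  have hl : (0 : ℝ) < ((l + 1 : ℕ) : ℝ) := by positivity
  have h1 := h (l + 1) (Nat.succ_pos l)
  rw [modeVariance, div_mul_div_comm, mul_one]
  refine div_le_div_of_nonneg_left p.sigmaSq_pos.le (by positivity) ?_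
  linarith

/-- For forms bounded uniformly in the mode, the variances are dominated by
$\sum_\ell\sigma^2/(2\lambda_\ell)$, which converges by the quadratic growth of $\lambda_\ell$. -/
lemma summable_modeForm {Δ : ℝ} (hΔ : 0 ≤ Δ) (N : ℕ) (b : ℕ → ℕ → ℝ) {C : ℝ}
    (hb : ∀ l, ∀ i ∈ Finset.range (N + 1), |b l i| ≤ C) :
    Summable fun l : ℕ ↦ modeForm p ic Δ N (l + 1) (b (l + 1)) := by
  refine Summable.of_nonneg_of_le (fun l ↦ modeForm_nonneg ic Δ N _ _) (fun l ↦ ?_)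
    ((summable_modeVariance (p := p)).mul_left ((N + 1) * ((N + 1) * C) ^ 2))
  refine (modeForm_le ic hΔ N (Nat.succ_pos l) _).trans
    (mul_le_mul_of_nonneg_right ?_ (modeVariance_pos (Nat.succ_pos l)).le)
  refine mul_le_mul_of_nonneg_left (pow_le_pow_left₀ (Finset.sum_nonneg fun _ _ ↦ abs_nonneg _) ?_ 2)
    (by positivity)
  refine (Finset.sum_le_sum fun i hi ↦ hb (l + 1) i hi).trans_eq ?_
  simp

end Scales

/-! ### Initial coefficients and the variance of one innovation. -/

section ObservationLaw

variable {Ω : Type*} [MeasurableSpace Ω] {p : Params} {ic : InitialCondition} {P : Measure Ω}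
  [IsProbabilityMeasure P] {W : ℝ≥0 → p.L2 → Ω → ℝ} {X : ℝ → ℝ → Ω → ℝ}

lemma IsWeakSolution.expI_initial (hX : IsWeakSolution p ic P W X) (Δ : ℝ) (n : ℕ) (α : ℕ → ℝ) :
    expI P (fun ω ↦ ∑ l ∈ Finset.range n, α l * coefficient p X (l + 1) 0 ω) =
      Complex.exp (((-(∑ l ∈ Finset.range n, α l ^ 2 * innovationScale p ic Δ (l + 1) 0 ^ 2) / 2 : ℝ))
        : ℂ) := by
  have hi := hX.initial_law
  cases ic with
  | zero =>
    have h0 : (fun ω ↦ ∑ l ∈ Finset.range n, α l * coefficient p X (l + 1) 0 ω) =ᵐ[P] fun _ ↦ 0 := by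
      filter_upwards [hi] with ω hω
      refine Finset.sum_eq_zero fun l _ ↦ ?_
      have : coefficient p X (l + 1) 0 ω = 0 := by
        rw [coefficient, Params.weightedInner]
        rw [intervalIntegral.integral_congr (g := fun _ ↦ (0 : ℝ)), intervalIntegral.integral_zero]
        intro x hx
        rw [Set.uIcc_of_le zero_le_one] at hx
        simp [hω x hx]
      rw [this, mul_zero]
    rw [expI_congr h0]
    simp [expI, innovationScale_zero_zero]
  | stationary =>
    obtain ⟨h1, h2⟩ := hi
    have h := expI_sum_of_iIndepFun (X := fun j ↦ coefficient p X (j + 1) 0)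
      (v := fun j ↦ (modeVariance p (j + 1)).toNNReal) h1 (fun j ↦ h2 (j + 1) (Nat.succ_pos j))
      (Finset.range n) α
    suffices e : ∑ l ∈ Finset.range n, α l ^ 2 * innovationScale p .stationary Δ (l + 1) 0 ^ 2 =
        ∑ l ∈ Finset.range n, α l ^ 2 * ((modeVariance p (l + 1)).toNNReal : ℝ) by rw [h, e]
    refine Finset.sum_congr rfl fun l _ ↦ ?_
    rw [innovationScale_zero_sq_stationary Δ (Nat.succ_pos l),
      Real.coe_toNNReal _ (modeVariance_pos (Nat.succ_pos l)).le]

/-- Plays the role of the Itô isometry: it is the limit of the variances of the weighted sums of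
increments. The endpoint `0 + Δ` matches `tendsto_riemann_sum`. -/
lemma integral_sq_exp {Δ : ℝ} (hΔ : 0 ≤ Δ) {l : ℕ} (hl : 1 ≤ l) (j : ℕ) :
    ∫ s in (0 : ℝ)..(0 + Δ), (p.sigma * Real.exp (-(p.eigenvalue l * (Δ - s)))) ^ 2 =
      innovationScale p ic Δ l (j + 1) ^ 2 := by
  have hlam := (p.eigenvalue_pos hl).ne'
  have hd : ∀ s ∈ Set.uIcc (0 : ℝ) (0 + Δ), HasDerivAt
      (fun s ↦ modeVariance p l * Real.exp (-(2 * p.eigenvalue l * (Δ - s))))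
      ((p.sigma * Real.exp (-(p.eigenvalue l * (Δ - s)))) ^ 2) s := by
    intro s _
    have h1 : HasDerivAt (fun s ↦ -(2 * p.eigenvalue l * (Δ - s))) (-(2 * p.eigenvalue l * -1)) s :=
      (((hasDerivAt_id s).const_sub Δ).const_mul _).neg
    refine (h1.exp.const_mul (modeVariance p l)).congr_deriv ?_
    rw [mul_pow, Params.sigma, Real.sq_sqrt p.sigmaSq_pos.le, ← Real.exp_nat_mul, modeVariance,
      show ((2 : ℕ) : ℝ) * -(p.eigenvalue l * (Δ - s)) = -(2 * p.eigenvalue l * (Δ - s)) by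
        push_cast; ring]
    field_simp
  rw [intervalIntegral.integral_eq_sub_of_hasDerivAt hd
    (Continuous.intervalIntegrable (by fun_prop) _ _), innovationScale_succ_sq ic hΔ hl, modeDecay,
    ← Real.exp_nat_mul]
  simp only [zero_add, sub_self, mul_zero, neg_zero, Real.exp_zero, sub_zero]
  rw [show ((2 : ℕ) : ℝ) * -(p.eigenvalue l * Δ) = -(2 * p.eigenvalue l * Δ) by push_cast; ring]
  ring

end ObservationLaw

/-! ### The characteristic function of the observations. -/

section ObservationLaw

variable {Ω : Type*} [MeasurableSpace Ω] {p : Params} {ic : InitialCondition} {P : Measure Ω}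
  [IsProbabilityMeasure P] {W : ℝ≥0 → p.L2 → Ω → ℝ} {X : ℝ → ℝ → Ω → ℝ}

/-- The approximation of the `i`-th innovation of the `(l+1)`-st coefficient by a sum over `n`
increments of the noise. -/
def approxInnovation (p : Params) (W : ℝ≥0 → p.L2 → Ω → ℝ) (Δ : ℝ≥0) (n l i : ℕ) (ω : Ω) : ℝ :=
  ∑ k ∈ Finset.range n, (p.sigma * Real.exp (-(p.eigenvalue (l + 1) * (Δ - k * (Δ / n))))) *
    noiseIncrement p W (Δ / n) (l, i * n + k) ω

lemma IsCylindricalBM.aemeasurable_approxInnovation (hW : IsCylindricalBM p P W) (Δ : ℝ≥0)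
    (n l i : ℕ) : AEMeasurable (approxInnovation p W Δ n l i) P :=
  Finset.aemeasurable_fun_sum _ fun _ _ ↦ (hW.hasLaw_noiseIncrement _ _).aemeasurable.const_mul _

lemma IsCylindricalBM.expI_approxInnovation (hW : IsCylindricalBM p P W) (Δ : ℝ≥0) (n m N : ℕ)
    (g : ℕ → ℕ → ℝ) :
    expI P (fun ω ↦ ∑ l ∈ Finset.range m, ∑ i ∈ Finset.range N,
        g l i * approxInnovation p W Δ n l i ω) =
      Complex.exp (((-(∑ l ∈ Finset.range m, ∑ i ∈ Finset.range N, g l i ^ 2 *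
        ∑ k ∈ Finset.range n, (Δ / n : ℝ) *
          (p.sigma * Real.exp (-(p.eigenvalue (l + 1) * (Δ - (0 + k * (Δ / n : ℝ)))))) ^ 2) / 2 : ℝ)) : ℂ) := by
  classical
  set D : ℕ × ℕ × Fin n → Ω → ℝ := fun q ↦ noiseIncrement p W (Δ / n) (q.1, q.2.1 * n + q.2.2)
    with hD
  -- Subinterval $k$ of observation interval $i$ has the number $in+k$; Euclidean division shows
  -- that no noise increment is used twice.
  have hinj : Function.Injective fun q : ℕ × ℕ × Fin n ↦ (q.1, q.2.1 * n + (q.2.2 : ℕ)) := by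
    rintro ⟨l, i, k⟩ ⟨l', i', k'⟩ h
    simp only [Prod.mk.injEq] at h
    obtain ⟨h1, h2⟩ := h
    have hk := k.2
    have hk' := k'.2
    have e1 : (i * n + (k : ℕ)) % n = (i' * n + (k' : ℕ)) % n := by rw [h2]
    rw [Nat.mul_add_mod_self_right, Nat.mul_add_mod_self_right, Nat.mod_eq_of_lt hk,
      Nat.mod_eq_of_lt hk'] at e1
    have e2 : i * n = i' * n := by omega
    have e3 := Nat.eq_of_mul_eq_mul_right (by omega) e2
    simp [h1, e3, Fin.ext e1]
  have hind : iIndepFun D P := (hW.iIndepFun_noiseIncrement (Δ / n)).precomp hinj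
  have h := expI_sum_of_iIndepFun (v := fun _ ↦ Δ / n) hind
    (fun q ↦ hW.hasLaw_noiseIncrement _ _)
    (Finset.range m ×ˢ Finset.range N ×ˢ (Finset.univ : Finset (Fin n)))
    (fun q ↦ g q.1 q.2.1 *
      (p.sigma * Real.exp (-(p.eigenvalue (q.1 + 1) * (Δ - (q.2.2 : ℕ) * (Δ / n))))))
  simp only [Finset.sum_product] at h
  have e1 : (fun ω ↦ ∑ l ∈ Finset.range m, ∑ i ∈ Finset.range N,
        g l i * approxInnovation p W Δ n l i ω) = fun ω ↦ ∑ l ∈ Finset.range m,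
        ∑ i ∈ Finset.range N, ∑ k : Fin n, g l i * (p.sigma * Real.exp (-(p.eigenvalue (l + 1) *
          (Δ - (k : ℕ) * (Δ / n))))) * D (l, i, k) ω := by
    funext ω
    refine Finset.sum_congr rfl fun l _ ↦ Finset.sum_congr rfl fun i _ ↦ ?_
    rw [approxInnovation, Finset.sum_range, Finset.mul_sum]
    exact Finset.sum_congr rfl fun k _ ↦ by rw [hD]; ring
  have e2 : ∑ l ∈ Finset.range m, ∑ i ∈ Finset.range N, g l i ^ 2 *
        ∑ k ∈ Finset.range n, (Δ / n : ℝ) *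
          (p.sigma * Real.exp (-(p.eigenvalue (l + 1) * (Δ - (0 + k * (Δ / n : ℝ)))))) ^ 2 =
      ∑ l ∈ Finset.range m, ∑ i ∈ Finset.range N, ∑ k : Fin n, (g l i * (p.sigma *
        Real.exp (-(p.eigenvalue (l + 1) * (Δ - (k : ℕ) * (Δ / n)))))) ^ 2 *
          ((Δ / n : ℝ≥0) : ℝ) := by
    refine Finset.sum_congr rfl fun l _ ↦ Finset.sum_congr rfl fun i _ ↦ ?_
    rw [Finset.sum_range, Finset.mul_sum]
    exact Finset.sum_congr rfl fun k _ ↦ by rw [zero_add]; push_cast; ring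
  rw [e1, h, e2]

/-- The initial values and the innovations of the coefficient processes are independent centered
Gaussian variables. -/
lemma IsWeakSolution.expI_innovation (hX : IsWeakSolution p ic P W X) (Δ : ℝ≥0) (m N : ℕ)
    (c : ℕ → ℕ → ℝ) :
    expI P (fun ω ↦ ∑ l ∈ Finset.range m, ∑ j ∈ Finset.range (N + 1), c l j *
        innovation (modeDecay p Δ (l + 1)) (fun i ↦ coefficient p X (l + 1) (i * Δ) ω) j) =
      Complex.exp (((-(∑ l ∈ Finset.range m, ∑ j ∈ Finset.range (N + 1),
        c l j ^ 2 * innovationScale p ic Δ (l + 1) j ^ 2) / 2 : ℝ)) : ℂ) := by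
  -- the approximations of the initial part and of the noise part
  set A : ℕ → Ω → ℝ := fun n ω ↦ ∑ l ∈ Finset.range m, c l 0 * ∑ k ∈ Finset.range n,
    (1 / n : ℝ) * (X 0 (clip (0 + k * (1 / n : ℝ))) ω *
      p.eigenfunction (l + 1) (0 + k * (1 / n : ℝ)) * Real.exp (p.kappa * (0 + k * (1 / n : ℝ))))
    with hA
  set Z : ℕ → Ω → ℝ := fun n ω ↦ ∑ l ∈ Finset.range m, ∑ i ∈ Finset.range N,
    c l (i + 1) * approxInnovation p W Δ n l i ω with hZ
  have hAm : ∀ n, AEMeasurable (A n) P := fun n ↦ Finset.aemeasurable_fun_sum _ fun l _ ↦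
    (hX.aemeasurable_riemann (l + 1) le_rfl n).const_mul _
  have hZm : ∀ n, AEMeasurable (Z n) P := fun n ↦ Finset.aemeasurable_fun_sum _ fun l _ ↦
    Finset.aemeasurable_fun_sum _ fun i _ ↦
      (hX.noise.aemeasurable_approxInnovation Δ n l i).const_mul _
  -- The approximations depend on finitely many values of $X_0$ and of $W$, hence are measurable
  -- functions on the product spaces for which independence is assumed. This is why Riemann sums are
  -- used for the initial coefficients too.
  have hind : ∀ n, IndepFun (A n) (Z n) P := by
    intro n
    have h1 : Measurable fun u : Set.Icc (0 : ℝ) 1 → ℝ ↦ ∑ l ∈ Finset.range m, c l 0 *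
        ∑ k ∈ Finset.range n, (1 / n : ℝ) * (u ⟨clip (0 + k * (1 / n : ℝ)), clip_mem _⟩ *
          p.eigenfunction (l + 1) (0 + k * (1 / n : ℝ)) *
            Real.exp (p.kappa * (0 + k * (1 / n : ℝ)))) := by
      fun_prop
    have h2 : Measurable fun w : ℝ≥0 × p.L2 → ℝ ↦ ∑ l ∈ Finset.range m, ∑ i ∈ Finset.range N,
        c l (i + 1) * ∑ k ∈ Finset.range n,
          (p.sigma * Real.exp (-(p.eigenvalue (l + 1) * (Δ - k * (Δ / n))))) *
          (w (((i * n + k : ℕ) + 1 : ℕ) * (Δ / n), p.eigenvector (l + 1)) -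
            w ((i * n + k : ℕ) * (Δ / n), p.eigenvector (l + 1))) := by
      fun_prop
    exact hX.initial_indep.comp h1 h2
  have hprod : ∀ n, expI P (fun ω ↦ A n ω + Z n ω) = expI P (A n) * expI P (Z n) := fun n ↦
    expI_add_of_indepFun (hind n) (hAm n) (hZm n)
  have hAlim : ∀ᵐ ω ∂P, Tendsto (fun n ↦ A n ω) atTop
      (𝓝 (∑ l ∈ Finset.range m, c l 0 * coefficient p X (l + 1) 0 ω)) := by
    filter_upwards [hX.continuousOn_slice] with ω hω
    exact tendsto_finsetSum _ fun l _ ↦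
      (tendsto_riemann_weightedInner p (hω 0 le_rfl) (l + 1)).const_mul _
  have hZlim : ∀ᵐ ω ∂P, Tendsto (fun n ↦ Z n ω) atTop
      (𝓝 (∑ l ∈ Finset.range m, ∑ i ∈ Finset.range N, c l (i + 1) *
        (coefficient p X (l + 1) ((i + 1 : ℕ) * Δ) ω -
        Real.exp (-(p.eigenvalue (l + 1) * Δ)) * coefficient p X (l + 1) (i * Δ) ω))) := by
    have := ae_all_iff.2 fun l : ℕ ↦ ae_all_iff.2 fun i : ℕ ↦ hX.tendsto_innovation Δ l i
    filter_upwards [this] with ω hω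
    exact tendsto_finsetSum _ fun l _ ↦ tendsto_finsetSum _ fun i _ ↦ (hω l i).const_mul _
  have hsum : ∀ ω, ∑ l ∈ Finset.range m, ∑ j ∈ Finset.range (N + 1), c l j *
        innovation (modeDecay p Δ (l + 1)) (fun i ↦ coefficient p X (l + 1) (i * Δ) ω) j =
      (∑ l ∈ Finset.range m, c l 0 * coefficient p X (l + 1) 0 ω) +
      ∑ l ∈ Finset.range m, ∑ i ∈ Finset.range N, c l (i + 1) *
        (coefficient p X (l + 1) ((i + 1 : ℕ) * Δ) ω -
        Real.exp (-(p.eigenvalue (l + 1) * Δ)) * coefficient p X (l + 1) (i * Δ) ω) := by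
    intro ω
    rw [← Finset.sum_add_distrib]
    refine Finset.sum_congr rfl fun l _ ↦ ?_
    rw [Finset.sum_range_succ', add_comm]
    simp [innovation, modeDecay]
  have hL := tendsto_expI (fun n ↦ (hAm n).add (hZm n))
    (Z := fun ω ↦ ∑ l ∈ Finset.range m, ∑ j ∈ Finset.range (N + 1), c l j *
        innovation (modeDecay p Δ (l + 1)) (fun i ↦ coefficient p X (l + 1) (i * Δ) ω) j)
    (by
      filter_upwards [hAlim, hZlim] with ω h1 h2
      rw [hsum]; exact h1.add h2)
  have hA' := tendsto_expI hAm hAlim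
  rw [hX.expI_initial Δ] at hA'
  -- The variances of the noise sums are Riemann sums of the integral in `integral_sq_exp`.
  have hZ' : Tendsto (fun n ↦ expI P (Z n)) atTop (𝓝 (Complex.exp
      (((-(∑ l ∈ Finset.range m, ∑ i ∈ Finset.range N, c l (i + 1) ^ 2 *
        innovationScale p ic Δ (l + 1) (i + 1) ^ 2) / 2 : ℝ)) : ℂ))) := by
    simp only [hZ, hX.noise.expI_approxInnovation]
    refine (Complex.continuous_exp.tendsto _).comp ((Complex.continuous_ofReal.tendsto _).comp
      (Tendsto.div_const (Tendsto.neg ?_) 2))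
    refine tendsto_finsetSum _ fun l _ ↦ tendsto_finsetSum _ fun i _ ↦ Tendsto.const_mul _ ?_
    rw [← integral_sq_exp (NNReal.coe_nonneg Δ) (Nat.le_add_left 1 l) i]
    exact tendsto_riemann_sum (f := fun s ↦ (p.sigma *
      Real.exp (-(p.eigenvalue (l + 1) * (Δ - s)))) ^ 2) (by fun_prop) 0 (NNReal.coe_nonneg Δ)
  have hlim := tendsto_nhds_unique (hL.congr fun n ↦ hprod n) (hA'.mul hZ')
  rw [hlim, ← Complex.exp_add]
  congr 1
  rw [← Complex.ofReal_add, ← add_div, ← neg_add, ← Finset.sum_add_distrib]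
  congr 4
  funext l
  rw [Finset.sum_range_succ' _ N, add_comm]

/-- The coefficients in the eigenfunctions of a linear form in the observations. -/
def spatialForm (p : Params) (M : ℕ) (a : ℕ → ℕ → ℝ) (l i : ℕ) : ℝ :=
  ∑ k ∈ Finset.range (M + 1), a i k * p.eigenfunction l (k / M)

lemma abs_eigenfunction_le (p : Params) (l : ℕ) {y : ℝ} (hy : y ∈ Set.Icc (0 : ℝ) 1) :
    |p.eigenfunction l y| ≤ √2 * Real.exp |p.kappa| := by
  rw [Params.eigenfunction, abs_mul, abs_mul, abs_of_nonneg (Real.sqrt_nonneg 2), Real.abs_exp, mul_assoc]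
  refine mul_le_mul_of_nonneg_left ?_ (Real.sqrt_nonneg 2)
  refine (mul_le_of_le_one_left (Real.exp_pos _).le (Real.abs_sin_le_one _)).trans ?_
  refine Real.exp_le_exp.2 ?_
  have h1 := neg_abs_le p.kappa
  have h2 := abs_nonneg p.kappa
  nlinarith [hy.1, hy.2, mul_le_mul_of_nonneg_right h1 hy.1]

lemma exists_abs_spatialForm_le (p : Params) (N M : ℕ) (a : ℕ → ℕ → ℝ) (hM : 1 ≤ M) :
    ∃ C : ℝ, ∀ l, ∀ i ∈ Finset.range (N + 1), |spatialForm p M a l i| ≤ C := by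
  refine ⟨∑ i ∈ Finset.range (N + 1), ∑ k ∈ Finset.range (M + 1), |a i k| * (√2 * Real.exp |p.kappa|),
    fun l i hi ↦ ?_⟩
  refine le_trans ?_ (Finset.single_le_sum (f := fun i ↦ ∑ k ∈ Finset.range (M + 1), |a i k| *
    (√2 * Real.exp |p.kappa|)) (fun _ _ ↦ Finset.sum_nonneg fun _ _ ↦ by positivity) hi)
  refine (Finset.abs_sum_le_sum_abs _ _).trans (Finset.sum_le_sum fun k hk ↦ ?_)
  rw [abs_mul]
  refine mul_le_mul_of_nonneg_left (abs_eigenfunction_le p l ?_) (abs_nonneg _)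
  have hM' : (0 : ℝ) < M := by exact_mod_cast hM
  have hk' : (k : ℝ) ≤ M := by exact_mod_cast Nat.lt_succ_iff.1 (Finset.mem_range.1 hk)
  exact ⟨by positivity, (div_le_one hM').2 hk'⟩

lemma summable_modeForm_spatialForm (p : Params) (ic : InitialCondition) {Δ : ℝ} (hΔ : 0 ≤ Δ)
    (N : ℕ) {M : ℕ} (hM : 1 ≤ M) (a : ℕ → ℕ → ℝ) :
    Summable fun l : ℕ ↦ modeForm p ic Δ N (l + 1) (spatialForm p M a (l + 1)) := by
  obtain ⟨C, hC⟩ := exists_abs_spatialForm_le p N M a hM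
  exact summable_modeForm ic hΔ N (spatialForm p M a) hC

/-- The characteristic function of the observation vector. -/
lemma IsWeakSolution.expI_observation (hX : IsWeakSolution p ic P W X) (Δ : ℝ≥0) (N : ℕ) {M : ℕ}
    (hM : 1 ≤ M) (a : ℕ → ℕ → ℝ) :
    expI P (fun ω ↦ ∑ i ∈ Finset.range (N + 1), ∑ k ∈ Finset.range (M + 1),
        a i k * X (i * Δ) (k / M) ω) =
      Complex.exp (((-(∑' l : ℕ, modeForm p ic Δ N (l + 1) (spatialForm p M a (l + 1))) / 2 : ℝ)) : ℂ) := by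
  have hmem : ∀ k ∈ Finset.range (M + 1), (k / M : ℝ) ∈ Set.Icc (0 : ℝ) 1 := by
    intro k hk
    have hM' : (0 : ℝ) < M := by exact_mod_cast hM
    have hk' : (k : ℝ) ≤ M := by exact_mod_cast Nat.lt_succ_iff.1 (Finset.mem_range.1 hk)
    exact ⟨by positivity, (div_le_one hM').2 hk'⟩
  have hnn : ∀ i : ℕ, (0 : ℝ) ≤ i * Δ := fun i ↦ by positivity
  -- The smoothed and truncated eigenfunction expansion of the linear form. The mode zero is absent
  -- because $e_0=0$.
  set Y : ℕ → Ω → ℝ := fun n ω ↦ ∑ l ∈ Finset.range n, ∑ i ∈ Finset.range (N + 1),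
    sumWeight n (l + 1) * spatialForm p M a (l + 1) i * coefficient p X (l + 1) (i * Δ) ω with hY
  have hYm : ∀ n, AEMeasurable (Y n) P := fun n ↦ Finset.aemeasurable_fun_sum _ fun l _ ↦
    Finset.aemeasurable_fun_sum _ fun i _ ↦ (hX.aemeasurable_coefficient (l + 1) (hnn i)).const_mul _
  have hlim : ∀ᵐ ω ∂P, Tendsto (fun n ↦ Y n ω) atTop (𝓝 (∑ i ∈ Finset.range (N + 1),
      ∑ k ∈ Finset.range (M + 1), a i k * X (i * Δ) (k / M) ω)) := by
    filter_upwards [hX.continuousOn_slice, hX.boundary] with ω hω hb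
    have h : Tendsto (fun n : ℕ ↦ ∑ i ∈ Finset.range (N + 1), ∑ k ∈ Finset.range (M + 1),
        a i k * ∑ l ∈ Finset.range (n + 1), sumWeight n l *
          (coefficient p X l (i * Δ) ω * p.eigenfunction l (k / M))) atTop
        (𝓝 (∑ i ∈ Finset.range (N + 1), ∑ k ∈ Finset.range (M + 1), a i k * X (i * Δ) (k / M) ω)) :=
      tendsto_finsetSum _ fun i _ ↦ tendsto_finsetSum _ fun k hk ↦
        (p.tendsto_eigenfunction_sum (hω _ (hnn i)) (hb _ (hnn i)).1 (hb _ (hnn i)).2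
          (hmem k hk)).const_mul _
    refine h.congr fun n ↦ ?_
    have h0 : ∀ y, p.eigenfunction 0 y = 0 := fun y ↦ by simp [Params.eigenfunction]
    simp only [Finset.sum_range_succ' _ n, h0, mul_zero, add_zero, hY]
    rw [Finset.sum_comm (s := Finset.range n)]
    refine Finset.sum_congr rfl fun i _ ↦ ?_
    simp_rw [Finset.mul_sum]
    rw [Finset.sum_comm]
    refine Finset.sum_congr rfl fun l _ ↦ ?_
    rw [spatialForm, Finset.mul_sum, Finset.sum_mul]
    exact Finset.sum_congr rfl fun k _ ↦ by ring
  have hexp : ∀ n, expI P (Y n) = Complex.exp (((-(∑' l : ℕ, if l < n then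
      sumWeight n (l + 1) ^ 2 * modeForm p ic Δ N (l + 1) (spatialForm p M a (l + 1)) else 0) / 2 : ℝ))
        : ℂ) := by
    intro n
    have e : Y n = fun ω ↦ ∑ l ∈ Finset.range n, ∑ j ∈ Finset.range (N + 1),
        backSum (modeDecay p Δ (l + 1)) N
          (fun i ↦ sumWeight n (l + 1) * spatialForm p M a (l + 1) i) j *
        innovation (modeDecay p Δ (l + 1)) (fun i ↦ coefficient p X (l + 1) (i * Δ) ω) j := by
      funext ω
      exact Finset.sum_congr rfl fun l _ ↦ sum_mul_eq_sum_backSum _ _ _ _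
    rw [e, hX.expI_innovation Δ n N (fun l j ↦ backSum (modeDecay p Δ (l + 1)) N
      (fun i ↦ sumWeight n (l + 1) * spatialForm p M a (l + 1) i) j)]
    rw [tsum_eq_sum (s := Finset.range n) (fun l hl ↦ if_neg fun h ↦ hl (Finset.mem_range.2 h))]
    have e2 : ∀ l ∈ Finset.range n, (if l < n then
        sumWeight n (l + 1) ^ 2 * modeForm p ic Δ N (l + 1) (spatialForm p M a (l + 1)) else 0) =
        ∑ j ∈ Finset.range (N + 1), backSum (modeDecay p Δ (l + 1)) N
          (fun i ↦ sumWeight n (l + 1) * spatialForm p M a (l + 1) i) j ^ 2 *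
          innovationScale p ic Δ (l + 1) j ^ 2 := by
      intro l hl
      rw [if_pos (Finset.mem_range.1 hl), ← modeForm_const_mul]
      rfl
    rw [Finset.sum_congr rfl e2]
  have h1 := tendsto_expI hYm hlim
  -- Each multiplier tends to one and none exceeds one in absolute value, so the unsmoothed
  -- variances dominate.
  have hts : Tendsto (fun n : ℕ ↦ ∑' l : ℕ, if l < n then
      sumWeight n (l + 1) ^ 2 * modeForm p ic Δ N (l + 1) (spatialForm p M a (l + 1)) else 0) atTop
      (𝓝 (∑' l : ℕ, modeForm p ic Δ N (l + 1) (spatialForm p M a (l + 1)))) := by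
    refine tendsto_tsum_of_dominated_convergence
      (summable_modeForm_spatialForm p ic (NNReal.coe_nonneg Δ) N hM a) (fun l ↦ ?_)
      (Eventually.of_forall fun n l ↦ ?_)
    · have := ((tendsto_sumWeight (l + 1)).pow 2).mul_const
        (modeForm p ic Δ N (l + 1) (spatialForm p M a (l + 1)))
      rw [one_pow, one_mul] at this
      refine this.congr' ?_
      filter_upwards [eventually_gt_atTop l] with n hn
      rw [if_pos hn]
    · have h0 := modeForm_nonneg (p := p) ic Δ N (l + 1) (spatialForm p M a (l + 1))
      split_ifs
      · rw [norm_mul, Real.norm_of_nonneg (sq_nonneg _), Real.norm_of_nonneg h0]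
        refine mul_le_of_le_one_left h0 ?_
        rw [← sq_abs]
        exact pow_le_one₀ (abs_nonneg _) (abs_sumWeight_le _ _)
      · simpa using h0
  have h2 := ((Complex.continuous_exp.tendsto _).comp ((Complex.continuous_ofReal.tendsto _).comp
    (hts.neg.div_const 2)))
  exact tendsto_nhds_unique h1 (h2.congr fun n ↦ (hexp n).symm)

end ObservationLaw

/-! ### Aliasing of the modes on the grid. -/

section Aliasing

variable {M : ℕ}

lemma mem_modeSet_iff {m : ℕ} (hm : m ∈ Finset.Ico 1 M) (l : ℕ) :
    l ∈ modeSet M m ↔ l % (2 * M) = m ∨ l % (2 * M) = 2 * M - m := by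
  obtain ⟨h1, h2⟩ := Finset.mem_Ico.1 hm
  have key : ∀ r, r < 2 * M → ((∃ n : ℕ, l = r + 2 * n * M) ↔ l % (2 * M) = r) := by
    intro r hr
    constructor
    · rintro ⟨n, rfl⟩
      rw [show r + 2 * n * M = r + (2 * M) * n by ring, Nat.add_mul_mod_self_left,
        Nat.mod_eq_of_lt hr]
    · intro h
      refine ⟨l / (2 * M), ?_⟩
      have := Nat.mod_add_div l (2 * M)
      rw [h] at this
      conv_lhs => rw [← this]
      ring
  simp only [modeSet, Set.mem_union, Set.mem_ofPred_eq]
  rw [key m (by omega), key (2 * M - m) (by omega)]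

/-- Every mode is aliased to exactly one mode `m < M`, or vanishes on the grid. -/
lemma modeSet_cases (hM : 1 ≤ M) (l : ℕ) :
    (l % M = 0 ∧ ∀ m ∈ Finset.Ico 1 M, l ∉ modeSet M m) ∨
    ∃ m ∈ Finset.Ico 1 M, l ∈ modeSet M m ∧ ∀ m' ∈ Finset.Ico 1 M, l ∈ modeSet M m' → m' = m := by
  have hr : l % (2 * M) < 2 * M := Nat.mod_lt _ (by omega)
  have hmod : l % M = l % (2 * M) % M := (Nat.mod_mul_left_mod l 2 M).symm
  by_cases h0 : l % (2 * M) = 0 ∨ l % (2 * M) = M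
  · left
    refine ⟨?_, fun m hm hl ↦ ?_⟩
    · rw [hmod]; rcases h0 with h | h <;> simp [h]
    · rw [mem_modeSet_iff hm] at hl
      have := Finset.mem_Ico.1 hm
      omega
  · right
    push Not at h0
    by_cases h1 : l % (2 * M) < M
    · have hm : l % (2 * M) ∈ Finset.Ico 1 M := Finset.mem_Ico.2 ⟨by omega, h1⟩
      refine ⟨_, hm, (mem_modeSet_iff hm l).2 (Or.inl rfl), fun m' hm' hl ↦ ?_⟩
      rw [mem_modeSet_iff hm'] at hl
      have := Finset.mem_Ico.1 hm'
      omega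
    · have hm : 2 * M - l % (2 * M) ∈ Finset.Ico 1 M := Finset.mem_Ico.2 ⟨by omega, by omega⟩
      refine ⟨_, hm, (mem_modeSet_iff hm l).2 (Or.inr (by omega)), fun m' hm' hl ↦ ?_⟩
      rw [mem_modeSet_iff hm'] at hl
      have := Finset.mem_Ico.1 hm'
      omega

lemma eigenfunction_grid_of_mod_eq_zero (p : Params) (hM : 1 ≤ M) {l : ℕ} (hl : l % M = 0) (k : ℕ) :
    p.eigenfunction l (k / M) = 0 := by
  obtain ⟨q, rfl⟩ := Nat.dvd_of_mod_eq_zero hl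
  have hM' : (M : ℝ) ≠ 0 := by exact_mod_cast (by omega : M ≠ 0)
  have : Real.sin (Real.pi * ((M * q : ℕ) : ℝ) * (k / M)) = 0 := by
    rw [show Real.pi * ((M * q : ℕ) : ℝ) * (k / M) = ((q * k : ℕ) : ℝ) * Real.pi by
      push_cast; field_simp]
    exact Real.sin_nat_mul_pi _
  rw [Params.eigenfunction, this, mul_zero, zero_mul]

/-- On the grid the sine is periodic in $\ell$ with period $2M$ and odd about multiples of it; the
exponential factor does not depend on $\ell$. The sign is $+1$ on the first family of modes and $-1$
on the second. -/
lemma eigenfunction_grid_of_mem (p : Params) {m l : ℕ} (hm : m ∈ Finset.Ico 1 M)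
    (hl : l ∈ modeSet M m) :
    ∃ ε : ℝ, ε ^ 2 = 1 ∧ ∀ k : ℕ, p.eigenfunction l (k / M) = ε * p.eigenfunction m (k / M) := by
  obtain ⟨h1, h2⟩ := Finset.mem_Ico.1 hm
  have hM' : (M : ℝ) ≠ 0 := by exact_mod_cast (by omega : M ≠ 0)
  rcases hl with ⟨n, hn⟩ | ⟨n, hn⟩
  · refine ⟨1, one_pow 2, fun k ↦ ?_⟩
    have e : Real.pi * (l : ℝ) * (k / M) =
        Real.pi * m * (k / M) + ((n * k : ℕ) : ℝ) * (2 * Real.pi) := by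
      rw [hn]; push_cast; field_simp
    rw [Params.eigenfunction, Params.eigenfunction, e, Real.sin_add_nat_mul_two_pi, one_mul]
  · refine ⟨-1, by norm_num, fun k ↦ ?_⟩
    have e : Real.pi * (l : ℝ) * (k / M) =
        ((n * k + k : ℕ) : ℝ) * (2 * Real.pi) - Real.pi * m * (k / M) := by
      rw [hn]; push_cast [Nat.cast_sub (by omega : m ≤ 2 * M)]; field_simp; ring
    rw [Params.eigenfunction, Params.eigenfunction, e, Real.sin_nat_mul_two_pi_sub]
    ring

-- Variances are even in the form, so the aliasing sign disappears and a mode contributes through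
-- its representative $m<M$, if it has one.
open Classical in
lemma modeForm_spatialForm (p : Params) (ic : InitialCondition) (hM : 1 ≤ M) (Δ : ℝ) (N : ℕ)
    (a : ℕ → ℕ → ℝ) (l : ℕ) :
    modeForm p ic Δ N l (spatialForm p M a l) = ∑ m ∈ Finset.Ico 1 M,
      if l ∈ modeSet M m then modeForm p ic Δ N l (spatialForm p M a m) else 0 := by
  rcases modeSet_cases hM l with ⟨h0, h1⟩ | ⟨m, hm, hl, huniq⟩
  · rw [Finset.sum_eq_zero fun m hm ↦ if_neg (h1 m hm)]
    -- Written as a multiple so that the scaling rule `modeForm_const_mul` makes the variance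
    -- vanish.
    have : spatialForm p M a l = fun i ↦ 0 * (0 : ℝ) := by
      funext i
      rw [zero_mul]
      exact Finset.sum_eq_zero fun k _ ↦ by rw [eigenfunction_grid_of_mod_eq_zero p hM h0, mul_zero]
    rw [this, modeForm_const_mul]; simp
  · rw [Finset.sum_eq_single_of_mem m hm fun m' hm' hne ↦ if_neg fun h ↦ hne (huniq m' hm' h),
      if_pos hl]
    obtain ⟨ε, hε, h⟩ := eigenfunction_grid_of_mem p hm hl
    have : spatialForm p M a l = fun i ↦ ε * spatialForm p M a m i := by
      funext i
      rw [spatialForm, spatialForm, Finset.mul_sum]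
      exact Finset.sum_congr rfl fun k _ ↦ by rw [h]; ring
    rw [this, modeForm_const_mul, hε, one_mul]

-- A mode belongs to at most one of the sets, so the sum has at most one nonzero term and there are
-- no cross terms.
open Classical in
lemma sq_sum_modeSet (hM : 1 ≤ M) (l : ℕ) (f : ℕ → ℝ) :
    (∑ m ∈ Finset.Ico 1 M, if l ∈ modeSet M m then f m else 0) ^ 2 =
      ∑ m ∈ Finset.Ico 1 M, if l ∈ modeSet M m then f m ^ 2 else 0 := by
  rcases modeSet_cases hM l with ⟨h0, h1⟩ | ⟨m, hm, hl, huniq⟩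
  · rw [Finset.sum_eq_zero fun m hm ↦ if_neg (h1 m hm),
      Finset.sum_eq_zero fun m hm ↦ if_neg (h1 m hm)]
    simp
  · rw [Finset.sum_eq_single_of_mem m hm fun m' hm' hne ↦ if_neg fun h ↦ hne (huniq m' hm' h),
      Finset.sum_eq_single_of_mem m hm fun m' hm' hne ↦ if_neg fun h ↦ hne (huniq m' hm' h),
      if_pos hl, if_pos hl]

end Aliasing

/-! ### The characteristic function of the replacement output. -/

section ReplacementLaw

variable (p : Params) (ic : InitialCondition)

lemma innovation_arPath (Δ : ℝ) (l : ℕ) (z : ℕ → ℝ) (j : ℕ) :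
    innovation (modeDecay p Δ l) (arPath p ic Δ l z) j = innovationScale p ic Δ l j * z j := by
  rcases j with _ | j
  · cases ic <;> simp [innovation, arPath, innovationScale, initialCoefficient]
  · simp only [innovation, arPath, innovationScale, modeDecay]; ring

/-- The standard deviation of `R_m^L(i)`. -/
def replacementScale (M L m i : ℕ) : ℝ := replacementTerm p ic M L m i 1

lemma replacementTerm_eq (M L m i : ℕ) (z : ℝ) :
    replacementTerm p ic M L m i z = replacementScale p ic M L m i * z := by
  unfold replacementScale
  cases ic <;> rcases i with _ | i <;> simp [replacementTerm]

instance : IsProbabilityMeasure noiseLaw := by unfold noiseLaw; infer_instance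

lemma measurable_replacementOutput (T : ℝ) (N M L : ℕ) :
    Measurable fun w : (ℕ × ℕ) ⊕ (ℕ × ℕ) → ℝ ↦ replacementOutput p ic T N M L
      (fun l i ↦ w (Sum.inl (l, i))) (fun m i ↦ w (Sum.inr (m, i))) := by
  have har : ∀ (Δ : ℝ) (l i : ℕ), Measurable fun w : (ℕ × ℕ) ⊕ (ℕ × ℕ) → ℝ ↦
      arPath p ic Δ l (fun i ↦ w (Sum.inl (l, i))) i := by
    intro Δ l i
    induction i with
    | zero => cases ic <;> simp only [arPath, initialCoefficient] <;> fun_prop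
    | succ i ih => simp only [arPath]; fun_prop
  refine measurable_pi_lambda _ fun i ↦ measurable_pi_lambda _ fun k ↦ ?_
  unfold replacementOutput replacementCoefficient
  refine Finset.measurable_fun_sum _ fun m _ ↦ Measurable.mul_const (Measurable.add ?_ ?_) _
  · exact Finset.measurable_fun_sum _ fun l _ ↦ har _ l i
  · simp_rw [replacementTerm_eq]; fun_prop

open Classical in
/-- The characteristic function of the output of the replacement method. -/
lemma expI_replacementOutput (T : ℝ) (N L : ℕ) {M : ℕ} (hM : 1 ≤ M) (a : ℕ → ℕ → ℝ) :
    expI noiseLaw (fun w ↦ ∑ i ∈ Finset.range (N + 1), ∑ k ∈ Finset.range (M + 1), a i k *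
      ∑ m ∈ Finset.Ico 1 M, replacementCoefficient p ic T N M L (fun l i ↦ w (Sum.inl (l, i)))
        (fun m i ↦ w (Sum.inr (m, i))) m i * p.eigenfunction m (k / M)) =
    Complex.exp (((-(∑ l ∈ Finset.range (L * M), (∑ m ∈ Finset.Ico 1 M,
        if l ∈ modeSet M m then modeForm p ic (T / N) N l (spatialForm p M a m) else 0) +
      ∑ m ∈ Finset.Ico 1 M, ∑ i ∈ Finset.range (N + 1),
        spatialForm p M a m i ^ 2 * replacementScale p ic M L m i ^ 2) / 2 : ℝ)) : ℂ) := by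
  set ρ : ℕ → ℝ := modeDecay p (T / N) with hρ
  -- The coefficient of each standard normal variable in the linear form: innovations of the
  -- simulated modes on the left, replacement variables on the right.
  set κ : (ℕ × ℕ) ⊕ (ℕ × ℕ) → ℝ := Sum.elim
    (fun q ↦ ∑ m ∈ Finset.Ico 1 M, if q.1 ∈ modeSet M m then
      backSum (ρ q.1) N (spatialForm p M a m) q.2 * innovationScale p ic (T / N) q.1 q.2 else 0)
    (fun q ↦ spatialForm p M a q.1 q.2 * replacementScale p ic M L q.1 q.2) with hκ
  have hind : iIndepFun (fun (q : (ℕ × ℕ) ⊕ (ℕ × ℕ)) (w : (ℕ × ℕ) ⊕ (ℕ × ℕ) → ℝ) ↦ w q) noiseLaw :=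
    iIndepFun_infinitePi (X := fun _ x ↦ x) fun _ ↦ measurable_id
  have hlaw : ∀ q : (ℕ × ℕ) ⊕ (ℕ × ℕ), HasLaw (fun w : (ℕ × ℕ) ⊕ (ℕ × ℕ) → ℝ ↦ w q)
      (gaussianReal 0 1) noiseLaw := fun q ↦
    (measurePreserving_eval_infinitePi (fun _ ↦ gaussianReal 0 1) q).hasLaw
  have h := expI_sum_of_iIndepFun (v := fun _ ↦ 1) hind hlaw
    ((Finset.range (L * M) ×ˢ Finset.range (N + 1)).disjSum
      (Finset.Ico 1 M ×ˢ Finset.range (N + 1))) κ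
  have e1 : (fun w : (ℕ × ℕ) ⊕ (ℕ × ℕ) → ℝ ↦ ∑ i ∈ Finset.range (N + 1),
      ∑ k ∈ Finset.range (M + 1), a i k *
      ∑ m ∈ Finset.Ico 1 M, replacementCoefficient p ic T N M L (fun l i ↦ w (Sum.inl (l, i)))
        (fun m i ↦ w (Sum.inr (m, i))) m i * p.eigenfunction m (k / M)) =
      fun w ↦ ∑ q ∈ (Finset.range (L * M) ×ˢ Finset.range (N + 1)).disjSum
        (Finset.Ico 1 M ×ˢ Finset.range (N + 1)), κ q * w q := by
    funext w
    have hA : ∑ i ∈ Finset.range (N + 1), ∑ k ∈ Finset.range (M + 1), a i k *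
        ∑ m ∈ Finset.Ico 1 M, replacementCoefficient p ic T N M L (fun l i ↦ w (Sum.inl (l, i)))
          (fun m i ↦ w (Sum.inr (m, i))) m i * p.eigenfunction m (k / M) =
        ∑ m ∈ Finset.Ico 1 M, ∑ i ∈ Finset.range (N + 1), spatialForm p M a m i *
          replacementCoefficient p ic T N M L (fun l i ↦ w (Sum.inl (l, i)))
            (fun m i ↦ w (Sum.inr (m, i))) m i := by
      rw [Finset.sum_comm (s := Finset.Ico 1 M)]
      refine Finset.sum_congr rfl fun i _ ↦ ?_
      simp_rw [Finset.mul_sum, spatialForm, Finset.sum_mul]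
      rw [Finset.sum_comm]
      exact Finset.sum_congr rfl fun m _ ↦ Finset.sum_congr rfl fun k _ ↦ by ring
    rw [hA, Finset.sum_disjSum, Finset.sum_product, Finset.sum_product]
    simp only [replacementCoefficient, mul_add, Finset.sum_add_distrib, replacementTerm_eq]
    congr 1
    · have hB : ∀ m ∈ Finset.Ico 1 M, ∑ i ∈ Finset.range (N + 1), spatialForm p M a m i *
          ∑ l ∈ (Finset.range (L * M)).filter (fun l ↦ l ∈ modeSet M m),
            arPath p ic (T / N) l (fun i ↦ w (Sum.inl (l, i))) i =
          ∑ l ∈ Finset.range (L * M), if l ∈ modeSet M m then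
            ∑ j ∈ Finset.range (N + 1), backSum (ρ l) N (spatialForm p M a m) j *
              (innovationScale p ic (T / N) l j * w (Sum.inl (l, j))) else 0 := by
        intro m _
        simp_rw [Finset.mul_sum]
        rw [Finset.sum_comm, Finset.sum_filter]
        refine Finset.sum_congr rfl fun l _ ↦ ?_
        rw [sum_mul_eq_sum_backSum (ρ l)]
        simp_rw [hρ, innovation_arPath]
      rw [Finset.sum_congr rfl hB, Finset.sum_comm]
      refine Finset.sum_congr rfl fun l _ ↦ ?_
      simp only [hκ, Sum.elim_inl, Finset.sum_mul]
      rw [Finset.sum_comm]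
      refine Finset.sum_congr rfl fun m _ ↦ ?_
      split_ifs
      · exact Finset.sum_congr rfl fun j _ ↦ by ring
      · simp
    · refine Finset.sum_congr rfl fun m _ ↦ Finset.sum_congr rfl fun i _ ↦ ?_
      simp only [hκ, Sum.elim_inr]; ring
  have e2 : ∑ q ∈ (Finset.range (L * M) ×ˢ Finset.range (N + 1)).disjSum
        (Finset.Ico 1 M ×ˢ Finset.range (N + 1)), κ q ^ 2 * ((1 : ℝ≥0) : ℝ) =
      ∑ l ∈ Finset.range (L * M), (∑ m ∈ Finset.Ico 1 M,
        if l ∈ modeSet M m then modeForm p ic (T / N) N l (spatialForm p M a m) else 0) +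
      ∑ m ∈ Finset.Ico 1 M, ∑ i ∈ Finset.range (N + 1),
        spatialForm p M a m i ^ 2 * replacementScale p ic M L m i ^ 2 := by
    rw [Finset.sum_disjSum, Finset.sum_product, Finset.sum_product]
    congr 1
    · refine Finset.sum_congr rfl fun l _ ↦ ?_
      simp only [hκ, Sum.elim_inl, sq_sum_modeSet hM, NNReal.coe_one, mul_one]
      rw [Finset.sum_comm]
      refine Finset.sum_congr rfl fun m _ ↦ ?_
      split_ifs
      · exact Finset.sum_congr rfl fun j _ ↦ by rw [mul_pow, hρ]
      · simp
    · refine Finset.sum_congr rfl fun m _ ↦ Finset.sum_congr rfl fun i _ ↦ ?_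
      simp only [hκ, Sum.elim_inr, NNReal.coe_one, mul_one]; ring
  rw [e1, h, e2]

end ReplacementLaw

/-! ### Rapidly decaying modes are almost white in time. -/

section TailForm

variable {p : Params} (ic : InitialCondition)

/-- `0` if the process starts at zero and `i = 0`, and `1` otherwise. -/
def activity (ic : InitialCondition) (i : ℕ) : ℝ :=
  match ic, i with
  | .zero, 0 => 0
  | _, _ => 1

/-- An active time is followed by active times only. Hence the sums over $i\ge j$ arising from an
active `j` involve active times alone and are controlled by the reference form. -/
lemma activity_cases (i : ℕ) : (ic = .zero ∧ i = 0 ∧ activity ic i = 0) ∨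
    ((∀ j, i ≤ j → activity ic j = 1) ∧ (ic = .zero → i ≠ 0)) := by
  cases ic with
  | zero =>
    rcases i with _ | i
    · exact Or.inl ⟨rfl, rfl, rfl⟩
    · refine Or.inr ⟨fun j hj ↦ ?_, fun _ ↦ Nat.succ_ne_zero i⟩
      rcases j with _ | j
      · omega
      · rfl
  | stationary => exact Or.inr ⟨fun j _ ↦ rfl, fun h ↦ by cases h⟩

lemma activity_nonneg (i : ℕ) : 0 ≤ activity ic i := by
  rcases activity_cases ic i with ⟨_, _, h⟩ | ⟨h, _⟩
  · exact h.ge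
  · rw [h i le_rfl]; exact zero_le_one

lemma activity_sq (i : ℕ) : activity ic i ^ 2 = activity ic i := by
  rcases activity_cases ic i with ⟨_, _, h⟩ | ⟨h, _⟩
  · rw [h]; norm_num
  · rw [h i le_rfl]; norm_num

/-- The term $i=j$ is exactly $b_j$, and every later term carries at least one factor $\rho$. -/
lemma abs_backSum_sub_le {ρ : ℝ} (h0 : 0 ≤ ρ) (h1 : ρ ≤ 1) {N : ℕ} (b : ℕ → ℝ) {j : ℕ}
    (hj : j ∈ Finset.range (N + 1)) :
    |backSum ρ N b j - b j| ≤ ρ * ∑ i ∈ Finset.range (N + 1), if j ≤ i then |b i| else 0 := by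
  have e : b j = ∑ i ∈ Finset.range (N + 1), if i = j then b i else 0 := by
    rw [Finset.sum_ite_eq' , if_pos hj]
  conv_lhs => rw [backSum, e, ← Finset.sum_sub_distrib]
  rw [Finset.mul_sum]
  refine (Finset.abs_sum_le_sum_abs _ _).trans (Finset.sum_le_sum fun i _ ↦ ?_)
  rcases lt_trichotomy i j with h | h | h
  · rw [if_neg (by omega), if_neg (by omega), if_neg (by omega)]; simp
  · subst h; simp; positivity
  · rw [if_pos h.le, if_neg (by omega), if_pos h.le, sub_zero, abs_mul,
      abs_of_nonneg (pow_nonneg h0 _), mul_comm]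
    refine mul_le_mul_of_nonneg_right ?_ (abs_nonneg _)
    exact pow_le_of_le_one h0 h1 (by omega)

/-- If its autocorrelation is small, a coefficient process is nearly a sequence of independent
variables. -/
lemma abs_modeForm_sub_le {Δ : ℝ} (hΔ : 0 ≤ Δ) (N : ℕ) {l : ℕ} (hl : 1 ≤ l) (b : ℕ → ℝ) :
    |modeForm p ic Δ N l b -
        modeVariance p l * ∑ i ∈ Finset.range (N + 1), activity ic i * b i ^ 2| ≤
      4 * (N + 1) ^ 2 * modeDecay p Δ l *
        (modeVariance p l * ∑ i ∈ Finset.range (N + 1), activity ic i * b i ^ 2) := by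
  set ρ := modeDecay p Δ l with hρ
  set v := modeVariance p l with hv
  set S := ∑ i ∈ Finset.range (N + 1), activity ic i * b i ^ 2 with hS
  set B := ∑ i ∈ Finset.range (N + 1), activity ic i * |b i| with hB
  have h0 : 0 ≤ ρ := modeDecay_nonneg _ _
  have h1 : ρ ≤ 1 := modeDecay_le_one hΔ hl
  have hv0 : 0 ≤ v := (modeVariance_pos hl).le
  have hB0 : 0 ≤ B := Finset.sum_nonneg fun i _ ↦ mul_nonneg (activity_nonneg ic i) (abs_nonneg _)
  have hS0 : 0 ≤ S := Finset.sum_nonneg fun i _ ↦ mul_nonneg (activity_nonneg ic i) (sq_nonneg _)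
  have hBS : B ^ 2 ≤ (N + 1) * S := by
    have := sq_sum_le_card_mul_sum_sq (s := Finset.range (N + 1)) (f := fun i ↦ activity ic i * |b i|)
    simp only [mul_pow, sq_abs, activity_sq, Finset.card_range] at this
    exact_mod_cast this
  have hterm : ∀ j ∈ Finset.range (N + 1),
      |backSum ρ N b j ^ 2 * innovationScale p ic Δ l j ^ 2 - v * (activity ic j * b j ^ 2)| ≤
      2 * ρ * v * B ^ 2 + ρ * v * (activity ic j * b j ^ 2) := by
    intro j hj
    -- For the zero start at time zero, both the innovation scale and the reference form vanish.
    rcases activity_cases ic j with ⟨hz, hj0, ha⟩ | ⟨ha, hne⟩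
    · subst hz; subst hj0
      rw [ha, innovationScale_zero_zero]
      simp; positivity
    · have hBj : (∑ i ∈ Finset.range (N + 1), if j ≤ i then |b i| else 0) ≤ B := by
        refine Finset.sum_le_sum fun i _ ↦ ?_
        split_ifs with h
        · rw [ha i h, one_mul]
        · exact mul_nonneg (activity_nonneg ic i) (abs_nonneg _)
      have hc : |backSum ρ N b j| ≤ B := (abs_backSum_le h0 h1 N b j).trans hBj
      have hd : |backSum ρ N b j - b j| ≤ ρ * B :=
        (abs_backSum_sub_le h0 h1 b hj).trans (mul_le_mul_of_nonneg_left hBj h0)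
      have hb : |b j| ≤ B := by
        have := Finset.single_le_sum (f := fun i ↦ activity ic i * |b i|)
          (fun i _ ↦ mul_nonneg (activity_nonneg ic i) (abs_nonneg _)) hj
        simpa [ha j le_rfl] using this
      have hτ0 := sq_nonneg (innovationScale p ic Δ l j)
      have hτ1 : innovationScale p ic Δ l j ^ 2 ≤ v := innovationScale_sq_le ic hΔ hl j
      -- The deficit is $\rho^2v$ after time zero and $0$ for a stationary start; $\rho^2\le\rho$
      -- puts it on the scale of the other error.
      have hτ2 : v - innovationScale p ic Δ l j ^ 2 ≤ ρ * v := by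
        have hρ2 : ρ ^ 2 * v ≤ ρ * v := mul_le_mul_of_nonneg_right (by nlinarith) hv0
        rcases j with _ | j
        · cases ic with
          | zero => exact absurd rfl (hne rfl)
          | stationary =>
            rw [innovationScale_zero_sq_stationary Δ hl, sub_self]; positivity
        · rw [innovationScale_succ_sq ic hΔ hl]
          linarith
      rw [ha j le_rfl, one_mul]
      have hsq : |backSum ρ N b j ^ 2 - b j ^ 2| ≤ 2 * ρ * B ^ 2 := by
        have e : backSum ρ N b j ^ 2 - b j ^ 2 =
            (backSum ρ N b j - b j) * (backSum ρ N b j + b j) := by ring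
        rw [e, abs_mul]
        calc _ ≤ (ρ * B) * (B + B) := mul_le_mul hd ((abs_add_le _ _).trans (add_le_add hc hb))
              (abs_nonneg _) (by positivity)
          _ = _ := by ring
      have e : backSum ρ N b j ^ 2 * innovationScale p ic Δ l j ^ 2 - v * b j ^ 2 =
          (backSum ρ N b j ^ 2 - b j ^ 2) * innovationScale p ic Δ l j ^ 2 -
            (v - innovationScale p ic Δ l j ^ 2) * b j ^ 2 := by ring
      rw [e]
      refine (abs_sub _ _).trans (add_le_add ?_ ?_)
      · rw [abs_mul, abs_of_nonneg hτ0]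
        calc _ ≤ (2 * ρ * B ^ 2) * v := mul_le_mul hsq hτ1 hτ0 (by positivity)
          _ = _ := by ring
      · rw [abs_mul, abs_of_nonneg (by linarith), abs_of_nonneg (sq_nonneg _)]
        exact mul_le_mul_of_nonneg_right hτ2 (sq_nonneg _)
  have hN : (1 : ℝ) ≤ (N + 1 : ℝ) ^ 2 := by
    have : (0 : ℝ) ≤ N := Nat.cast_nonneg N
    nlinarith
  calc |modeForm p ic Δ N l b - v * S| = |∑ j ∈ Finset.range (N + 1),
        (backSum ρ N b j ^ 2 * innovationScale p ic Δ l j ^ 2 - v * (activity ic j * b j ^ 2))| := by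
        rw [Finset.sum_sub_distrib, ← Finset.mul_sum]; rfl
    _ ≤ ∑ j ∈ Finset.range (N + 1), (2 * ρ * v * B ^ 2 + ρ * v * (activity ic j * b j ^ 2)) :=
        (Finset.abs_sum_le_sum_abs _ _).trans (Finset.sum_le_sum hterm)
    _ = (N + 1) * (2 * ρ * v * B ^ 2) + ρ * v * S := by
        rw [Finset.sum_add_distrib, Finset.sum_const, Finset.card_range, nsmul_eq_mul, hS,
          Finset.mul_sum]; push_cast; rfl
    -- Cauchy–Schwarz $B^2\le(N+1)S$ in the first term; the total factor is $3(N+1)^2$, rounded up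
    -- to $4(N+1)^2$.
    _ ≤ (N + 1) * (2 * ρ * v * ((N + 1) * S)) + ρ * v * ((N + 1) ^ 2 * S) := by
        gcongr
        exact le_mul_of_one_le_left hS0 hN
    _ ≤ 4 * (N + 1) ^ 2 * ρ * (v * S) := by
        have : 0 ≤ (N + 1 : ℝ) ^ 2 * (ρ * (v * S)) := by positivity
        nlinarith

end TailForm

/-! ### Covariance matrices of the aliased coefficients. -/

section CovarianceMatrix

open Matrix

variable (p : Params) (ic : InitialCondition)

/-- The covariance of the values at the times `i Δ` and `j Δ` of the `l`-th coefficient process. -/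
def modeCovariance (Δ : ℝ) (N l i i' : ℕ) : ℝ :=
  ∑ j ∈ Finset.range (N + 1), (if j ≤ i then modeDecay p Δ l ^ (i - j) else 0) *
    (if j ≤ i' then modeDecay p Δ l ^ (i' - j) else 0) * innovationScale p ic Δ l j ^ 2

lemma modeCovariance_comm (Δ : ℝ) (N l i i' : ℕ) :
    modeCovariance p ic Δ N l i i' = modeCovariance p ic Δ N l i' i :=
  Finset.sum_congr rfl fun j _ ↦ by ring

lemma modeForm_eq_sum_modeCovariance (Δ : ℝ) (N l : ℕ) (b : ℕ → ℝ) :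
    modeForm p ic Δ N l b = ∑ i ∈ Finset.range (N + 1), ∑ i' ∈ Finset.range (N + 1),
      b i * modeCovariance p ic Δ N l i i' * b i' := by
  have h : ∀ j ∈ Finset.range (N + 1),
      backSum (modeDecay p Δ l) N b j ^ 2 * innovationScale p ic Δ l j ^ 2 =
      ∑ i ∈ Finset.range (N + 1), ∑ i' ∈ Finset.range (N + 1), b i *
        ((if j ≤ i then modeDecay p Δ l ^ (i - j) else 0) *
        (if j ≤ i' then modeDecay p Δ l ^ (i' - j) else 0) * innovationScale p ic Δ l j ^ 2) * b i' := by
    intro j _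
    rw [backSum, sq (Finset.sum _ _), Finset.sum_mul_sum, Finset.sum_mul]
    refine Finset.sum_congr rfl fun i _ ↦ ?_
    rw [Finset.sum_mul]
    refine Finset.sum_congr rfl fun i' _ ↦ ?_
    split_ifs <;> ring
  rw [modeForm, Finset.sum_congr rfl h, Finset.sum_comm]
  refine Finset.sum_congr rfl fun i _ ↦ ?_
  rw [Finset.sum_comm]
  refine Finset.sum_congr rfl fun i' _ ↦ ?_
  rw [modeCovariance, Finset.mul_sum, Finset.sum_mul]

variable {p}

lemma abs_modeCovariance_le {Δ : ℝ} (hΔ : 0 ≤ Δ) (N : ℕ) {l : ℕ} (hl : 1 ≤ l) (i i' : ℕ) :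
    |modeCovariance p ic Δ N l i i'| ≤ (N + 1) * modeVariance p l := by
  have hg : ∀ i j : ℕ, |if j ≤ i then modeDecay p Δ l ^ (i - j) else 0| ≤ 1 := by
    intro i j
    split_ifs
    · rw [abs_of_nonneg (pow_nonneg (modeDecay_nonneg _ _) _)]
      exact pow_le_one₀ (modeDecay_nonneg _ _) (modeDecay_le_one hΔ hl)
    · simp
  refine (Finset.abs_sum_le_sum_abs _ _).trans ((Finset.sum_le_sum fun j _ ↦
    (?_ : _ ≤ modeVariance p l)).trans_eq (by simp))
  rw [abs_mul, abs_mul, abs_of_nonneg (sq_nonneg (innovationScale p ic Δ l j))]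
  calc _ ≤ 1 * 1 * modeVariance p l := by
        refine mul_le_mul (mul_le_mul (hg i j) (hg i' j) (abs_nonneg _) zero_le_one)
          (innovationScale_sq_le ic hΔ hl j) (sq_nonneg _) (by norm_num)
    _ = _ := by ring

lemma summable_ite_of_le_modeVariance (q : ℕ → Prop) [DecidablePred q] {f : ℕ → ℝ} {C : ℝ}
    (hC : 0 ≤ C) (hf : ∀ l, |f l| ≤ C * modeVariance p (l + 1)) :
    Summable fun l ↦ if q l then f l else 0 := by
  refine Summable.of_norm_bounded ((summable_modeVariance (p := p)).mul_left C) fun l ↦ ?_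
  split_ifs
  · exact hf l
  · simpa using mul_nonneg hC (modeVariance_pos (p := p) (Nat.succ_pos l)).le

variable (p)

/-- The indices `(m, i)` of the variables `U_m(t_i)`. -/
abbrev GridIndex (N M : ℕ) : Type := ↥(Finset.Ico 1 M ×ˢ Finset.range (N + 1))

open Classical in
/-- The covariance matrix of the sums of the coefficient processes over the modes in `I_m ∩ S`. -/
def covarianceMatrix (Δ : ℝ) (N M : ℕ) (S : Set ℕ) : Matrix (GridIndex N M) (GridIndex N M) ℝ :=
  fun x y ↦ if x.1.1 = y.1.1 then ∑' l : ℕ, if l + 1 ∈ modeSet M x.1.1 ∧ l + 1 ∈ S then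
    modeCovariance p ic Δ N (l + 1) x.1.2 y.1.2 else 0 else 0

lemma isHermitian_covarianceMatrix (Δ : ℝ) (N M : ℕ) (S : Set ℕ) :
    (covarianceMatrix p ic Δ N M S).IsHermitian := by
  ext x y
  simp only [conjTranspose_apply, star_trivial, covarianceMatrix]
  by_cases h : x.1.1 = y.1.1
  · rw [if_pos h, if_pos h.symm, h]
    congr 1; funext l
    rw [modeCovariance_comm]
  · rw [if_neg h, if_neg (Ne.symm h)]

-- The matrix is block diagonal in `m`, since different $I_m$ share no mode; summability of the mode
-- covariances allows exchanging the mode sum with the finite quadratic form.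
open Classical in
lemma quadratic_covarianceMatrix {Δ : ℝ} (hΔ : 0 ≤ Δ) (N M : ℕ) (S : Set ℕ) (β : ℕ → ℕ → ℝ) :
    (fun x : GridIndex N M ↦ β x.1.1 x.1.2) ⬝ᵥ covarianceMatrix p ic Δ N M S *ᵥ
        (fun x : GridIndex N M ↦ β x.1.1 x.1.2) =
      ∑ m ∈ Finset.Ico 1 M, ∑' l : ℕ, if l + 1 ∈ modeSet M m ∧ l + 1 ∈ S then
        modeForm p ic Δ N (l + 1) (β m) else 0 := by
  set k : ℕ → ℕ → ℕ → ℝ := fun m i i' ↦ ∑' l : ℕ, if l + 1 ∈ modeSet M m ∧ l + 1 ∈ S then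
    modeCovariance p ic Δ N (l + 1) i i' else 0 with hk
  have e1 : (fun x : GridIndex N M ↦ β x.1.1 x.1.2) ⬝ᵥ covarianceMatrix p ic Δ N M S *ᵥ
        (fun x : GridIndex N M ↦ β x.1.1 x.1.2) =
      ∑ q ∈ Finset.Ico 1 M ×ˢ Finset.range (N + 1), β q.1 q.2 *
        ∑ r ∈ Finset.Ico 1 M ×ˢ Finset.range (N + 1),
          (if q.1 = r.1 then k q.1 q.2 r.2 else 0) * β r.1 r.2 := by
    simp only [dotProduct, mulVec]
    rw [← Finset.sum_coe_sort (Finset.Ico 1 M ×ˢ Finset.range (N + 1))]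
    refine Finset.sum_congr rfl fun x _ ↦ ?_
    rw [← Finset.sum_coe_sort (Finset.Ico 1 M ×ˢ Finset.range (N + 1))]
    rfl
  rw [e1, Finset.sum_product]
  refine Finset.sum_congr rfl fun m hm ↦ ?_
  have e2 : ∀ i ∈ Finset.range (N + 1), β m i *
        ∑ r ∈ Finset.Ico 1 M ×ˢ Finset.range (N + 1),
          (if m = r.1 then k m i r.2 else 0) * β r.1 r.2 =
      ∑ i' ∈ Finset.range (N + 1), β m i * k m i i' * β m i' := by
    intro i _
    rw [Finset.sum_product, Finset.sum_eq_single_of_mem m hm, Finset.mul_sum]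
    · exact Finset.sum_congr rfl fun i' _ ↦ by rw [if_pos rfl]; ring
    · intro m' _ hne
      exact Finset.sum_eq_zero fun i' _ ↦ by rw [if_neg (Ne.symm hne), zero_mul]
  simp only
  rw [Finset.sum_congr rfl e2]
  have hsum : ∀ i i', Summable fun l : ℕ ↦ if l + 1 ∈ modeSet M m ∧ l + 1 ∈ S then
      modeCovariance p ic Δ N (l + 1) i i' else 0 := fun i i' ↦
    summable_ite_of_le_modeVariance (p := p) _ (by positivity)
      fun l ↦ abs_modeCovariance_le ic hΔ N (Nat.le_add_left 1 l) i i'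
  have e3 : ∀ l : ℕ, (if l + 1 ∈ modeSet M m ∧ l + 1 ∈ S then
      modeForm p ic Δ N (l + 1) (β m) else 0) =
      ∑ i ∈ Finset.range (N + 1), ∑ i' ∈ Finset.range (N + 1), β m i *
        (if l + 1 ∈ modeSet M m ∧ l + 1 ∈ S then modeCovariance p ic Δ N (l + 1) i i' else 0) *
          β m i' := by
    intro l
    split_ifs
    · exact modeForm_eq_sum_modeCovariance p ic Δ N (l + 1) (β m)
    · simp
  simp_rw [e3]
  rw [Summable.tsum_finsetSum fun i _ ↦ summable_sum fun i' _ ↦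
    ((hsum i i').mul_left _).mul_right _]
  refine Finset.sum_congr rfl fun i _ ↦ ?_
  rw [Summable.tsum_finsetSum fun i' _ ↦ ((hsum i i').mul_left _).mul_right _]
  refine Finset.sum_congr rfl fun i' _ ↦ ?_
  rw [tsum_mul_right, tsum_mul_left]

/-- Every vector on the grid comes from a double sequence. -/
lemma exists_eq_double_seq {N M : ℕ} (b : GridIndex N M → ℝ) :
    ∃ β : ℕ → ℕ → ℝ, b = fun x ↦ β x.1.1 x.1.2 := by
  classical
  refine ⟨fun m i ↦ if h : (m, i) ∈ Finset.Ico 1 M ×ˢ Finset.range (N + 1) then b ⟨(m, i), h⟩ else 0,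
    funext fun x ↦ ?_⟩
  simp only [Prod.mk.eta, x.2, dif_pos]

lemma posSemidef_covarianceMatrix {Δ : ℝ} (hΔ : 0 ≤ Δ) (N M : ℕ) (S : Set ℕ) :
    (covarianceMatrix p ic Δ N M S).PosSemidef := by
  classical
  refine PosSemidef.of_dotProduct_mulVec_nonneg (isHermitian_covarianceMatrix p ic Δ N M S) fun b ↦ ?_
  obtain ⟨β, rfl⟩ := exists_eq_double_seq b
  rw [star_trivial, quadratic_covarianceMatrix p ic hΔ]
  refine Finset.sum_nonneg fun m _ ↦ tsum_nonneg fun l ↦ ?_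
  split_ifs
  · exact modeForm_nonneg ic Δ N _ _
  · exact le_rfl

end CovarianceMatrix

/-! ### The tail covariance and the replacement variances. -/

section TailVariance

variable (p : Params) (ic : InitialCondition)

lemma zero_notMem_modeSet {M m : ℕ} (hm : m ∈ Finset.Ico 1 M) : 0 ∉ modeSet M m := by
  have := Finset.mem_Ico.1 hm
  rw [mem_modeSet_iff hm, Nat.zero_mod]
  omega

-- The mode zero lies in no $I_m$ with $1\le m<M$, so the series can start at $\ell=1$, where the
-- eigenvalues are known to be positive.
open Classical in
lemma replacementVariance_eq {M m : ℕ} (hm : m ∈ Finset.Ico 1 M) (L : ℕ) :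
    replacementVariance p M L m =
      ∑' l : ℕ, if l + 1 ∈ modeSet M m ∧ L * M ≤ l + 1 then modeVariance p (l + 1) else 0 := by
  have hs : Summable fun l : ℕ ↦ if l ∈ modeSet M m ∧ L * M ≤ l then modeVariance p l else 0 :=
    (summable_nat_add_iff 1).1 (summable_ite_of_le_modeVariance (p := p) _ zero_le_one
      fun l ↦ by rw [abs_of_pos (modeVariance_pos (Nat.succ_pos l)), one_mul])
  have h := hs.tsum_eq_zero_add
  rw [if_neg fun h ↦ zero_notMem_modeSet hm h.1, zero_add] at h
  exact h

lemma replacementVariance_nonneg {M m : ℕ} (hm : m ∈ Finset.Ico 1 M) (L : ℕ) :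
    0 ≤ replacementVariance p M L m := by
  classical
  rw [replacementVariance_eq p hm]
  refine tsum_nonneg fun l ↦ ?_
  split_ifs
  · exact (modeVariance_pos (Nat.succ_pos l)).le
  · exact le_rfl

lemma replacementScale_sq {M m : ℕ} (hm : m ∈ Finset.Ico 1 M) (L i : ℕ) :
    replacementScale p ic M L m i ^ 2 = activity ic i * replacementVariance p M L m := by
  have h := Real.sq_sqrt (replacementVariance_nonneg p hm L)
  unfold replacementScale
  cases ic <;> rcases i with _ | i <;> simp [replacementTerm, activity, h]

variable {p}

lemma modeDecay_anti {Δ : ℝ} (hΔ : 0 ≤ Δ) {k l : ℕ} (h : k ≤ l) :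
    modeDecay p Δ l ≤ modeDecay p Δ k :=
  Real.exp_le_exp.2 (neg_le_neg (mul_le_mul_of_nonneg_right (p.eigenvalue_mono h) hΔ))

variable (p)

-- Frees the formula from a particular decidability instance and from the set notation.
open Matrix in
lemma quadratic_covarianceMatrix_of_iff {Δ : ℝ} (hΔ : 0 ≤ Δ) (N M : ℕ) (S : Set ℕ)
    (q : ℕ → ℕ → Prop) [∀ m, DecidablePred (q m)]
    (hq : ∀ m l, q m l ↔ l + 1 ∈ modeSet M m ∧ l + 1 ∈ S) (β : ℕ → ℕ → ℝ) :
    (fun x : GridIndex N M ↦ β x.1.1 x.1.2) ⬝ᵥ covarianceMatrix p ic Δ N M S *ᵥ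
        (fun x : GridIndex N M ↦ β x.1.1 x.1.2) =
      ∑ m ∈ Finset.Ico 1 M, ∑' l : ℕ, if q m l then modeForm p ic Δ N (l + 1) (β m) else 0 :=
  by classical exact (quadratic_covarianceMatrix p ic hΔ N M S β).trans (Finset.sum_congr rfl fun m _ ↦
    tsum_congr fun l ↦ if_congr (hq m l).symm rfl rfl)

open Matrix in
/-- The contribution of the high modes is relatively close to that of independent variables. -/
lemma abs_quadratic_tail_sub_le {Δ : ℝ} (hΔ : 0 ≤ Δ) (N M L : ℕ) (b : GridIndex N M → ℝ) :
    |b ⬝ᵥ covarianceMatrix p ic Δ N M {l | L * M ≤ l} *ᵥ b -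
        ∑ x : GridIndex N M, replacementScale p ic M L x.1.1 x.1.2 ^ 2 * b x ^ 2| ≤
      4 * (N + 1) ^ 2 * modeDecay p Δ (L * M) *
        ∑ x : GridIndex N M, replacementScale p ic M L x.1.1 x.1.2 ^ 2 * b x ^ 2 := by
  classical
  obtain ⟨β, rfl⟩ := exists_eq_double_seq b
  rw [quadratic_covarianceMatrix_of_iff p ic hΔ N M {l | L * M ≤ l}
    (fun m l ↦ l + 1 ∈ modeSet M m ∧ L * M ≤ l + 1) fun m l ↦ Iff.rfl]
  set θ : ℝ := 4 * (N + 1) ^ 2 * modeDecay p Δ (L * M) with hθ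
  set S : ℕ → ℝ := fun m ↦ ∑ i ∈ Finset.range (N + 1), activity ic i * β m i ^ 2 with hS
  have hS0 : ∀ m, 0 ≤ S m := fun m ↦
    Finset.sum_nonneg fun i _ ↦ mul_nonneg (activity_nonneg ic i) (sq_nonneg _)
  have e1 : ∑ x : GridIndex N M, replacementScale p ic M L x.1.1 x.1.2 ^ 2 * β x.1.1 x.1.2 ^ 2 =
      ∑ m ∈ Finset.Ico 1 M, replacementVariance p M L m * S m := by
    rw [Finset.sum_coe_sort (Finset.Ico 1 M ×ˢ Finset.range (N + 1))
      (fun q ↦ replacementScale p ic M L q.1 q.2 ^ 2 * β q.1 q.2 ^ 2), Finset.sum_product]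
    refine Finset.sum_congr rfl fun m hm ↦ ?_
    rw [hS, Finset.mul_sum]
    exact Finset.sum_congr rfl fun i _ ↦ by rw [replacementScale_sq p ic hm]; ring
  rw [e1, ← Finset.sum_sub_distrib, Finset.mul_sum]
  refine (Finset.abs_sum_le_sum_abs _ _).trans (Finset.sum_le_sum fun m hm ↦ ?_)
  rw [replacementVariance_eq p hm, ← tsum_mul_right]
  set q : ℕ → Prop := fun l ↦ l + 1 ∈ modeSet M m ∧ L * M ≤ l + 1 with hq
  have hb : ∀ l, |modeForm p ic Δ N (l + 1) (β m)| ≤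
      (N + 1) * (∑ i ∈ Finset.range (N + 1), |β m i|) ^ 2 * modeVariance p (l + 1) := fun l ↦ by
    rw [abs_of_nonneg (modeForm_nonneg ic Δ N _ _)]
    exact modeForm_le ic hΔ N (Nat.succ_pos l) (β m)
  have hs1 : Summable fun l : ℕ ↦ if q l then modeForm p ic Δ N (l + 1) (β m) else 0 :=
    summable_ite_of_le_modeVariance (p := p) _ (by positivity) hb
  have hs2 : Summable fun l : ℕ ↦ (if q l then modeVariance p (l + 1) else 0) * S m :=
    (summable_ite_of_le_modeVariance (p := p) _ zero_le_one fun l ↦ by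
      rw [abs_of_pos (modeVariance_pos (Nat.succ_pos l)), one_mul]).mul_right _
  -- The relative error holds mode by mode with one constant: among the modes $\ell\ge LM$ the AR
  -- coefficient is largest at $LM$. Relative bounds for nonnegative terms add up.
  have hterm : ∀ l : ℕ, ‖(if q l then modeForm p ic Δ N (l + 1) (β m) else 0) -
      (if q l then modeVariance p (l + 1) else 0) * S m‖ ≤
      θ * ((if q l then modeVariance p (l + 1) else 0) * S m) := by
    intro l
    rw [Real.norm_eq_abs]
    split_ifs with h
    · refine (abs_modeForm_sub_le ic hΔ N (Nat.succ_pos l) (β m)).trans ?_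
      refine mul_le_mul_of_nonneg_right ?_
        (mul_nonneg (modeVariance_pos (Nat.succ_pos l)).le (hS0 m))
      exact mul_le_mul_of_nonneg_left (modeDecay_anti hΔ h.2) (by positivity)
    · simp
  change |(∑' l : ℕ, if q l then modeForm p ic Δ N (l + 1) (β m) else 0) -
    ∑' l : ℕ, (if q l then modeVariance p (l + 1) else 0) * S m| ≤
    θ * ∑' l : ℕ, (if q l then modeVariance p (l + 1) else 0) * S m
  rw [← hs1.tsum_sub hs2, ← tsum_mul_left]
  exact tsum_of_norm_bounded (hs2.mul_left θ).hasSum hterm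

end TailVariance

/-! ### Splitting into simulated and replaced modes. -/

section Splitting

open Matrix

variable (p : Params) (ic : InitialCondition)

open Classical in
lemma quadratic_low_modes {Δ : ℝ} (hΔ : 0 ≤ Δ) (N M L : ℕ) (β : ℕ → ℕ → ℝ) :
    (fun x : GridIndex N M ↦ β x.1.1 x.1.2) ⬝ᵥ covarianceMatrix p ic Δ N M {l | l < L * M} *ᵥ
        (fun x : GridIndex N M ↦ β x.1.1 x.1.2) =
      ∑ l ∈ Finset.range (L * M), ∑ m ∈ Finset.Ico 1 M,
        if l ∈ modeSet M m then modeForm p ic Δ N l (β m) else 0 := by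
  rw [quadratic_covarianceMatrix_of_iff p ic hΔ N M {l | l < L * M}
    (fun m l ↦ l + 1 ∈ modeSet M m ∧ l + 1 < L * M) fun m l ↦ Iff.rfl, Finset.sum_comm]
  refine Finset.sum_congr rfl fun m hm ↦ ?_
  set f : ℕ → ℝ := fun l ↦ if l ∈ modeSet M m ∧ l < L * M then modeForm p ic Δ N l (β m) else 0
    with hf
  have h0 : f 0 = 0 := if_neg fun h ↦ zero_notMem_modeSet hm h.1
  have hz : ∀ l ∉ Finset.range (L * M), f l = 0 := fun l hl ↦
    if_neg fun h ↦ hl (Finset.mem_range.2 h.2)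
  have h := (summable_of_ne_finset_zero hz).tsum_eq_zero_add
  rw [h0, zero_add, tsum_eq_sum hz] at h
  refine h.symm.trans (Finset.sum_congr rfl fun l hl ↦ ?_)
  simp only [hf, Finset.mem_range.1 hl, and_true]

/-- After aliasing, every mode counts either as replaced or as simulated. This writes the
observation variance as tail plus low-mode form, the latter being shared with the replacement
output. -/
lemma tsum_modeForm_spatialForm {Δ : ℝ} (hΔ : 0 ≤ Δ) (N : ℕ) {M : ℕ} (hM : 1 ≤ M) (L : ℕ)
    (a : ℕ → ℕ → ℝ) :
    ∑' l : ℕ, modeForm p ic Δ N (l + 1) (spatialForm p M a (l + 1)) =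
      (fun x : GridIndex N M ↦ spatialForm p M a x.1.1 x.1.2) ⬝ᵥ
        (covarianceMatrix p ic Δ N M {l | L * M ≤ l} +
          covarianceMatrix p ic Δ N M {l | l < L * M}) *ᵥ
        (fun x : GridIndex N M ↦ spatialForm p M a x.1.1 x.1.2) := by
  classical
  rw [add_mulVec, dotProduct_add, quadratic_covarianceMatrix_of_iff p ic hΔ N M {l | L * M ≤ l}
    (fun m l ↦ l + 1 ∈ modeSet M m ∧ L * M ≤ l + 1) fun m l ↦ Iff.rfl,
    quadratic_covarianceMatrix_of_iff p ic hΔ N M {l | l < L * M}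
    (fun m l ↦ l + 1 ∈ modeSet M m ∧ l + 1 < L * M) fun m l ↦ Iff.rfl, ← Finset.sum_add_distrib]
  have hb : ∀ m l, |modeForm p ic Δ N (l + 1) (spatialForm p M a m)| ≤
      (N + 1) * (∑ i ∈ Finset.range (N + 1), |spatialForm p M a m i|) ^ 2 *
        modeVariance p (l + 1) := fun m l ↦ by
    rw [abs_of_nonneg (modeForm_nonneg ic Δ N _ _)]
    exact modeForm_le ic hΔ N (Nat.succ_pos l) _
  have hs : ∀ (q : ℕ → Prop) [DecidablePred q] (m : ℕ), Summable fun l : ℕ ↦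
      if q l then modeForm p ic Δ N (l + 1) (spatialForm p M a m) else 0 := fun q _ m ↦
    summable_ite_of_le_modeVariance (p := p) _ (by positivity) (hb m)
  simp_rw [modeForm_spatialForm p ic hM]
  rw [Summable.tsum_finsetSum fun m _ ↦ hs _ m]
  refine Finset.sum_congr rfl fun m _ ↦ ?_
  rw [← Summable.tsum_add (hs (fun l ↦ l + 1 ∈ modeSet M m ∧ L * M ≤ l + 1) m)
    (hs (fun l ↦ l + 1 ∈ modeSet M m ∧ l + 1 < L * M) m)]
  refine tsum_congr fun l ↦ ?_
  by_cases h1 : l + 1 ∈ modeSet M m <;> by_cases h2 : l + 1 < L * M <;>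
    simp [h1, h2, not_le.2, not_lt.1]

end Splitting

/-! ### Gaussian fields on the grid. -/

section GaussianField

open Matrix

variable (p : Params)

/-- The values on the grid of the field with the coefficients `u`. -/
def gridField {N M : ℕ} (u : EuclideanSpace ℝ (GridIndex N M)) : Fin (N + 1) → Fin (M + 1) → ℝ :=
  fun i k ↦ ∑ m ∈ Finset.Ico 1 M,
    (if h : (m, (i : ℕ)) ∈ Finset.Ico 1 M ×ˢ Finset.range (N + 1) then u ⟨_, h⟩ else 0) *
      p.eigenfunction m ((k : ℕ) / M)

lemma measurable_gridField (N M : ℕ) : Measurable (gridField p (N := N) (M := M)) := by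
  refine measurable_pi_lambda _ fun i ↦ measurable_pi_lambda _ fun k ↦ ?_
  unfold gridField
  refine Finset.measurable_fun_sum _ fun m _ ↦ Measurable.mul_const ?_ _
  split_ifs <;> fun_prop

/-- `spatialForm` is the adjoint of `gridField`: a linear form in the field is a linear form in its
coefficients. -/
lemma sum_gridField {N M : ℕ} (a : ℕ → ℕ → ℝ) (u : EuclideanSpace ℝ (GridIndex N M)) :
    ∑ i : Fin (N + 1), ∑ k : Fin (M + 1), a i k * gridField p u i k =
      ∑ x : GridIndex N M, u x * spatialForm p M a x.1.1 x.1.2 := by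
  obtain ⟨U, hU⟩ := exists_eq_double_seq (fun x : GridIndex N M ↦ u x)
  have hU' : ∀ x : GridIndex N M, u x = U x.1.1 x.1.2 := fun x ↦ congrFun hU x
  have e : ∀ (i : Fin (N + 1)) (k : Fin (M + 1)), gridField p u i k =
      ∑ m ∈ Finset.Ico 1 M, U m i * p.eigenfunction m ((k : ℕ) / M) := by
    intro i k
    refine Finset.sum_congr rfl fun m hm ↦ ?_
    rw [dif_pos (Finset.mem_product.2 ⟨hm, Finset.mem_range.2 i.2⟩), hU']
  simp_rw [e, hU']
  rw [Finset.sum_coe_sort (Finset.Ico 1 M ×ˢ Finset.range (N + 1))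
    (fun q ↦ U q.1 q.2 * spatialForm p M a q.1 q.2), Finset.sum_product_right,
    Finset.sum_range]
  refine Finset.sum_congr rfl fun i _ ↦ ?_
  simp only [spatialForm, Finset.mul_sum]
  rw [Finset.sum_comm]
  refine Finset.sum_congr rfl fun m _ ↦ ?_
  rw [Finset.sum_range]
  exact Finset.sum_congr rfl fun k _ ↦ by ring

lemma expI_gridField {N M : ℕ} {K : Matrix (GridIndex N M) (GridIndex N M) ℝ} (hK : K.PosSemidef)
    (a : ℕ → ℕ → ℝ) :
    expI (multivariateGaussian 0 K)
        (fun u ↦ ∑ i : Fin (N + 1), ∑ k : Fin (M + 1), a i k * gridField p u i k) =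
      Complex.exp (((-((fun x : GridIndex N M ↦ spatialForm p M a x.1.1 x.1.2) ⬝ᵥ K *ᵥ
        (fun x : GridIndex N M ↦ spatialForm p M a x.1.1 x.1.2)) / 2 : ℝ)) : ℂ) := by
  have h := charFun_multivariateGaussian (μ := 0) hK
    (WithLp.toLp 2 fun x : GridIndex N M ↦ spatialForm p M a x.1.1 x.1.2)
  rw [charFun_apply] at h
  simp_rw [sum_gridField, expI]
  convert h using 1
  · refine integral_congr_ae (ae_of_all _ fun u ↦ ?_)
    simp only [PiLp.inner_apply]
    congr 3
    simp [mul_comm]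
  · simp [neg_div]

/-- The law of a random matrix is determined by the laws of its linear forms. -/
lemma map_eq_map_of_expI {Ω Ω' : Type*} [MeasurableSpace Ω] [MeasurableSpace Ω'] {P : Measure Ω}
    {Q : Measure Ω'} [IsProbabilityMeasure P] [IsProbabilityMeasure Q] {n m : ℕ}
    {Y : Ω → Fin n → Fin m → ℝ} {Z : Ω' → Fin n → Fin m → ℝ} (hY : AEMeasurable Y P)
    (hZ : AEMeasurable Z Q)
    (h : ∀ a : ℕ → ℕ → ℝ, expI P (fun ω ↦ ∑ i : Fin n, ∑ k : Fin m, a i k * Y ω i k) =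
      expI Q (fun ω ↦ ∑ i : Fin n, ∑ k : Fin m, a i k * Z ω i k)) :
    P.map Y = Q.map Z := by
  have := Measure.isProbabilityMeasure_map hY
  have := Measure.isProbabilityMeasure_map hZ
  refine Measure.ext_of_charFunDual (funext fun F ↦ ?_)
  -- The coefficients of the functional are its values on the matrix units, extended by zero beyond
  -- the matrix size.
  have hF : ∃ a : ℕ → ℕ → ℝ, ∀ y, F y = ∑ i : Fin n, ∑ k : Fin m, a i k * y i k := by
    refine ⟨fun i k ↦ if h : i < n ∧ k < m then
      F (Pi.single ⟨i, h.1⟩ (Pi.single ⟨k, h.2⟩ 1)) else 0, fun y ↦ ?_⟩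
    conv_lhs => rw [← Finset.univ_sum_single y, map_sum]
    refine Finset.sum_congr rfl fun i _ ↦ ?_
    have := LinearMap.pi_apply_eq_sum_univ
      ((F : (Fin n → Fin m → ℝ) →ₗ[ℝ] ℝ) ∘ₗ LinearMap.single ℝ (fun _ ↦ Fin m → ℝ) i) (y i)
    simp only [LinearMap.comp_apply, LinearMap.single_apply] at this
    refine Eq.trans this (Finset.sum_congr rfl fun k _ ↦ ?_)
    change _ = (if h : (i : ℕ) < n ∧ (k : ℕ) < m then _ else 0) * _
    rw [dif_pos ⟨i.2, k.2⟩, smul_eq_mul, mul_comm]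
    congr 1
    change F _ = F _
    congr 2
    funext j
    rw [Pi.single_apply]
    exact if_congr eq_comm rfl rfl
  obtain ⟨a, ha⟩ := hF
  have hm : Measurable fun y : Fin n → Fin m → ℝ ↦ Complex.exp (F y * Complex.I) := by fun_prop
  rw [charFunDual_apply, charFunDual_apply, integral_map hY hm.aestronglyMeasurable,
    integral_map hZ hm.aestronglyMeasurable]
  simp_rw [ha]
  exact h a

end GaussianField

/-! ### Both laws as images of Gaussian laws, and their distance. -/

section TotalVariation

open Matrix

variable {p : Params} {ic : InitialCondition} {Ω : Type*} [MeasurableSpace Ω] {P : Measure Ω}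
  [IsProbabilityMeasure P] {W : ℝ≥0 → p.L2 → Ω → ℝ} {X : ℝ → ℝ → Ω → ℝ}

omit [IsProbabilityMeasure P] in
lemma IsWeakSolution.aemeasurable_observation (hX : IsWeakSolution p ic P W X) {T : ℝ} (hT : 0 < T)
    (N : ℕ) {M : ℕ} (hM : 1 ≤ M) :
    AEMeasurable (fun ω (i : Fin (N + 1)) (k : Fin (M + 1)) ↦
      X ((i : ℕ) * T / N) ((k : ℕ) / M) ω) P := by
  refine aemeasurable_pi_lambda _ fun i ↦ aemeasurable_pi_lambda _ fun k ↦
    hX.aemeasurable _ (by positivity) _ ⟨by positivity, ?_⟩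
  rw [div_le_one (by positivity)]
  exact_mod_cast Nat.lt_succ_iff.1 k.2

/-- The level `L` is arbitrary here; the covariance is split at $LM$ only to expose the part shared
with `replacementLaw_eq`. -/
lemma IsWeakSolution.observationLaw_eq (hX : IsWeakSolution p ic P W X) {T : ℝ} (hT : 0 < T)
    (N : ℕ) {M : ℕ} (hM : 1 ≤ M) (L : ℕ) :
    observationLaw P X T N M = (multivariateGaussian 0
      (covarianceMatrix p ic (T / N) N M {l | L * M ≤ l} +
        covarianceMatrix p ic (T / N) N M {l | l < L * M})).map (gridField p) := by
  have hΔ : 0 ≤ T / N := by positivity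
  refine map_eq_map_of_expI (hX.aemeasurable_observation hT N hM)
    (measurable_gridField p N M).aemeasurable fun a ↦ ?_
  rw [expI_gridField p ((posSemidef_covarianceMatrix p ic hΔ N M _).add
    (posSemidef_covarianceMatrix p ic hΔ N M _)), ← tsum_modeForm_spatialForm p ic hΔ N hM L a]
  have h := hX.expI_observation (T / N).toNNReal N hM a
  rw [Real.coe_toNNReal _ hΔ] at h
  rw [← h]
  congr 1
  funext ω
  rw [Finset.sum_range]
  refine Finset.sum_congr rfl fun i _ ↦ ?_
  rw [Finset.sum_range]
  refine Finset.sum_congr rfl fun k _ ↦ ?_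
  rw [mul_div_assoc]

variable (p ic)

/-- The simulated modes reproduce the low-mode covariance exactly, and the tail becomes diagonal. -/
lemma replacementLaw_eq {T : ℝ} (hT : 0 < T) (N : ℕ) {M : ℕ} (hM : 1 ≤ M) (L : ℕ) :
    replacementLaw p ic T N M L = (multivariateGaussian 0
      (diagonal (fun x : GridIndex N M ↦ replacementScale p ic M L x.1.1 x.1.2 ^ 2) +
        covarianceMatrix p ic (T / N) N M {l | l < L * M})).map (gridField p) := by
  classical
  have hΔ : 0 ≤ T / N := by positivity
  refine map_eq_map_of_expI (measurable_replacementOutput p ic T N M L).aemeasurable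
    (measurable_gridField p N M).aemeasurable fun a ↦ ?_
  rw [expI_gridField p ((PosSemidef.diagonal fun x ↦ sq_nonneg _).add
    (posSemidef_covarianceMatrix p ic hΔ N M _)), add_mulVec, dotProduct_add,
    quadratic_low_modes p ic hΔ, add_comm (dotProduct _ _)]
  have h := expI_replacementOutput p ic T N L hM a
  have e : (fun x : GridIndex N M ↦ spatialForm p M a x.1.1 x.1.2) ⬝ᵥ
      diagonal (fun x : GridIndex N M ↦ replacementScale p ic M L x.1.1 x.1.2 ^ 2) *ᵥ
        (fun x : GridIndex N M ↦ spatialForm p M a x.1.1 x.1.2) =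
      ∑ m ∈ Finset.Ico 1 M, ∑ i ∈ Finset.range (N + 1),
        spatialForm p M a m i ^ 2 * replacementScale p ic M L m i ^ 2 := by
    rw [← Finset.sum_product' (Finset.Ico 1 M) (Finset.range (N + 1))
      (fun m i ↦ spatialForm p M a m i ^ 2 * replacementScale p ic M L m i ^ 2),
      ← Finset.sum_coe_sort (Finset.Ico 1 M ×ˢ Finset.range (N + 1))]
    simp only [dotProduct, mulVec_diagonal]
    exact Finset.sum_congr rfl fun x _ ↦ by ring
  rw [e]
  refine Eq.trans ?_ h
  congr 1
  funext w
  rw [Finset.sum_range]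
  refine Finset.sum_congr rfl fun i _ ↦ ?_
  rw [Finset.sum_range]
  rfl

variable {p ic}

/-- The law of the observations and that of the output of the replacement method are close if the
first replaced mode has a small autocorrelation. -/
lemma IsWeakSolution.tvClose (hX : IsWeakSolution p ic P W X) {T : ℝ} (hT : 0 < T) (N : ℕ) {M : ℕ}
    (hM : 1 ≤ M) (L : ℕ) (hθ : 4 * (N + 1) ^ 2 * modeDecay p (T / N) (L * M) ≤ 1 / 2) :
    TVClose (observationLaw P X T N M) (replacementLaw p ic T N M L)
      (8 * (M * (N + 1)) * √(4 * (N + 1) ^ 2 * modeDecay p (T / N) (L * M))) := by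
  have hΔ : 0 ≤ T / N := by positivity
  rw [hX.observationLaw_eq hT N hM L, replacementLaw_eq p ic hT N hM L]
  refine TVClose.map ?_ (measurable_gridField p N M)
  refine (tvClose_multivariateGaussian_of_relative (fun x ↦ sq_nonneg _)
    (posSemidef_covarianceMatrix p ic hΔ N M _) (isHermitian_covarianceMatrix p ic _ N M _)
    (mul_nonneg (by positivity) (modeDecay_nonneg _ _)) hθ
    (abs_quadratic_tail_sub_le p ic hΔ N M L)).mono ?_
  refine mul_le_mul_of_nonneg_right (mul_le_mul_of_nonneg_left ?_ (by norm_num)) (Real.sqrt_nonneg _)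
  -- There are $(M-1)(N+1)$ coefficients, at most $M(N+1)$.
  rw [Fintype.card_coe, Finset.card_product, Nat.card_Ico, Finset.card_range]
  exact_mod_cast Nat.mul_le_mul_right _ (Nat.sub_le M 1)

end TotalVariation

/-! ### The nonasymptotic bound. -/

section ExponentialBound

variable {p : Params} {ic : InitialCondition} {Ω : Type*} [MeasurableSpace Ω] {P : Measure Ω}
  [IsProbabilityMeasure P] {W : ℝ≥0 → p.L2 → Ω → ℝ} {X : ℝ → ℝ → Ω → ℝ}

/-- The total variation bound, for a lower bound `c ℓ²` of the eigenvalues. -/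
lemma IsWeakSolution.tvDist_le (hX : IsWeakSolution p ic P W X) {c : ℝ}
    (hc : ∀ l : ℕ, 1 ≤ l → c * (l : ℝ) ^ 2 ≤ p.eigenvalue l) {T : ℝ} (hT : 0 < T) {N M L : ℕ}
    (hN : 1 ≤ N) (hM : 1 ≤ M) (hL : 1 ≤ L) :
    tvDist (observationLaw P X T N M) (replacementLaw p ic T N M L) ≤
      3 * √((M : ℝ) * N) * Real.exp (-(c / 8 * (L : ℝ) ^ 2 * (M : ℝ) ^ 2 * (T / N))) := by
  have hN' : (1 : ℝ) ≤ N := by exact_mod_cast hN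
  have hM' : (1 : ℝ) ≤ M := by exact_mod_cast hM
  -- With the exponent $c/8$, the AR coefficient at the mode $LM$ is at most $g^8$, so
  -- $\sqrt\theta\le4Ng^4$ and the raw bound is $64MN^2g^4$.
  set g := Real.exp (-(c / 8 * (L : ℝ) ^ 2 * (M : ℝ) ^ 2 * (T / N))) with hg
  have hg0 : 0 < g := Real.exp_pos _
  set B := 3 * √((M : ℝ) * N) * g with hB
  have hB0 : 0 ≤ B := by positivity
  have hB2 : B ^ 2 = 9 * (M * N) * g ^ 2 := by
    rw [hB, mul_pow, mul_pow, Real.sq_sqrt (by positivity)]; ring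
  have hd : modeDecay p (T / N) (L * M) ≤ g ^ 8 := by
    rw [modeDecay, hg, ← Real.exp_nat_mul, Real.exp_le_exp]
    have h := mul_le_mul_of_nonneg_right (hc (L * M) (Nat.mul_pos hL hM))
      (show 0 ≤ T / N by positivity)
    push_cast at h ⊢
    linarith
  have hθ : 4 * ((N : ℝ) + 1) ^ 2 * modeDecay p (T / N) (L * M) ≤ (4 * N * g ^ 4) ^ 2 := by
    have h1 : ((N : ℝ) + 1) ^ 2 ≤ (2 * N) ^ 2 := pow_le_pow_left₀ (by positivity) (by linarith) 2
    calc _ ≤ 4 * (2 * (N : ℝ)) ^ 2 * g ^ 8 :=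
          mul_le_mul (mul_le_mul_of_nonneg_left h1 (by norm_num)) hd (modeDecay_nonneg _ _)
            (by positivity)
      _ = _ := by ring
  have hMN : (N : ℝ) ^ 2 ≤ M * N * (M * N) := by
    nlinarith [mul_le_mul hM' hM' zero_le_one (by linarith), sq_nonneg (N : ℝ)]
  have hB4 : 81 * (M * (N ^ 2 * g ^ 4)) ≤ B ^ 4 := by
    have e : B ^ 4 = 81 * (M * (M * (N ^ 2 * g ^ 4))) := by
      rw [show B ^ 4 = (B ^ 2) ^ 2 by ring, hB2]; ring
    rw [e]
    have : 0 ≤ M * (N ^ 2 * g ^ 4) := by positivity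
    nlinarith
  have : IsProbabilityMeasure (observationLaw P X T N M) :=
    Measure.isProbabilityMeasure_map (hX.aemeasurable_observation hT N hM)
  have : IsProbabilityMeasure (replacementLaw p ic T N M L) :=
    Measure.isProbabilityMeasure_map (measurable_replacementOutput p ic T N M L).aemeasurable
  -- For $B\ge1$ the claim is trivial. For $B<1$ the raw bound is at most $81MN^2g^4\le B^4\le B$,
  -- which improves the prefactor to $\sqrt{MN}$; the same inequality gives $81Ng^4\le1$ and hence
  -- $\theta\le1/2$.
  by_cases hB1 : 1 ≤ B
  · exact tvDist_le_of_close ((tvClose_one _ _).mono hB1)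
  push Not at hB1
  have hsmall : 81 * (M * (N ^ 2 * g ^ 4)) ≤ B :=
    hB4.trans (pow_le_of_le_one hB0 hB1.le (by norm_num))
  have hNg : 81 * (N * g ^ 4) ≤ 1 := by
    have h1 : (N : ℝ) * g ^ 4 ≤ M * (N ^ 2 * g ^ 4) := by
      have : 0 < (N : ℝ) * g ^ 4 := by positivity
      have h2 : (1 : ℝ) ≤ M * N := by nlinarith
      nlinarith
    linarith
  have hNg0 : 0 ≤ 4 * (N : ℝ) * g ^ 4 := by positivity
  refine tvDist_le_of_close ((hX.tvClose hT N hM L (hθ.trans ?_)).mono ?_)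
  · nlinarith
  · have h1 : √(4 * ((N : ℝ) + 1) ^ 2 * modeDecay p (T / N) (L * M)) ≤ 4 * N * g ^ 4 :=
      Real.sqrt_le_iff.2 ⟨hNg0, hθ⟩
    calc _ ≤ 8 * (M * (N + N : ℝ)) * (4 * N * g ^ 4) := by gcongr
      _ = 64 * (M * (N ^ 2 * g ^ 4)) := by ring
      _ ≤ 81 * (M * (N ^ 2 * g ^ 4)) := by
        have : 0 ≤ M * (N ^ 2 * g ^ 4) := by positivity
        linarith
      _ ≤ B := hsmall

end ExponentialBound

/-! ### Asymptotics of the bound. -/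

section Limits

/-- The prefactor is at most $Y^{(1+r)/2}$ and the exponential at most $e^{-c\kappa Y^s}$;
substituting $Y^s$ reduces to a power against an exponential. -/
lemma tendsto_sqrt_mul_exp {c κ r s : ℝ} (hc : 0 < c) (hκ : 0 < κ) (hs : 0 < s)
    {Y M N Q : ℕ → ℝ} (hY : Tendsto Y atTop atTop) (hM : ∀ᶠ n in atTop, M n ≤ Y n)
    (h0 : ∀ n, 0 ≤ N n) (hN : ∀ᶠ n in atTop, N n ≤ Y n ^ r)
    (hQ : ∀ᶠ n in atTop, κ * Y n ^ s ≤ Q n) :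
    Tendsto (fun n ↦ √(M n * N n) * Real.exp (-(c * Q n))) atTop (𝓝 0) := by
  have hlim := (tendsto_rpow_mul_exp_neg_mul_atTop_nhds_zero ((1 + r) / 2 / s) (c * κ)
    (mul_pos hc hκ)).comp ((tendsto_rpow_atTop hs).comp hY)
  refine squeeze_zero' (Eventually.of_forall fun n ↦ by positivity) ?_ hlim
  filter_upwards [hM, hN, hQ, hY.eventually_gt_atTop 0] with n h1 h2 h3 h4
  simp only [Function.comp_apply]
  rw [← Real.rpow_mul h4.le, mul_div_cancel₀ _ hs.ne']
  refine mul_le_mul ?_ (Real.exp_le_exp.2 ?_) (Real.exp_pos _).le (by positivity)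
  · rw [div_eq_mul_inv, Real.rpow_mul h4.le, ← one_div, ← Real.sqrt_eq_rpow, Real.rpow_add h4,
      Real.rpow_one]
    exact Real.sqrt_le_sqrt (mul_le_mul h1 h2 (h0 n) h4.le)
  · nlinarith

/-- With $Y=LM$, eventually $Y\Delta^\alpha\ge1$, that is, $\Delta\ge Y^{-1/\alpha}$, and
$N\Delta^{1+q}=T\Delta^q<1$. Hence $N\le Y^{(1+q)/\alpha}$ and $L^2M^2\Delta\ge Y^{2-1/\alpha}$. -/
lemma tendsto_sqrt_mul_exp_of_infill {c q α : ℝ} (hc : 0 < c) (hq : 0 < q) (hα : 1 / 2 < α)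
    {T : ℕ → ℝ} {N M L : ℕ → ℕ} (hT : ∀ n, 0 < T n) (hN : ∀ n, 1 ≤ N n)
    (hL : ∀ n, 1 ≤ L n)
    (h1 : Tendsto (fun n ↦ T n * (T n / N n) ^ q) atTop (𝓝 0))
    (h2 : Tendsto (fun n ↦ (L n : ℝ) * M n * (T n / N n) ^ α) atTop atTop) :
    Tendsto (fun n ↦ √((M n : ℝ) * N n) *
      Real.exp (-(c * ((L n : ℝ) ^ 2 * (M n : ℝ) ^ 2 * (T n / N n))))) atTop (𝓝 0) := by
  have hα0 : 0 < α := by linarith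
  have hN' : ∀ n, (1 : ℝ) ≤ N n := fun n ↦ by exact_mod_cast hN n
  have hΔ : ∀ n, 0 < T n / N n := fun n ↦ div_pos (hT n) (by linarith [hN' n])
  set Δ : ℕ → ℝ := fun n ↦ T n / N n with hΔ_def
  have hpow : ∀ n, (N n : ℝ) * Δ n ^ (1 + q) = T n * Δ n ^ q := by
    intro n
    rw [Real.rpow_add (hΔ n), Real.rpow_one, ← mul_assoc, hΔ_def]
    congr 1
    exact mul_div_cancel₀ _ (by linarith [hN' n])
  have hsmall : ∀ᶠ n in atTop, (N n : ℝ) * Δ n ^ (1 + q) < 1 := by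
    simp_rw [hpow]
    exact h1.eventually_lt_const one_pos
  -- Since $N\ge1$, a step $\Delta>1$ would contradict $N\Delta^{1+q}<1$. This is needed to deduce
  -- $LM\to\infty$ from $LM\Delta^\alpha\to\infty$.
  have hΔ1 : ∀ᶠ n in atTop, Δ n ≤ 1 := by
    filter_upwards [hsmall] with n hn
    by_contra! h
    have := Real.one_lt_rpow h (by linarith : 0 < 1 + q)
    nlinarith [hN' n]
  have hY : Tendsto (fun n ↦ (L n : ℝ) * M n) atTop atTop := by
    refine tendsto_atTop_mono' _ ?_ h2
    filter_upwards [hΔ1] with n hn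
    exact mul_le_of_le_one_right (by positivity) (Real.rpow_le_one (hΔ n).le hn hα0.le)
  have hYΔ : ∀ᶠ n in atTop, ((L n : ℝ) * M n) ^ (-α⁻¹) ≤ Δ n := by
    filter_upwards [h2.eventually_ge_atTop 1, hY.eventually_gt_atTop 0] with n hn hn0
    have h : ((L n : ℝ) * M n)⁻¹ ≤ Δ n ^ α := by
      rwa [inv_le_iff_one_le_mul₀' hn0]
    have := Real.rpow_le_rpow (inv_nonneg.2 hn0.le) h (inv_nonneg.2 hα0.le)
    rwa [Real.rpow_rpow_inv (hΔ n).le hα0.ne', Real.inv_rpow hn0.le, ← Real.rpow_neg hn0.le] at this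
  -- The place where $\alpha>1/2$ is decisive: the exponent in the lower bound of $L^2M^2\Delta$ is
  -- positive.
  have hs : 0 < 2 - α⁻¹ := by
    have : α⁻¹ < 2 := by
      rw [inv_lt_comm₀ hα0 two_pos]; linarith
    linarith
  refine tendsto_sqrt_mul_exp (r := α⁻¹ * (1 + q)) (κ := 1) hc one_pos hs hY
    (Eventually.of_forall fun n ↦ le_mul_of_one_le_left (by positivity) (by exact_mod_cast hL n))
    (fun n ↦ Nat.cast_nonneg _) ?_ ?_
  · filter_upwards [hsmall, hYΔ, hY.eventually_gt_atTop 0] with n hn1 hn2 hn0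
    have h := Real.rpow_le_rpow (by positivity) hn2 (by linarith : 0 ≤ 1 + q)
    rw [← Real.rpow_mul hn0.le, neg_mul, Real.rpow_neg hn0.le] at h
    have hp : 0 < ((L n : ℝ) * M n) ^ (α⁻¹ * (1 + q)) := by positivity
    have h3 := (mul_le_mul_of_nonneg_left h (Nat.cast_nonneg (N n))).trans hn1.le
    rwa [← div_eq_mul_inv, div_le_one hp] at h3
  · filter_upwards [hYΔ, hY.eventually_gt_atTop 0] with n hn hn0
    rw [one_mul, sub_eq_add_neg, Real.rpow_add hn0, ← mul_pow, Real.rpow_two]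
    exact mul_le_mul_of_nonneg_left hn (by positivity)

/-- Here $N$ need not tend to infinity, so $T\Delta^q\to0$ may fail and the infill statement does
not apply. Instead $N\le M^{1/\alpha}$ directly gives $M^2T/N\ge TM^{2-1/\alpha}$. -/
lemma tendsto_sqrt_mul_exp_of_fixed_horizon {c α T : ℝ} (hc : 0 < c) (hα : 1 / 2 < α) (hT : 0 < T)
    {N M : ℕ → ℕ} (hN : ∀ n, 1 ≤ N n)
    (h : Tendsto (fun n ↦ (M n : ℝ) / (N n : ℝ) ^ α) atTop atTop) :
    Tendsto (fun n ↦ √((M n : ℝ) * N n) *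
      Real.exp (-(c * ((M n : ℝ) ^ 2 * (T / N n))))) atTop (𝓝 0) := by
  have hα0 : 0 < α := by linarith
  have hN' : ∀ n, (1 : ℝ) ≤ N n := fun n ↦ by exact_mod_cast hN n
  have hM : Tendsto (fun n ↦ (M n : ℝ)) atTop atTop :=
    tendsto_atTop_mono (fun n ↦ div_le_self (Nat.cast_nonneg _)
      (Real.one_le_rpow (hN' n) hα0.le)) h
  have hNM : ∀ᶠ n in atTop, (N n : ℝ) ≤ (M n : ℝ) ^ α⁻¹ := by
    filter_upwards [h.eventually_ge_atTop 1] with n hn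
    have hp : 0 < (N n : ℝ) ^ α := Real.rpow_pos_of_pos (by linarith [hN' n]) _
    rw [one_le_div hp] at hn
    have := Real.rpow_le_rpow hp.le hn (inv_nonneg.2 hα0.le)
    rwa [Real.rpow_rpow_inv (by positivity) hα0.ne'] at this
  have hs : 0 < 2 - α⁻¹ := by
    have : α⁻¹ < 2 := by
      rw [inv_lt_comm₀ hα0 two_pos]; linarith
    linarith
  refine tendsto_sqrt_mul_exp (r := α⁻¹) hc hT hs hM (Eventually.of_forall fun n ↦ le_rfl)
    (fun n ↦ Nat.cast_nonneg _) hNM ?_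
  filter_upwards [hNM, hM.eventually_gt_atTop 0] with n hn hn0
  have hN0 : (0 : ℝ) < N n := by linarith [hN' n]
  rw [Real.rpow_sub hn0, Real.rpow_two, mul_div_assoc', mul_div_assoc', mul_comm T]
  exact div_le_div_of_nonneg_left (by positivity) hN0 hn

end Limits

end HeatSPDE

end

/-! ### The main theorem. -/

open HeatSPDE
theorem mainTheorem1 (p : Params) :
    (∃ c C : ℝ, 0 < c ∧ 0 < C ∧
      ∀ (ic : InitialCondition) (Ω : Type*) [MeasurableSpace Ω] (P : Measure Ω)
        [IsProbabilityMeasure P] (W : ℝ≥0 → p.L2 → Ω → ℝ) (X : ℝ → ℝ → Ω → ℝ),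
        IsWeakSolution p ic P W X →
        ∀ (T : ℝ) (N M L : ℕ), 0 < T → 1 ≤ N → 1 ≤ M → 1 ≤ L →
          tvDist (observationLaw P X T N M) (replacementLaw p ic T N M L) ≤
            C * √((M : ℝ) * N) * Real.exp (-(c * (L : ℝ) ^ 2 * (M : ℝ) ^ 2 * (T / N)))) ∧
    (∀ (ic : InitialCondition) (Ω : Type*) [MeasurableSpace Ω] (P : Measure Ω)
        [IsProbabilityMeasure P] (W : ℝ≥0 → p.L2 → Ω → ℝ) (X : ℝ → ℝ → Ω → ℝ),
        IsWeakSolution p ic P W X →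
        (∀ (T : ℕ → ℝ) (N M L : ℕ → ℕ),
          (∀ n, 0 < T n) → (∀ n, 1 ≤ N n) → (∀ n, 1 ≤ M n) → (∀ n, 1 ≤ L n) →
          (∃ q : ℝ, 0 < q ∧ Tendsto (fun n ↦ T n * (T n / N n) ^ q) atTop (𝓝 0)) →
          (∃ α : ℝ, 1 / 2 < α ∧
            Tendsto (fun n ↦ (L n : ℝ) * M n * (T n / N n) ^ α) atTop atTop) →
          Tendsto (fun n ↦ tvDist (observationLaw P X (T n) (N n) (M n))
            (replacementLaw p ic (T n) (N n) (M n) (L n))) atTop (𝓝 0)) ∧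
        (∀ (T : ℝ) (N M : ℕ → ℕ),
          0 < T → (∀ n, 1 ≤ N n) → (∀ n, 1 ≤ M n) →
          (∃ α : ℝ, 1 / 2 < α ∧
            Tendsto (fun n ↦ (M n : ℝ) / (N n : ℝ) ^ α) atTop atTop) →
          Tendsto (fun n ↦ tvDist (observationLaw P X T (N n) (M n))
            (replacementLaw p ic T (N n) (M n) 1)) atTop (𝓝 0))) := by
  -- The constant is fixed by the parameters alone, before the initial condition and the probability
  -- space are chosen.
  obtain ⟨c, hc0, hc⟩ := p.exists_eigenvalue_ge
  have hc8 : 0 < c / 8 := by positivity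
  refine ⟨⟨c / 8, 3, hc8, three_pos, fun ic Ω _ P _ W X hX T N M L hT hN hM hL ↦
    hX.tvDist_le hc hT hN hM hL⟩, fun ic Ω _ P _ W X hX ↦ ⟨?_, ?_⟩⟩
  · rintro T N M L hT hN hM hL ⟨q, hq, h1⟩ ⟨α, hα, h2⟩
    have h := (tendsto_sqrt_mul_exp_of_infill hc8 hq hα hT hN hL h1 h2).const_mul 3
    rw [mul_zero] at h
    refine squeeze_zero (fun n ↦ tvDist_nonneg _ _) (fun n ↦ ?_) h
    refine (hX.tvDist_le hc (hT n) (hN n) (hM n) (hL n)).trans_eq ?_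
    rw [mul_assoc]
    congr 4
    ring
  · rintro T N M hT hN hM ⟨α, hα, h⟩
    have h := (tendsto_sqrt_mul_exp_of_fixed_horizon hc8 hα hT hN h).const_mul 3
    rw [mul_zero] at h
    refine squeeze_zero (fun n ↦ tvDist_nonneg _ _) (fun n ↦ ?_) h
    refine (hX.tvDist_le hc hT (hN n) (hM n) le_rfl).trans_eq ?_
    rw [mul_assoc]
    congr 4
    push_cast
    ring
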